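/- Let $d,r,n$ be positive integers with $r\mid d$ and $n\ge 3$. Let $G(d,1,n)$ be the group generated by $s_1,\dots,s_n$ with defining relations $s_n^d=s_i^2=1$ ($1\le i\le n-1$); $s_is_j=s_js_i$ ($j+1<i\le n$); $s_{i+1}s_is_{i+1}=s_is_{i+1}s_i$ ($1\le i\le n-2$); $s_ns_{n-1}s_ns_{n-1}=s_{n-1}s_ns_{n-1}s_n$. Let $G(d,r,n)$ be the group generated by $\tilde s,\tilde s_1,\dots,\tilde s_n$ with defining relations $\tilde s^{d/r}=\tilde s_i^2=1$ ($1\le i\le n$); $\tilde s_i\tilde s_j=\tilde s_j\tilde s_i$ ($j+1<i\le n-1$); $\tilde s\tilde s_j=\tilde s_j\tilde s$ ($j\le n-2$); $\tilde s_n\tilde s_j=\tilde s_j\tilde s_n$ ($j\le n-3$); $\tilde s_{i+1}\tilde s_i\tilde s_{i+1}=\tilde s_i\tilde s_{i+1}\tilde s_i$ ($1\le i\le n-2$); $\tilde s\tilde s_n\tilde s_{n-1}=\tilde s_n\tilde s_{n-1}\tilde s$; $\tilde s_n\tilde s_{n-2}\tilde s_n=\tilde s_{n-2}\tilde s_n\tilde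 s_{n-2}$; $(\tilde s_n\tilde s_{n-1}\tilde s_{n-2})^2=(\tilde s_{n-2}\tilde s_n\tilde s_{n-1})^2$; $\tilde s\tilde s_n(\tilde s_{n-1}\tilde s_n)^{r-1}=\tilde s_{n-1}\tilde s$. Let $\tau:G(d,r,n)\to G(d,1,n)$ be the homomorphism (an embedding) with $\tau(\tilde s)=s_n^r$, $\tau(\tilde s_n)=s_n^{d-1}s_{n-1}s_n$ and $\tau(\tilde s_i)=s_i$ for $1\le i\le n-1$. A reduced word of $g\in G(d,1,n)$ is a word of minimal length in the letters $s_1,\dots,s_n$ (no inverses) that represents $g$. The element $g$ is *fully commutative* if any two of its reduced words can be transformed into each other by using only the relations $s_is_j=s_js_i$ with $j+1<i\le n$. An element $w\in G(d,r,n)$ is *fully commutative* if $\tau(w)$ is fully commutative in $G(d,1,n)$. Put $s_{ij}=s_is_{i-1}\cdots s_j$ for $i\ge j$, let $s_{ij}$ be the empty word for $i<j$, and put $s^{(k)}_{nj}=s_n^k s_{n-1,j}$. A *canonical word* is a word $$s_{1i_1}s_{2i_2}\cdots s_{n-1,i_{n-1}}\;s^{(k_1)}_{nj_1}\cdots s^{(k_\ell)}_{nj_\ell}$$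 with $1\le i_p\le p+1$, $\ell\ge0$, $1\le j_1<\dots<j_\ell\le n$ and $1\le k_p\le d-1$; its part $s^{(k_1)}_{nj_1}\cdots s^{(k_\ell)}_{nj_\ell}$ is its *suffix*. The *collection* labeled by a suffix is the set of all canonical words with this suffix that represent fully commutative elements of $G(d,1,n)$. The $(n,k)$-packet of $G(d,1,n)$, $0\le k\le n$, is the set of collections labeled by the following suffixes: for $k=0$, those with $\ell\ge2$ and $j_1=1$; for $1\le k\le n-2$, the suffixes $s^{(t)}_{nk}$ and those with $\ell\ge2$ and $j_1=k+1$; for $k=n-1$, the suffixes $s_n^{t}$ and $s^{(t)}_{n,n-1}$; for $k=n$, the empty suffix (here $1\le t\le d-1$). The packet $\mathcal P(n,k)$ of $G(d,r,n)$ is the set of those collections in the $(n,k)$-packet of $G(d,1,n)$ all of whose words represent elements of $\tau(G(d,r,n))$. Let $C_n=\frac1{n+1}\binom{2n}{n}$, let $C(n,k)=\frac{(n+k)!\,(n-k+1)}{k!\,(n+1)!}$ for $0\le k\le n$, and let $\mathfrak F_{n,k}(x)=\sum_{m=0}^{k}C(n,m)x^{k-m}$. Then the number of fully commutative elements of $G(d,r,n)$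 is equal to $$\sum_{k=0}^n C(n,k)\,|\mathcal P(n,k)|=\frac{d(d-1)}{r}\,\mathfrak F_{n,n-2}(d)+\Bigl(\frac{2d}{r}-1\Bigr)C_n-\Bigl(\frac dr-1\Bigr).$$ -/

import Mathlib

namespace ComplexReflection

/-- The index set `{1, …, n}` of the generators. -/
abbrev Letter (n : ℕ) : Type := {i : ℕ // 1 ≤ i ∧ i ≤ n}

/-! ### The group `G(d,1,n)` -/

/-- The defining relations `u = v` of `G(d,1,n)` on the generators `s_1, …, s_n`. -/
inductive Rel1 (d n : ℕ) : FreeGroup (Letter n) → FreeGroup (Letter n) → Prop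
  | pow_last (i : Letter n) (hi : i.1 = n) : Rel1 d n (FreeGroup.of i ^ d) 1
  | sq (i : Letter n) (hi : i.1 < n) : Rel1 d n (FreeGroup.of i ^ 2) 1
  | comm (i j : Letter n) (h : j.1 + 1 < i.1) :
      Rel1 d n (FreeGroup.of i * FreeGroup.of j) (FreeGroup.of j * FreeGroup.of i)
  | braid (i j : Letter n) (hj : j.1 = i.1 + 1) (hi : i.1 + 2 ≤ n) :
      Rel1 d n (FreeGroup.of j * FreeGroup.of i * FreeGroup.of j)
        (FreeGroup.of i * FreeGroup.of j * FreeGroup.of i)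
  | braid_last (i j : Letter n) (hi : i.1 = n) (hj : j.1 + 1 = n) :
      Rel1 d n (FreeGroup.of i * FreeGroup.of j * FreeGroup.of i * FreeGroup.of j)
        (FreeGroup.of j * FreeGroup.of i * FreeGroup.of j * FreeGroup.of i)

/-- The complex reflection group `G(d,1,n)`, given by its presentation. -/
abbrev G1 (d n : ℕ) : Type :=
  PresentedGroup {x : FreeGroup (Letter n) | ∃ u v, Rel1 d n u v ∧ x = u * v⁻¹}

/-- The generator `s_i` of `G(d,1,n)`, for `1 ≤ i ≤ n`. -/
def s (d n : ℕ) (i : Letter n) : G1 d n := PresentedGroup.of i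

/-! ### The group `G(d,r,n)` -/

/-- The generator `s̃_i` in the free group on `s̃` and `s̃_1, …, s̃_n`. -/
abbrev tl {n : ℕ} (i : Letter n) : FreeGroup (Option (Letter n)) := FreeGroup.of (some i)

/-- The generator `s̃` in the free group on `s̃` and `s̃_1, …, s̃_n`. -/
abbrev t0 {n : ℕ} : FreeGroup (Option (Letter n)) := FreeGroup.of none

/-- The defining relations `u = v` of `G(d,r,n)` on the generators `s̃` and `s̃_1, …, s̃_n`.
In the constructors `a`, `b`, `c` stand for the indices `n`, `n - 1`, `n - 2`. -/
inductive RelR (d r n : ℕ) :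
    FreeGroup (Option (Letter n)) → FreeGroup (Option (Letter n)) → Prop
  | pow_zero : RelR d r n (t0 ^ (d / r)) 1
  | sq (i : Letter n) : RelR d r n (tl i ^ 2) 1
  | comm (i j : Letter n) (h : j.1 + 1 < i.1) (hi : i.1 + 1 ≤ n) :
      RelR d r n (tl i * tl j) (tl j * tl i)
  | comm_zero (j : Letter n) (hj : j.1 + 2 ≤ n) : RelR d r n (t0 * tl j) (tl j * t0)
  | comm_last (a j : Letter n) (ha : a.1 = n) (hj : j.1 + 3 ≤ n) :
      RelR d r n (tl a * tl j) (tl j * tl a)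
  | braid (i j : Letter n) (hj : j.1 = i.1 + 1) (hi : i.1 + 2 ≤ n) :
      RelR d r n (tl j * tl i * tl j) (tl i * tl j * tl i)
  | zero_last (a b : Letter n) (ha : a.1 = n) (hb : b.1 + 1 = n) :
      RelR d r n (t0 * tl a * tl b) (tl a * tl b * t0)
  | braid_last (a c : Letter n) (ha : a.1 = n) (hc : c.1 + 2 = n) :
      RelR d r n (tl a * tl c * tl a) (tl c * tl a * tl c)
  | six (a b c : Letter n) (ha : a.1 = n) (hb : b.1 + 1 = n) (hc : c.1 + 2 = n) :
      RelR d r n ((tl a * tl b * tl c) ^ 2) ((tl c * tl a * tl b) ^ 2)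
  | long (a b : Letter n) (ha : a.1 = n) (hb : b.1 + 1 = n) :
      RelR d r n (t0 * tl a * (tl b * tl a) ^ (r - 1)) (tl b * t0)

/-- The complex reflection group `G(d,r,n)`, given by its presentation (for `r ∣ d`, `n ≥ 3`). -/
abbrev G (d r n : ℕ) : Type :=
  PresentedGroup {x : FreeGroup (Option (Letter n)) | ∃ u v, RelR d r n u v ∧ x = u * v⁻¹}

/-! ### The homomorphism `τ : G(d,r,n) → G(d,1,n)` -/

theorem s_rel {d n : ℕ} {u v : FreeGroup (Letter n)} (h : Rel1 d n u v) :
    FreeGroup.lift (s d n) u = FreeGroup.lift (s d n) v := by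
  have key : ∀ x : FreeGroup (Letter n),
      FreeGroup.lift (s d n) x = PresentedGroup.mk
        {x : FreeGroup (Letter n) | ∃ u v, Rel1 d n u v ∧ x = u * v⁻¹} x := by
    intro x
    have : FreeGroup.lift (s d n) = PresentedGroup.mk
        {x : FreeGroup (Letter n) | ∃ u v, Rel1 d n u v ∧ x = u * v⁻¹} := by
      ext i
      simp [s, PresentedGroup.of]
    rw [this]
  rw [key, key, ← mul_inv_eq_one, ← map_inv, ← map_mul]
  exact PresentedGroup.one_of_mem ⟨u, v, h, rfl⟩

section abstract_relations

variable {H : Type*} [Group H] {t p q : H}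

theorem commute_conj (h : t * p * t * p = p * t * p * t) :
    Commute t (p * t * p) := by
  change t * (p * t * p) = p * t * p * t
  rw [← h]; group

theorem rel_six (hp : p * p = 1) (hq : q * q = 1) (h : t * p * t * p = p * t * p * t)
    (htq : t * q = q * t) (hb : p * q * p = q * p * q) :
    (t⁻¹ * p * t * p * q) ^ 2 = (q * (t⁻¹ * p * t) * p) ^ 2 := by
  have hq' : q⁻¹ = q := inv_eq_of_mul_eq_one_left hq
  have hp' : p⁻¹ = p := inv_eq_of_mul_eq_one_left hp
  have htu : Commute t (p * t * p) := commute_conj h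
  have htw : Commute t (q * (p * t * p) * q) := by
    have e : q * t * q⁻¹ = t := by rw [← htq]; group
    have := (Commute.conj_iff q).2 htu
    rw [e, hq'] at this
    exact this
  have huw : Commute (p * t * p) (q * (p * t * p) * q) := by
    have := (Commute.conj_iff p).2 htw
    rw [hp'] at this
    have e : p * (q * (p * t * p) * q) * p = q * (p * t * p) * q := by
      calc p * (q * (p * t * p) * q) * p = (p * q * p) * t * (p * q * p) := by group
        _ = q * p * (q * t) * q * p * q := by rw [hb]; group
        _ = q * p * t * (q * q) * p * q := by rw [← htq]; group
        _ = q * (p * t * p) * q := by rw [hq]; group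
    rwa [e] at this
  have hv : Commute (t⁻¹ * (p * t * p)) (t⁻¹ * (q * (p * t * p) * q)) :=
    ((Commute.refl t).inv_inv.mul_right htw.inv_left).mul_left
      (htu.symm.inv_right.mul_right huw)
  have hqt : q * t⁻¹ = t⁻¹ * q := by
    have : Commute q t := htq.symm
    exact this.inv_right
  have e : q * (t⁻¹ * (p * t * p)) * q = t⁻¹ * (q * (p * t * p) * q) := by
    rw [← mul_assoc q, hqt]; group
  rw [← e] at hv
  calc (t⁻¹ * p * t * p * q) ^ 2
      = t⁻¹ * (p * t * p) * (q * (t⁻¹ * (p * t * p)) * q) := by rw [pow_two]; group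
    _ = q * (t⁻¹ * (p * t * p)) * q * (t⁻¹ * (p * t * p)) := hv
    _ = (q * (t⁻¹ * p * t) * p) ^ 2 := by rw [pow_two]; group

theorem rel_zero_last (h : t * p * t * p = p * t * p * t) (r : ℕ) :
    t ^ r * (t⁻¹ * p * t) * p = t⁻¹ * p * t * p * t ^ r := by
  have htu : Commute t (p * t * p) := commute_conj h
  have : Commute (t ^ r) (t⁻¹ * (p * t * p)) :=
    ((Commute.refl t).inv_right.mul_right htu).pow_left r
  calc t ^ r * (t⁻¹ * p * t) * p = t ^ r * (t⁻¹ * (p * t * p)) := by group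
    _ = t⁻¹ * (p * t * p) * t ^ r := this
    _ = _ := by group

theorem rel_long (hp : p * p = 1) (h : t * p * t * p = p * t * p * t) (r : ℕ) :
    t ^ (r + 1) * (t⁻¹ * p * t) * (p * (t⁻¹ * p * t)) ^ r = p * t ^ (r + 1) := by
  have hp' : p⁻¹ = p := inv_eq_of_mul_eq_one_left hp
  have htu : Commute t (p * t * p) := commute_conj h
  have e : p * (t⁻¹ * p * t) = (p * t * p)⁻¹ * t := by
    simp only [mul_inv_rev, hp']; group
  have hpt : p * t ^ (r + 1) = (p * t * p) ^ (r + 1) * p := by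
    have : (p * t * p⁻¹) ^ (r + 1) = p * t ^ (r + 1) * p⁻¹ := conj_pow
    rw [hp'] at this
    rw [this, mul_assoc _ p p, hp, mul_one]
  have hpt2 : ∀ m : ℕ, p * (p * t * p) ^ m = t ^ m * p := by
    intro m
    have : (p * t * p⁻¹) ^ m = p * t ^ m * p⁻¹ := conj_pow
    rw [hp'] at this
    rw [this, ← mul_assoc, ← mul_assoc, hp, one_mul]
  rw [e, (htu.symm.inv_left).mul_pow]
  have hc : Commute (t ^ (r + 1)) ((p * t * p)⁻¹ ^ r) := (htu.inv_right).pow_pow _ _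
  have step : p * t * ((p * t * p)⁻¹ ^ r * t ^ r) = p * t ^ (r + 1) * (p * t * p)⁻¹ ^ r := by
    rw [mul_assoc p (t ^ (r + 1)), hc.eq, mul_assoc p t, pow_succ' t r, ← mul_assoc t,
      ← mul_assoc ((p * t * p)⁻¹ ^ r) t, ((htu.inv_right).pow_right r).eq]
  calc t ^ (r + 1) * (t⁻¹ * p * t) * ((p * t * p)⁻¹ ^ r * t ^ r)
      = t ^ r * (p * t * ((p * t * p)⁻¹ ^ r * t ^ r)) := by
        rw [pow_succ]; group
    _ = t ^ r * (p * t ^ (r + 1) * (p * t * p)⁻¹ ^ r) := by rw [step]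
    _ = t ^ r * ((p * t * p) ^ (r + 1) * (p * (p * t * p)⁻¹ ^ r)) := by
        rw [hpt, mul_assoc]
    _ = t ^ r * ((p * t * p) ^ (r + 1) * (t⁻¹ ^ r * p)) := by
        congr 2
        rw [inv_pow, inv_pow, eq_inv_mul_iff_mul_eq, ← mul_assoc, ← hpt2 r]; group
    _ = (p * t * p) ^ (r + 1) * p := by
        rw [← mul_assoc, (htu.pow_pow r (r + 1)).eq]; group
    _ = p * t ^ (r + 1) := hpt.symm

end abstract_relations

/-- The index `n`. -/
def lastL (n : ℕ) (hn : 3 ≤ n) : Letter n := ⟨n, by omega, le_rfl⟩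

/-- The index `n - 1`. -/
def predL (n : ℕ) (hn : 3 ≤ n) : Letter n := ⟨n - 1, by omega, by omega⟩

/-- The images of the generators under `τ`:  `s̃ ↦ s_n ^ r`, `s̃_n ↦ s_n ^ (d-1) s_{n-1} s_n` and
`s̃_i ↦ s_i` for `1 ≤ i ≤ n - 1`. -/
def tauGen (d r n : ℕ) (hn : 3 ≤ n) : Option (Letter n) → G1 d n
  | none => s d n (lastL n hn) ^ r
  | some i =>
      if i.1 = n then
        s d n (lastL n hn) ^ (d - 1) * s d n (predL n hn) *
          s d n (lastL n hn)
      else s d n i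

theorem tauGen_rel (d r n : ℕ) (hd : 0 < d) (hr : r ∣ d) (hn : 3 ≤ n)
    {u v : FreeGroup (Option (Letter n))} (h : RelR d r n u v) :
    FreeGroup.lift (tauGen d r n hn) u = FreeGroup.lift (tauGen d r n hn) v := by
  have hsq : ∀ i : Letter n, i.1 < n → s d n i * s d n i = 1 := by
    intro i hi
    simpa [pow_two] using s_rel (Rel1.sq (d := d) i hi)
  have hcomm : ∀ i j : Letter n, j.1 + 1 < i.1 → s d n i * s d n j = s d n j * s d n i := by
    intro i j hij
    simpa using s_rel (Rel1.comm (d := d) i j hij)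
  have hbraid : ∀ i j : Letter n, j.1 = i.1 + 1 → i.1 + 2 ≤ n →
      s d n j * s d n i * s d n j = s d n i * s d n j * s d n i := by
    intro i j hij hi
    simpa using s_rel (Rel1.braid (d := d) i j hij hi)
  have elast : ∀ a : Letter n, a.1 = n → a = (lastL n hn) := fun a ha => Subtype.ext ha
  have epred : ∀ b : Letter n, b.1 + 1 = n → b = (predL n hn) :=
    fun b hb => Subtype.ext (by simp [lastL, predL]; omega)
  have hg0 : tauGen d r n hn none = s d n (lastL n hn) ^ r := rfl
  have hglt : ∀ i : Letter n, i.1 < n → tauGen d r n hn (some i) = s d n i := by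
    intro i hi
    simp [tauGen, hi.ne]
  have hgn : ∀ a : Letter n, a.1 = n → tauGen d r n hn (some a) =
      (s d n (lastL n hn))⁻¹ * s d n (predL n hn) *
        s d n (lastL n hn) := by
    intro a ha
    have hpow : s d n (lastL n hn) ^ d = 1 := by
      simpa using s_rel (Rel1.pow_last (d := d) (lastL n hn) rfl)
    have : s d n (lastL n hn) ^ (d - 1) = (s d n (lastL n hn))⁻¹ := by
      apply eq_inv_of_mul_eq_one_left
      rw [← pow_succ, Nat.sub_add_cancel hd, hpow]
    simp [tauGen, ha, this]
  have hpow : s d n (lastL n hn) ^ d = 1 := by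
    simpa using s_rel (Rel1.pow_last (d := d) (lastL n hn) rfl)
  have hp := hsq (predL n hn) (by simp [lastL, predL]; omega)
  have hB : s d n (lastL n hn) * s d n (predL n hn) *
      s d n (lastL n hn) * s d n (predL n hn) =
      s d n (predL n hn) * s d n (lastL n hn) *
      s d n (predL n hn) * s d n (lastL n hn) := by
    simpa using s_rel (Rel1.braid_last (d := d) (lastL n hn)
      (predL n hn) rfl (by simp [lastL, predL]; omega))
  have hcl : ∀ j : Letter n, j.1 + 2 ≤ n →
      s d n (lastL n hn) * s d n j = s d n j * s d n (lastL n hn) :=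
    fun j hj => hcomm _ j (by simp [lastL, predL]; omega)
  have hcp : ∀ j : Letter n, j.1 + 3 ≤ n →
      s d n (predL n hn) * s d n j =
        s d n j * s d n (predL n hn) :=
    fun j hj => hcomm _ j (by simp [lastL, predL]; omega)
  have hbc : ∀ c : Letter n, c.1 + 2 = n →
      s d n (predL n hn) * s d n c * s d n (predL n hn) =
        s d n c * s d n (predL n hn) * s d n c :=
    fun c hc => hbraid c _ (by simp [lastL, predL]; omega) (by omega)
  generalize s d n (lastL n hn) = t at hg0 hgn hpow hB hcl
  have hglb : ∀ b : Letter n, b.1 + 1 = n →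
      tauGen d r n hn (some b) = s d n (predL n hn) := by
    intro b hb
    rw [hglt b (by omega), epred b hb]
  generalize s d n (predL n hn) = p at hgn hp hB hcp hbc hglb
  cases h with
  | pow_zero =>
      simp only [map_pow, FreeGroup.lift_apply_of, map_one, hg0]
      rw [← pow_mul, Nat.mul_div_cancel' hr, hpow]
  | sq i =>
      simp only [pow_two, map_mul, FreeGroup.lift_apply_of, map_one]
      rcases lt_or_eq_of_le i.2.2 with hi | hi
      · rw [hglt i hi, hsq i hi]
      · rw [hgn i hi]
        calc t⁻¹ * p * t * (t⁻¹ * p * t) = t⁻¹ * (p * p) * t := by group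
          _ = 1 := by rw [hp]; group
  | comm i j h hi =>
      simp only [map_mul, FreeGroup.lift_apply_of]
      rw [hglt i (by omega), hglt j (by omega), hcomm i j h]
  | comm_zero j hj =>
      simp only [map_mul, FreeGroup.lift_apply_of]
      rw [hg0, hglt j (by omega)]
      exact Commute.pow_left (hcl j hj) r
  | comm_last a j ha hj =>
      simp only [map_mul, FreeGroup.lift_apply_of]
      rw [hgn a ha, hglt j (by omega)]
      have h1 : Commute t (s d n j) := hcl j (by omega)
      have h2 : Commute p (s d n j) := hcp j hj
      exact ((h1.inv_left.mul_left h2).mul_left h1)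
  | braid i j hj hi =>
      simp only [map_mul, FreeGroup.lift_apply_of]
      rw [hglt i (by omega), hglt j (by omega), hbraid i j hj hi]
  | zero_last a b ha hb =>
      simp only [map_mul, FreeGroup.lift_apply_of]
      rw [hg0, hgn a ha, hglb b hb]
      exact rel_zero_last hB r
  | braid_last a c ha hc =>
      simp only [map_mul, FreeGroup.lift_apply_of]
      rw [hgn a ha, hglt c (by omega)]
      have h1 : Commute t (s d n c) := hcl c (by omega)
      have h2 := hbc c hc
      generalize s d n c = q at *
      have h3 : t * q * t⁻¹ = q := by rw [h1.eq]; group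
      have h4 : t⁻¹ * q = q * t⁻¹ := h1.inv_left
      calc t⁻¹ * p * t * q * (t⁻¹ * p * t) = t⁻¹ * p * (t * q * t⁻¹) * p * t := by group
        _ = t⁻¹ * (p * q * p) * t := by rw [h3]; group
        _ = t⁻¹ * q * p * (q * t) := by rw [h2]; group
        _ = q * (t⁻¹ * p * t) * q := by rw [h4, ← h1.eq]; group
  | six a b c ha hb hc =>
      simp only [map_mul, map_pow, FreeGroup.lift_apply_of]
      rw [hgn a ha, hglb b hb, hglt c (by omega)]
      exact rel_six hp (hsq c (by omega)) hB (hcl c (by omega)) (hbc c hc)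
  | long a b ha hb =>
      simp only [map_mul, map_pow, FreeGroup.lift_apply_of]
      rw [hg0, hgn a ha, hglb b hb]
      obtain ⟨m, rfl⟩ : ∃ m, r = m + 1 :=
        ⟨r - 1, by have := Nat.pos_of_dvd_of_pos hr hd; omega⟩
      exact rel_long hp hB m

/-- The homomorphism `τ : G(d,r,n) → G(d,1,n)`. -/
def tau (d r n : ℕ) (hd : 0 < d) (hr : r ∣ d) (hn : 3 ≤ n) : G d r n →* G1 d n :=
  PresentedGroup.toGroup (f := tauGen d r n hn) (by
    rintro _ ⟨u, v, h, rfl⟩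
    rw [map_mul, map_inv, tauGen_rel d r n hd hr hn h, mul_inv_cancel])

/-! ### Fully commutative elements -/

/-- The element of `G(d,1,n)` expressed by a word in `s_1, …, s_n`. -/
def evalWord (d n : ℕ) (w : List (Letter n)) : G1 d n := (w.map (s d n)).prod

/-- The set `R(g)` of reduced expressions of `g`: the words of minimal length expressing `g`. -/
def reducedWords (d n : ℕ) (g : G1 d n) : Set (List (Letter n)) :=
  {w | evalWord d n w = g ∧ ∀ v, evalWord d n v = g → w.length ≤ v.length}

/-- One application of `s_i s_j = s_j s_i`, `j + 1 < i`, inside a word. -/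
def CommStep (n : ℕ) (u v : List (Letter n)) : Prop :=
  ∃ (x y : List (Letter n)) (i j : Letter n), j.1 + 1 < i.1 ∧
    u = x ++ [i, j] ++ y ∧ v = x ++ [j, i] ++ y

/-- Two words lie in the same commutativity class. -/
def CommEquiv (n : ℕ) : List (Letter n) → List (Letter n) → Prop :=
  Relation.EqvGen (CommStep n)

/-- `g` is fully commutative: its reduced expressions form a single commutativity class. -/
def IsFullyCommutative (d n : ℕ) (g : G1 d n) : Prop :=
  ∀ u ∈ reducedWords d n g, ∀ v ∈ reducedWords d n g, CommEquiv n u v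

/-! ### Canonical words, collections and packets -/

/-- The word `s_{ij} = [i, i-1, …, j]` (empty for `i < j`). -/
def desc (i j : ℕ) : List ℕ := (List.range' j (i + 1 - j)).reverse

/-- The prefix `s_{1 i_1} s_{2 i_2} ⋯ s_{n-1 i_{n-1}}`. -/
def prefixWord (n : ℕ) (i : ℕ → ℕ) : List ℕ :=
  (List.range' 1 (n - 1)).flatMap fun p => desc p (i p)

/-- The suffix `s^{(k_1)}_{n j_1} ⋯ s^{(k_ℓ)}_{n j_ℓ}` with `σ = [(j_1, k_1), …, (j_ℓ, k_ℓ)]`,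
where `s^{(k)}_{n j} = s_n ^ k s_{n-1, j}`. -/
def suffixWord (n : ℕ) (σ : List (ℕ × ℕ)) : List ℕ :=
  σ.flatMap fun x => List.replicate x.2 n ++ desc (n - 1) x.1

/-- `1 ≤ i_p ≤ p + 1` for `1 ≤ p ≤ n - 1`. -/
def IsPrefixData (n : ℕ) (i : ℕ → ℕ) : Prop :=
  ∀ p, 1 ≤ p → p + 1 ≤ n → 1 ≤ i p ∧ i p ≤ p + 1

/-- `1 ≤ j_1 < ⋯ < j_ℓ ≤ n` and `1 ≤ k_p ≤ d - 1`. -/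
def IsSuffixData (d n : ℕ) (σ : List (ℕ × ℕ)) : Prop :=
  (σ.map Prod.fst).Pairwise (· < ·) ∧
    ∀ x ∈ σ, 1 ≤ x.1 ∧ x.1 ≤ n ∧ 1 ≤ x.2 ∧ x.2 < d

/-- The collection labeled by the suffix `σ`: the canonical words with suffix `σ` that express
fully commutative elements of `G(d,1,n)`. -/
def collection (d n : ℕ) (σ : List (ℕ × ℕ)) : Set (List (Letter n)) :=
  {w | (∃ i, IsPrefixData n i ∧ w.map Subtype.val = prefixWord n i ++ suffixWord n σ) ∧
    IsFullyCommutative d n (evalWord d n w)}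

/-- The labels of the collections in the `(n,k)`-packet. -/
def packetLabels (d n k : ℕ) : Set (List (ℕ × ℕ)) :=
  {σ | IsSuffixData d n σ ∧
    ((k + 2 ≤ n ∧ 2 ≤ σ.length ∧ ∃ t, σ.head? = some (k + 1, t)) ∨
     (1 ≤ k ∧ k + 2 ≤ n ∧ ∃ t, σ = [(k, t)]) ∨
     (k + 1 = n ∧ ∃ t, σ = [(n, t)] ∨ σ = [(n - 1, t)]) ∨
     (k = n ∧ σ = []))}

/-- The `(n,k)`-packet of `G(d,1,n)`, a set of collections. -/
def packet1 (d n k : ℕ) : Set (Set (List (Letter n))) :=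
  collection d n '' packetLabels d n k

/-- The `(n,k)`-packet of `G(d,r,n)`: the collections in the `(n,k)`-packet of `G(d,1,n)` that are
contained in (the image under `τ` of) `G(d,r,n)`. -/
def packet (d r n : ℕ) (hd : 0 < d) (hr : r ∣ d) (hn : 3 ≤ n) (k : ℕ) :
    Set (Set (List (Letter n))) :=
  {c ∈ packet1 d n k | ∀ w ∈ c, evalWord d n w ∈ (tau d r n hd hr hn).range}

/-! ### Catalan triangle -/

/-- The Catalan triangle number `C(n,k) = (n+k)! (n-k+1) / (k! (n+1)!)`, for `0 ≤ k ≤ n`. -/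
def catalanTriangle (n k : ℕ) : ℚ :=
  ((n + k).factorial * ((n : ℚ) - k + 1)) / (k.factorial * (n + 1).factorial)

/-- The Catalan triangle polynomial `𝔉_{n,k}(x) = ∑_{m=0}^{k} C(n,m) x^{k-m}`. -/
noncomputable def catalanTrianglePoly (n k : ℕ) : Polynomial ℚ :=
  ∑ m ∈ Finset.range (k + 1), Polynomial.C (catalanTriangle n m) * Polynomial.X ^ (k - m)

end ComplexReflection

/-! The count rests on a normal form for G(d,1,n). Every element is expressed by exactly one
canonical word, and that word is reduced. Existence comes from appending one letter to a canonical
word (`step`): the result is again canonical, at most one letter longer, so a canonical word is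
never longer than the word it replaces (`exists_canon`). Uniqueness is read off from the action by
monomial transformations (`canon_injective`).

An element is fully commutative exactly when its canonical word is `Good`
(`isFullyCommutative_iff_good`). For sufficiency, the appending procedure is followed at the same
time in the trace monoid, where only distant letters commute. If the length grows and the new word
is good, the old word was good and the letter was absorbed by commutations alone; by induction every
reduced word of the element is commutation equivalent to the canonical one. For necessity, each
violation of goodness lets one move a letter through a descending factor, or a power of s_n past a
conjugate of another power of s_n. This yields a second reduced word, told apart from the first by
its subword in two neighbouring letters, which commutations preserve. Word identities are stated for
arbitrary monoids so that they serve in the group, the trace monoid and the permutation group.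

The map τ is injective because G(d,r,n) has an automorphism `rot`, modelling conjugation by s_n,
whose r-th power is an inner automorphism by s̃; adjoining an r-th root of s̃ gives a group onto
which the relations of G(d,1,n) can be mapped (`tau_injective`). Its image consists of the elements
whose words contain a number of letters s_n divisible by r (`mem_range_tau_iff`), a condition on the
suffix only.

The number of good prefixes of a given suffix depends only on the packet of the suffix and satisfies
the recurrence of the Catalan triangle (`card_goodF`); this gives the first equality. Exponent sums
are equidistributed modulo r (`mul_resCount`), which gives the packet sizes (`mul_card_packet`) and
then the closed formula (`sum_packet`). -/

namespace ComplexReflection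

/-! ### `τ` is injective -/

/-- A group with an automorphism `φ` whose `r`-th power is conjugation by a fixed point `z` embeds
in a group where `φ` is conjugation by an `r`-th root of `z`. -/
theorem exists_cyclic_extension {A : Type} [Group A] (φ : MulAut A) (z : A) (r : ℕ) (hr : 0 < r)
    (hz : φ z = z) (h : ∀ g, (φ ^ r) g = z⁻¹ * g * z) :
    ∃ (K : Type) (_ : Group K) (ι : A →* K) (t : K), Function.Injective ι ∧ t ^ r = ι z ∧
      ∀ g, ι (φ g) = t⁻¹ * ι g * t := by
  obtain ⟨S, _, j, u, ρ, hj, hρj, hρu, hconj, hgen⟩ : ∃ (S : Type) (_ : Group S) (j : A →* S)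
      (u : S) (ρ : S →* Multiplicative ℤ), Function.Injective j ∧ (∀ g, ρ (j g) = 1) ∧
      ρ u = Multiplicative.ofAdd 1 ∧ (∀ g, u * j g = j (φ g) * u) ∧
      ∀ x, ∃ g, ∃ k : ℤ, x = j g * u ^ k := by
    refine ⟨A ⋊[zpowersHom (MulAut A) φ] Multiplicative ℤ, inferInstance, SemidirectProduct.inl,
      SemidirectProduct.inr (Multiplicative.ofAdd 1), SemidirectProduct.rightHom,
      SemidirectProduct.inl_injective, fun g => SemidirectProduct.rightHom_inl g,
      SemidirectProduct.rightHom_inr _, fun g => ?_, fun x => ⟨x.left, x.right.toAdd, ?_⟩⟩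
    · have : φ g = zpowersHom (MulAut A) φ (Multiplicative.ofAdd 1) g := by simp
      rw [this, SemidirectProduct.inl_aut]
      simp
    · rw [← map_zpow, ← ofAdd_zsmul]
      simp
  have hconjk : ∀ (k : ℕ) g, u ^ k * j g = j ((φ ^ k) g) * u ^ k := by
    intro k
    induction k with
    | zero => intro g; simp
    | succ k ih =>
      intro g
      rw [pow_succ, mul_assoc, hconj, ← mul_assoc, ih, pow_succ φ, MulAut.mul_apply, mul_assoc]
  -- This element is central, since conjugation by u ^ r on the base group is undone by that of z.
  -- Killing it makes u⁻¹ an r-th root of z. The base group still embeds, because the k-th power of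
  -- c has integer coordinate k r, which vanishes only for k = 0.
  obtain ⟨c, hc⟩ : ∃ c, c = j z * u ^ r := ⟨_, rfl⟩
  have hzu : Commute (j z) u := by
    have := hconj z
    rw [hz] at this
    exact this.symm
  have hc1 : Commute c u := by
    rw [hc]
    exact hzu.mul_left ((Commute.refl u).pow_left r)
  have hc2 : ∀ g, Commute c (j g) := by
    intro g
    change c * j g = j g * c
    rw [hc, mul_assoc, hconjk, h, ← mul_assoc, ← mul_assoc, ← map_mul, ← map_mul]
    congr 2
    group
  have hcomm : ∀ x : S, Commute c x := by
    intro x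
    obtain ⟨g, k, rfl⟩ := hgen x
    exact (hc2 g).mul_right (hc1.zpow_right k)
  have hN : (Subgroup.zpowers c).Normal := by
    constructor
    intro y hy x
    obtain ⟨k, rfl⟩ := Subgroup.mem_zpowers_iff.1 hy
    rw [← ((hcomm x).zpow_left k).eq, mul_inv_cancel_right]
    exact hy
  refine ⟨S ⧸ Subgroup.zpowers c, inferInstance,
    (QuotientGroup.mk' (Subgroup.zpowers c)).comp j,
    QuotientGroup.mk' (Subgroup.zpowers c) u⁻¹, ?_, ?_, ?_⟩
  · rw [injective_iff_map_eq_one]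
    intro g hg
    have hg' : j g ∈ Subgroup.zpowers c := by
      simpa using hg
    obtain ⟨k, hk⟩ := Subgroup.mem_zpowers_iff.1 hg'
    have h2 := congrArg (fun x => (ρ x).toAdd) hk
    simp only [map_zpow, hc, map_mul, hρj, map_pow, hρu, toAdd_zpow, toAdd_mul, toAdd_one,
      toAdd_pow, toAdd_ofAdd, zero_add, smul_eq_mul, mul_one, nsmul_eq_mul] at h2
    have hk0 : k = 0 := by
      rcases mul_eq_zero.1 h2 with h | h
      · exact h
      · omega
    rw [hk0, zpow_zero] at hk
    exact hj (by rw [← hk, map_one])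
  · rw [← map_pow, MonoidHom.comp_apply, QuotientGroup.mk'_apply, QuotientGroup.mk'_apply,
      QuotientGroup.eq]
    have : (u⁻¹ ^ r)⁻¹ * j z = c := by
      rw [inv_pow, inv_inv, ← (hzu.pow_right r).eq, hc]
    rw [this]
    exact Subgroup.mem_zpowers c
  · intro g
    simp only [MonoidHom.comp_apply]
    rw [← map_inv, ← map_mul, ← map_mul]
    congr 1
    rw [inv_inv, hconj, mul_inv_cancel_right]

/-! ### Conjugation by s_n inside the presented group G(d,r,n) -/

section conjugation_endomorphism

variable {H : Type*} [Group H] {z p q c : H}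

/-- With q, p, c standing for s̃_n, s̃_{n-1}, s̃_{n-2}, the element q p q is what conjugation by s_n
makes of s̃_n. The braid relation of q and c must survive this conjugation, and the six-letter
relation is exactly what makes it do so. -/
theorem conj_braid (hp : p * p = 1) (hq : q * q = 1) (hc : c * c = 1)
    (h1 : p * c * p = c * p * c) (h2 : q * c * q = c * q * c)
    (h6 : (q * p * c) ^ 2 = (c * q * p) ^ 2) :
    q * p * q * c * (q * p * q) = c * (q * p * q) * c := by
  have h3 : p * c * p * c * p = c := by
    rw [h1, mul_assoc (c * p) c c, hc, mul_one, mul_assoc, hp, mul_one]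
  have h6' : q * p * c * q * p * c = c * q * p * c * q * p := by
    simpa only [pow_two, ← mul_assoc] using h6
  calc q * p * q * c * (q * p * q) = q * p * (q * c * q) * p * q := by group
    _ = q * p * c * q * (c * p * q) := by rw [h2]; group
    _ = (q * p * c * q * p * c) * c⁻¹ * p⁻¹ * c * p * q := by group
    _ = c * q * p * c * q * (p * c * p * c * p) * q := by
        rw [h6', inv_eq_of_mul_eq_one_left hc, inv_eq_of_mul_eq_one_left hp]; group
    _ = c * q * p * (c * q * c) * q := by rw [h3]; group
    _ = c * q * p * q * c * (q * q) := by rw [← h2]; group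
    _ = c * (q * p * q) * c := by rw [hq]; group

end conjugation_endomorphism

section

variable (d r n : ℕ)

/-- The generators of `G(d,r,n)`. -/
def gen (o : Option (Letter n)) : G d r n := PresentedGroup.of o

theorem gen_rel {u v : FreeGroup (Option (Letter n))} (h : RelR d r n u v) :
    FreeGroup.lift (gen d r n) u = FreeGroup.lift (gen d r n) v := by
  have key : FreeGroup.lift (gen d r n) = PresentedGroup.mk
      {x : FreeGroup (Option (Letter n)) | ∃ u v, RelR d r n u v ∧ x = u * v⁻¹} := by
    ext i
    simp [gen, PresentedGroup.of]
  rw [key]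
  exact PresentedGroup.mk_eq_mk_of_mul_inv_mem ⟨u, v, h, rfl⟩

/-- The images of the generators under conjugation by `s_n`. -/
def rotGen (hn : 3 ≤ n) : Option (Letter n) → G d r n
  | none => gen d r n none
  | some i =>
      if i.1 = n then gen d r n (some (lastL n hn)) * gen d r n (some (predL n hn)) *
        gen d r n (some (lastL n hn))
      else if i.1 + 1 = n then gen d r n (some (lastL n hn))
      else gen d r n (some i)

variable {d r n}

theorem gen_long (hn : 3 ≤ n) :
    gen d r n none * gen d r n (some (lastL n hn)) *
      (gen d r n (some (predL n hn)) * gen d r n (some (lastL n hn))) ^ (r - 1) =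
    gen d r n (some (predL n hn)) * gen d r n none := by
  simpa using gen_rel d r n (RelR.long (lastL n hn) (predL n hn) rfl
    (by simp [predL]; omega))

theorem gen_zero_last (hn : 3 ≤ n) :
    gen d r n none * gen d r n (some (lastL n hn)) * gen d r n (some (predL n hn)) =
    gen d r n (some (lastL n hn)) * gen d r n (some (predL n hn)) * gen d r n none := by
  simpa using gen_rel d r n (RelR.zero_last (lastL n hn) (predL n hn) rfl
    (by simp [predL]; omega))

theorem gen_sq (i : Letter n) : gen d r n (some i) * gen d r n (some i) = 1 := by
  simpa [pow_two] using gen_rel d r n (RelR.sq i)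

/-- Most relations are carried to relations of the same list, up to cancelling q q = 1 for q = s̃_n.
Two need more: the braid relation of s̃_n and s̃_{n-2} becomes `conj_braid`, and the image of the
long relation follows by first moving s̃ past s̃_n s̃_{n-1}. -/
theorem rotGen_rel (hn : 3 ≤ n)
    {u v : FreeGroup (Option (Letter n))} (h : RelR d r n u v) :
    FreeGroup.lift (rotGen d r n hn) u = FreeGroup.lift (rotGen d r n hn) v := by
  have elast : ∀ a : Letter n, a.1 = n → a = lastL n hn := fun a ha => Subtype.ext ha
  have epred : ∀ b : Letter n, b.1 + 1 = n → b = predL n hn :=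
    fun b hb => Subtype.ext (by simp [predL]; omega)
  have hlast : (lastL n hn).1 = n := rfl
  have hpred : (predL n hn).1 + 1 = n := by simp [predL]; omega
  have hq2 := gen_sq (d := d) (r := r) (lastL n hn)
  have hp2 := gen_sq (d := d) (r := r) (predL n hn)
  have hzl := gen_zero_last (d := d) (r := r) hn
  have hlong := gen_long (d := d) (r := r) hn
  have hg0 : rotGen d r n hn none = gen d r n none := rfl
  have hgn : rotGen d r n hn (some (lastL n hn)) = gen d r n (some (lastL n hn)) *
      gen d r n (some (predL n hn)) * gen d r n (some (lastL n hn)) := by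
    simp [rotGen, hlast]
  have hgp : rotGen d r n hn (some (predL n hn)) = gen d r n (some (lastL n hn)) := by
    simp only [rotGen, if_neg (show (predL n hn).1 ≠ n by omega), if_pos hpred]
  have hglt : ∀ i : Letter n, i.1 + 2 ≤ n →
      rotGen d r n hn (some i) = gen d r n (some i) := by
    intro i hi
    simp only [rotGen, if_neg (show i.1 ≠ n by omega), if_neg (show i.1 + 1 ≠ n by omega)]
  have hql : ∀ j : Letter n, j.1 + 3 ≤ n →
      Commute (gen d r n (some (lastL n hn))) (gen d r n (some j)) := by
    intro j hj
    have := gen_rel d r n (RelR.comm_last (lastL n hn) j rfl hj)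
    simp only [map_mul, FreeGroup.lift_apply_of] at this
    exact this
  have hpl : ∀ j : Letter n, j.1 + 3 ≤ n →
      Commute (gen d r n (some (predL n hn))) (gen d r n (some j)) := by
    intro j hj
    have := gen_rel d r n (RelR.comm (predL n hn) j (by omega) (by omega))
    simp only [map_mul, FreeGroup.lift_apply_of] at this
    exact this
  have hqc : ∀ c : Letter n, c.1 + 2 = n → gen d r n (some (lastL n hn)) * gen d r n (some c) *
      gen d r n (some (lastL n hn)) =
      gen d r n (some c) * gen d r n (some (lastL n hn)) * gen d r n (some c) := by
    intro c hc
    simpa using gen_rel d r n (RelR.braid_last (lastL n hn) c rfl hc)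
  have hpc : ∀ c : Letter n, c.1 + 2 = n → gen d r n (some (predL n hn)) * gen d r n (some c) *
      gen d r n (some (predL n hn)) =
      gen d r n (some c) * gen d r n (some (predL n hn)) * gen d r n (some c) := by
    intro c hc
    simpa using gen_rel d r n (RelR.braid c (predL n hn) (by omega) (by omega))
  have h6 : ∀ c : Letter n, c.1 + 2 = n →
      (gen d r n (some (lastL n hn)) * gen d r n (some (predL n hn)) * gen d r n (some c)) ^ 2 =
      (gen d r n (some c) * gen d r n (some (lastL n hn)) * gen d r n (some (predL n hn))) ^ 2 := by
    intro c hc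
    simpa using gen_rel d r n (RelR.six (lastL n hn) (predL n hn) c rfl hpred hc)
  have hgp' : ∀ b : Letter n, b.1 + 1 = n →
      rotGen d r n hn (some b) = gen d r n (some (lastL n hn)) := by
    intro b hb
    rw [epred b hb, hgp]
  have hgn' : ∀ a : Letter n, a.1 = n →
      rotGen d r n hn (some a) = gen d r n (some (lastL n hn)) *
      gen d r n (some (predL n hn)) * gen d r n (some (lastL n hn)) := by
    intro a ha
    rw [elast a ha, hgn]
  have hself : ∀ i : Letter n, gen d r n (some i) * gen d r n (some i) = 1 := gen_sq
  generalize gen d r n (some (lastL n hn)) = q at *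
  generalize gen d r n (some (predL n hn)) = p at *
  have hqq : q * p * q * q = q * p := by rw [mul_assoc, hq2, mul_one]
  cases h with
  | pow_zero =>
      simpa [hg0] using gen_rel d r n RelR.pow_zero
  | sq i =>
      simp only [pow_two, map_mul, FreeGroup.lift_apply_of, map_one]
      rcases lt_trichotomy (i.1 + 1) n with hi | hi | hi
      · rw [hglt i (by omega), hself]
      · rw [hgp' i hi, hq2]
      · rw [hgn' i (by have := i.2.2; omega)]
        calc q * p * q * (q * p * q) = q * p * (q * q) * p * q := by group
          _ = q * (p * p) * q := by rw [hq2]; group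
          _ = 1 := by rw [hp2, mul_one, hq2]
  | comm i j h hi =>
      simp only [map_mul, FreeGroup.lift_apply_of]
      rcases eq_or_lt_of_le hi with hi | hi
      · rw [hgp' i hi, hglt j (by omega)]
        exact hql j (by omega)
      · rw [hglt i (by omega), hglt j (by omega)]
        simpa using gen_rel d r n (RelR.comm i j h hi.le)
  | comm_zero j hj =>
      simp only [map_mul, FreeGroup.lift_apply_of]
      rw [hglt j hj, hg0]
      simpa using gen_rel d r n (RelR.comm_zero j hj)
  | comm_last a j ha hj =>
      simp only [map_mul, FreeGroup.lift_apply_of]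
      rw [hgn' a ha, hglt j (by omega)]
      exact ((hql j hj).mul_left (hpl j hj)).mul_left (hql j hj)
  | braid i j hj hi =>
      simp only [map_mul, FreeGroup.lift_apply_of]
      rcases eq_or_lt_of_le hi with hi | hi
      · rw [hgp' j (by omega), hglt i (by omega)]
        exact hqc i hi
      · rw [hglt i (by omega), hglt j (by omega)]
        simpa using gen_rel d r n (RelR.braid i j hj hi.le)
  | zero_last a b ha hb =>
      simp only [map_mul, FreeGroup.lift_apply_of]
      rw [hgn' a ha, hgp' b hb, hg0, hqq, mul_assoc, hqq, ← hzl, mul_assoc]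
  | braid_last a c ha hc =>
      simp only [map_mul, FreeGroup.lift_apply_of]
      rw [hgn' a ha, hglt c (by omega)]
      exact conj_braid hp2 hq2 (hself c) (hpc c hc) (hqc c hc) (h6 c hc)
  | six a b c ha hb hc =>
      simp only [map_mul, map_pow, FreeGroup.lift_apply_of]
      rw [hgn' a ha, hgp' b hb, hglt c (by omega), hqq, mul_assoc _ (q * p * q), hqq]
      rw [h6 c hc, mul_assoc]
  | long a b ha hb =>
      simp only [map_mul, map_pow, FreeGroup.lift_apply_of]
      rw [hgn' a ha, hgp' b hb, hg0]
      have e : q * (q * p * q) = p * q := by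
        rw [← mul_assoc, ← mul_assoc, hq2, one_mul]
      rw [e]
      calc gen d r n none * (q * p * q) * (p * q) ^ (r - 1)
          = (gen d r n none * q * p) * q * (p * q) ^ (r - 1) := by group
        _ = q * p * (gen d r n none * q * (p * q) ^ (r - 1)) := by rw [hzl]; group
        _ = q * (p * p) * gen d r n none := by rw [hlong]; group
        _ = q * gen d r n none := by rw [hp2, mul_one]

/-- Conjugation by `s_n`, as an endomorphism of the presented group `G(d,r,n)`. -/
def rot (hn : 3 ≤ n) : G d r n →* G d r n :=
  PresentedGroup.toGroup (f := rotGen d r n hn) (by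
    rintro _ ⟨u, v, h, rfl⟩
    rw [map_mul, map_inv, rotGen_rel hn h, mul_inv_cancel])

theorem rot_gen (hn : 3 ≤ n) (o : Option (Letter n)) :
    rot (d := d) (r := r) hn (gen d r n o) = rotGen d r n hn o :=
  PresentedGroup.toGroup.of _

theorem rot_zero (hn : 3 ≤ n) :
    rot (d := d) (r := r) hn (gen d r n none) = gen d r n none := rot_gen hn _

theorem rot_low (hn : 3 ≤ n) (i : Letter n) (hi : i.1 + 2 ≤ n) :
    rot (d := d) (r := r) hn (gen d r n (some i)) = gen d r n (some i) := by
  rw [rot_gen]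
  simp only [rotGen, if_neg (show i.1 ≠ n by omega), if_neg (show i.1 + 1 ≠ n by omega)]

theorem rot_pred (hn : 3 ≤ n) :
    rot (d := d) (r := r) hn (gen d r n (some (predL n hn))) = gen d r n (some (lastL n hn)) := by
  rw [rot_gen]
  have : (predL n hn).1 + 1 = n := by simp [predL]; omega
  simp only [rotGen, if_neg (show (predL n hn).1 ≠ n by omega), if_pos this]

theorem rot_last (hn : 3 ≤ n) :
    rot (d := d) (r := r) hn (gen d r n (some (lastL n hn))) = gen d r n (some (lastL n hn)) *
      gen d r n (some (predL n hn)) * gen d r n (some (lastL n hn)) := by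
  rw [rot_gen]
  have : (lastL n hn).1 = n := rfl
  simp [rotGen, this]

/-- The involutions q = s̃_n and p = s̃_{n-1} generate a dihedral group; `rot` fixes the rotation q
p and multiplies the reflection p by it on the left. -/
theorem rot_iterate_pred (hn : 3 ≤ n) (m : ℕ) :
    (rot (d := d) (r := r) hn)^[m] (gen d r n (some (predL n hn))) =
      (gen d r n (some (lastL n hn)) * gen d r n (some (predL n hn))) ^ m *
        gen d r n (some (predL n hn)) := by
  have hp := gen_sq (d := d) (r := r) (predL n hn)
  have hq := gen_sq (d := d) (r := r) (lastL n hn)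
  have h1 := rot_pred (d := d) (r := r) hn
  have h2 := rot_last (d := d) (r := r) hn
  induction m with
  | zero => simp
  | succ m ih =>
    rw [Function.iterate_succ_apply', ih, map_mul, map_pow, map_mul, h1, h2, pow_succ]
    generalize gen d r n (some (lastL n hn)) = q at *
    generalize gen d r n (some (predL n hn)) = p at *
    rw [show q * p * q * q = q * p by rw [mul_assoc, hq, mul_one], mul_assoc _ (q * p) p,
      mul_assoc q p p, hp, mul_one]

/-- Both sides are endomorphisms, so generators suffice. Those fixed by `rot` commute with s̃; on
s̃_{n-1} the claim is a form of the long relation. -/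
theorem rot_iterate (hr : 0 < r) (hn : 3 ≤ n) (g : G d r n) :
    (rot (d := d) (r := r) hn)^[r] g = (gen d r n none)⁻¹ * g * gen d r n none := by
  obtain ⟨F, hF⟩ : ∃ F : G d r n →* G d r n, ∀ x, F x = (rot (d := d) (r := r) hn)^[r] x := by
    have : ∀ k : ℕ, ∃ F : G d r n →* G d r n, ∀ x, F x = (rot (d := d) (r := r) hn)^[k] x := by
      intro k
      induction k with
      | zero => exact ⟨MonoidHom.id _, fun x => rfl⟩
      | succ k ih =>
        obtain ⟨F, hF⟩ := ih
        exact ⟨F.comp (rot hn), fun x => hF _⟩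
    exact this r
  have key : F = (MulAut.conj (gen d r n none)⁻¹).toMonoidHom := by
    refine PresentedGroup.ext ?_
    intro o
    change F (gen d r n o) = (gen d r n none)⁻¹ * gen d r n o * (gen d r n none)⁻¹⁻¹
    rw [hF, inv_inv]
    have hfix : ∀ x, rot (d := d) (r := r) hn x = x → Commute (gen d r n none) x →
        (rot (d := d) (r := r) hn)^[r] x = (gen d r n none)⁻¹ * x * gen d r n none := by
      intro x hx hc
      rw [Function.iterate_fixed hx, mul_assoc, ← hc.eq]; group
    have hz := gen_zero_last (d := d) (r := r) hn
    have hlong := gen_long (d := d) (r := r) hn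
    have hp := gen_sq (d := d) (r := r) (predL n hn)
    have hq := gen_sq (d := d) (r := r) (lastL n hn)
    have hP : (rot (d := d) (r := r) hn)^[r] (gen d r n (some (predL n hn))) =
        (gen d r n none)⁻¹ * gen d r n (some (predL n hn)) * gen d r n none := by
      rw [rot_iterate_pred]
      generalize gen d r n (some (lastL n hn)) = q at *
      generalize gen d r n (some (predL n hn)) = p at *
      rw [mul_assoc _ p, ← hlong]
      obtain ⟨m, rfl⟩ : ∃ m, r = m + 1 := ⟨r - 1, by omega⟩
      have : ∀ k : ℕ, (q * p) ^ (k + 1) * p = q * (p * q) ^ k := by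
        intro k
        induction k with
        | zero => simp [mul_assoc, hp]
        | succ k ih =>
          rw [pow_succ', mul_assoc, ih, pow_succ' (p * q) k]; simp only [mul_assoc]
      rw [this]
      simp
      group
    cases o with
    | none => exact hfix _ (rot_zero hn) (Commute.refl _)
    | some i =>
      rcases lt_trichotomy (i.1 + 1) n with hi | hi | hi
      · refine hfix _ (rot_low hn i hi) ?_
        have := gen_rel d r n (RelR.comm_zero i hi)
        simp only [map_mul, FreeGroup.lift_apply_of] at this
        exact this
      · obtain rfl : i = predL n hn := Subtype.ext (by simp [predL]; omega)
        exact hP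
      · obtain rfl : i = lastL n hn := Subtype.ext (by have := i.2.2; simp [lastL]; omega)
        -- As s̃_n is the image of s̃_{n-1} under `rot`, and `rot` commutes with its iterates, this
        -- case follows from the previous one.
        rw [← rot_pred hn, ← Function.iterate_succ_apply, Function.iterate_succ_apply', hP,
          map_mul, map_mul, map_inv, rot_zero]
  have := DFunLike.congr_fun key g
  rw [hF] at this
  rw [this]
  simp

/-- The r-th iterate is an inner automorphism, and a map with a bijective iterate of positive order
is bijective. -/
theorem rot_bijective (hr : 0 < r) (hn : 3 ≤ n) : Function.Bijective (rot (d := d) (r := r) hn) := by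
  have hb : Function.Bijective (rot (d := d) (r := r) hn)^[r] := by
    rw [show (rot (d := d) (r := r) hn)^[r] = MulAut.conj (gen d r n none)⁻¹ by
      funext g; rw [rot_iterate hr hn g]; simp]
    exact MulEquiv.bijective _
  obtain ⟨m, rfl⟩ : ∃ m, r = m + 1 := ⟨r - 1, by omega⟩
  constructor
  · have := hb.1
    rw [Function.iterate_succ] at this
    exact this.of_comp
  · have := hb.2
    rw [Function.iterate_succ'] at this
    exact this.of_comp

theorem tau_gen (hd : 0 < d) (hr : r ∣ d) (hn : 3 ≤ n) (o : Option (Letter n)) :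
    tau d r n hd hr hn (gen d r n o) = tauGen d r n hn o :=
  PresentedGroup.toGroup.of _

theorem s_pow_last (hn : 3 ≤ n) : s d n (lastL n hn) ^ d = 1 := by
  simpa using s_rel (Rel1.pow_last (d := d) (lastL n hn) rfl)

/-- Adjoin to G(d,r,n) an element t with t ^ r = s̃ that induces `rot`. Sending s_n to t and the
other s_i to s̃_i respects the relations of G(d,1,n), and composed with τ it is the embedding into
the extension. -/
theorem tau_injective (hd : 0 < d) (hr : r ∣ d) (hn : 3 ≤ n) :
    Function.Injective (tau d r n hd hr hn) := by
  have hr0 : 0 < r := Nat.pos_of_dvd_of_pos hr hd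
  have hrot : ∀ (k : ℕ) (g : G d r n),
      ((MulEquiv.ofBijective (rot (d := d) (r := r) hn) (rot_bijective hr0 hn) :
          MulAut (G d r n)) ^ k) g =
        (rot (d := d) (r := r) hn)^[k] g := by
    intro k
    induction k with
    | zero => intro g; rfl
    | succ k ih =>
      intro g
      rw [pow_succ, MulAut.mul_apply, ih, Function.iterate_succ_apply]
      rfl
  obtain ⟨K, _, ι, t, hι, ht, hconj⟩ := exists_cyclic_extension
    (MulEquiv.ofBijective (rot (d := d) (r := r) hn) (rot_bijective hr0 hn)) (gen d r n none) r hr0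
    (rot_zero hn) (fun g => by rw [hrot]; exact rot_iterate hr0 hn g)
  have hconj' : ∀ g, ι (rot (d := d) (r := r) hn g) = t⁻¹ * ι g * t := hconj
  have hpredlt : (predL n hn).1 + 1 = n := by simp [predL]; omega
  let f : Letter n → K := fun i => if i.1 = n then t else ι (gen d r n (some i))
  have fn : ∀ i : Letter n, i.1 = n → f i = t := fun i hi => by simp [f, hi]
  have flt : ∀ i : Letter n, i.1 < n → f i = ι (gen d r n (some i)) :=
    fun i hi => by simp [f, hi.ne]
  have hqeq : ι (gen d r n (some (lastL n hn))) =
      t⁻¹ * ι (gen d r n (some (predL n hn))) * t := by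
    rw [← hconj', rot_pred]
  have htd : t ^ d = 1 := by
    have e : gen d r n none ^ (d / r) = 1 := by simpa using gen_rel d r n RelR.pow_zero
    rw [← Nat.mul_div_cancel' hr, pow_mul, ht, ← map_pow, e, map_one]
  have hf : ∀ {u v}, Rel1 d n u v → FreeGroup.lift f u = FreeGroup.lift f v := by
    intro u v h
    cases h with
    | pow_last i hi => simpa [fn i hi] using htd
    | sq i hi =>
      simp only [pow_two, map_mul, FreeGroup.lift_apply_of, map_one]
      rw [flt i hi, ← map_mul, gen_sq, map_one]
    | comm i j h =>
      simp only [map_mul, FreeGroup.lift_apply_of]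
      have hj : j.1 + 2 ≤ n := by have := i.2.2; omega
      rw [flt j (by omega)]
      rcases eq_or_lt_of_le i.2.2 with hi | hi
      · rw [fn i hi]
        have := hconj' (gen d r n (some j))
        rw [rot_low hn j hj] at this
        conv_lhs => rw [this]
        group
      · rw [flt i hi, ← map_mul, ← map_mul]
        congr 1
        simpa using gen_rel d r n (RelR.comm i j h hi)
    | braid i j hj hi =>
      simp only [map_mul, FreeGroup.lift_apply_of]
      rw [flt i (by omega), flt j (by omega)]
      simp only [← map_mul]
      congr 1
      simpa using gen_rel d r n (RelR.braid i j hj hi)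
    | braid_last i j hi hj =>
      simp only [map_mul, FreeGroup.lift_apply_of]
      obtain rfl : j = predL n hn := Subtype.ext (by simp [predL]; omega)
      rw [fn i hi, flt _ (by omega)]
      -- Written in terms of t and s̃_{n-1}, the value of `rot` at s̃_n is the length-four braid
      -- relation in disguise.
      have h2 := hconj' (gen d r n (some (lastL n hn)))
      have hp : ι (gen d r n (some (predL n hn))) * ι (gen d r n (some (predL n hn))) = 1 := by
        rw [← map_mul, gen_sq, map_one]
      rw [rot_last, map_mul, map_mul, hqeq] at h2
      generalize ι (gen d r n (some (predL n hn))) = p at *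
      have h3 : p * t * p * t⁻¹ * p = t⁻¹ * p * t := by
        calc p * t * p * t⁻¹ * p = t * (t⁻¹ * p * t * p * (t⁻¹ * p * t)) * t⁻¹ := by group
          _ = _ := by rw [h2]; group
      have h4 : p⁻¹ = p := inv_eq_of_mul_eq_one_left hp
      calc t * p * t * p = t * (p * t * p * t⁻¹ * p) * p⁻¹ * t := by group
        _ = p * t * p⁻¹ * t := by rw [h3]; group
        _ = p * t * p * t := by rw [h4]
  let F : G1 d n →* K := PresentedGroup.toGroup (f := f) (by
    rintro _ ⟨u, v, h, rfl⟩
    rw [map_mul, map_inv, hf h, mul_inv_cancel])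
  have hF : ∀ i, F (s d n i) = f i := fun i => PresentedGroup.toGroup.of _
  have hcomp : F.comp (tau d r n hd hr hn) = ι := by
    refine PresentedGroup.ext ?_
    intro o
    change F (tau d r n hd hr hn (gen d r n o)) = ι (gen d r n o)
    rw [tau_gen]
    cases o with
    | none => simp only [tauGen, map_pow, hF]; rw [fn _ rfl, ht]
    | some i =>
      by_cases hi : i.1 = n
      · obtain rfl : i = lastL n hn := Subtype.ext hi
        simp only [tauGen, if_pos hi, map_mul, map_pow, hF]
        rw [fn _ rfl, flt _ (by omega), hqeq]
        congr 2
        rw [eq_inv_iff_mul_eq_one, ← pow_succ, Nat.sub_add_cancel hd, htd]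
      · simp only [tauGen, if_neg hi, hF]
        rw [flt _ (lt_of_le_of_ne i.2.2 hi)]
  have : Function.Injective (F ∘ tau d r n hd hr hn) := by
    rw [← MonoidHom.coe_comp, hcomp]; exact hι
  exact this.of_comp

end

/-! ### Evaluation of words in a monoid -/

section words

variable {M : Type*} [Monoid M]

/-- The value of a word in a monoid with a marked element for every letter. -/
def ev (x : ℕ → M) (w : List ℕ) : M := (w.map x).prod

variable {x : ℕ → M}

@[simp] theorem ev_nil : ev x [] = 1 := rfl

@[simp] theorem ev_append (u v : List ℕ) : ev x (u ++ v) = ev x u * ev x v := by simp [ev]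

@[simp] theorem ev_cons (a : ℕ) (v : List ℕ) : ev x (a :: v) = x a * ev x v := by simp [ev]

theorem ev_singleton (a : ℕ) : ev x [a] = x a := by simp

@[simp] theorem ev_replicate (k a : ℕ) : ev x (List.replicate k a) = x a ^ k := by simp [ev]

/-- Letters that are not neighbours commute. -/
def FarCommute (x : ℕ → M) : Prop := ∀ a b, a + 1 < b → Commute (x a) (x b)

theorem FarCommute.ev (hx : FarCommute x) {a : ℕ} {w : List ℕ}
    (h : ∀ b ∈ w, a + 1 < b ∨ b + 1 < a) : Commute (x a) (ev x w) := by
  induction w with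
  | nil => exact Commute.one_right _
  | cons b w ih =>
    rw [ev_cons]
    refine Commute.mul_right ?_ (ih fun c hc => h c (List.mem_cons_of_mem _ hc))
    rcases h b List.mem_cons_self with h | h
    · exact hx _ _ h
    · exact (hx _ _ h).symm

/-- The defining relations of `G(d,1,n)`. -/
structure BraidGens (d n : ℕ) (x : ℕ → M) : Prop where
  comm : FarCommute x
  sq : ∀ a, 1 ≤ a → a < n → x a * x a = 1
  braid : ∀ a, 1 ≤ a → a + 1 < n → x (a + 1) * x a * x (a + 1) = x a * x (a + 1) * x a
  last : ∀ a, 1 ≤ a → a + 1 = n → x n * x a * x n * x a = x a * x n * x a * x n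
  pow : x n ^ d = 1

/-! ### Descending words -/

theorem desc_of_lt {i j : ℕ} (h : i < j) : desc i j = [] := by
  simp [desc, show i + 1 - j = 0 by omega]

theorem desc_eq_append {i j : ℕ} (h : j ≤ i) : desc i j = desc i (j + 1) ++ [j] := by
  simp only [desc]
  rw [show i + 1 - j = (i + 1 - (j + 1)) + 1 by omega, List.range'_succ]
  simp

@[simp] theorem mem_desc {i j a : ℕ} : a ∈ desc i j ↔ j ≤ a ∧ a ≤ i := by
  simp [desc, List.mem_range'_1]
  omega

@[simp] theorem length_desc (i j : ℕ) : (desc i j).length = i + 1 - j := by simp [desc]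

theorem desc_split {p b j : ℕ} (h1 : j ≤ b + 1) (h2 : b ≤ p) :
    desc p j = desc p (b + 1) ++ desc b j := by
  obtain ⟨k, hk⟩ : ∃ k, j + k = b + 1 := ⟨b + 1 - j, by omega⟩
  induction k generalizing j with
  | zero => simp [show j = b + 1 by omega, desc_of_lt (Nat.lt_succ_self b)]
  | succ k ih =>
    rw [desc_eq_append (show j ≤ p by omega), ih (by omega) (by omega),
      desc_eq_append (show j ≤ b by omega), List.append_assoc]

/-- A letter entering a descending run from the right commutes until it meets its own pair b+1, b;
the braid relation turns it into b, which commutes out on the left. -/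
theorem desc_shift {d n : ℕ} (hx : BraidGens d n x) {p j b : ℕ} (hj : 1 ≤ j) (hjb : j ≤ b)
    (hbp : b < p) (hp : p < n) :
    ev x (desc p j) * x (b + 1) = x b * ev x (desc p j) := by
  have e : desc p j = desc p (b + 2) ++ ([b + 1] ++ ([b] ++ desc (b - 1) j)) := by
    rw [desc_split (p := p) (b := b + 1) (by omega) (by omega)]
    congr 1
    rw [desc_split (p := b + 1) (b := b) (by omega) (by omega),
      desc_eq_append (i := b + 1) (j := b + 1) le_rfl, desc_of_lt (Nat.lt_succ_self _),
      List.nil_append]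
    congr 1
    rw [desc_split (p := b) (b := b - 1) (by omega) (by omega),
      show b - 1 + 1 = b by omega,
      desc_eq_append (i := b) (j := b) le_rfl, desc_of_lt (Nat.lt_succ_self _), List.nil_append]
  have h1 : Commute (x (b + 1)) (ev x (desc (b - 1) j)) :=
    hx.comm.ev fun c hc => by rw [mem_desc] at hc; omega
  have h2 : Commute (x b) (ev x (desc p (b + 2))) :=
    hx.comm.ev fun c hc => by rw [mem_desc] at hc; omega
  rw [e]
  simp only [ev_append, ev_singleton]
  generalize ev x (desc p (b + 2)) = U at *
  generalize ev x (desc (b - 1) j) = V at *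
  calc U * (x (b + 1) * (x b * V)) * x (b + 1)
      = U * (x (b + 1) * x b * (V * x (b + 1))) := by simp only [mul_assoc]
    _ = U * ((x (b + 1) * x b * x (b + 1)) * V) := by rw [← h1.eq]; simp only [mul_assoc]
    _ = (U * x b) * (x (b + 1) * x b * V) := by
        rw [hx.braid b (by omega) (by omega)]; simp only [mul_assoc]
    _ = _ := by rw [← h2.eq]; simp only [mul_assoc]

/-! ### Prefixes -/

/-- The word `s_{1 i_1} ⋯ s_{p i_p}`. -/
def pre (p : ℕ) (i : ℕ → ℕ) : List ℕ := (List.range' 1 p).flatMap fun q => desc q (i q)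

theorem prefixWord_eq_pre (n : ℕ) (i : ℕ → ℕ) : prefixWord n i = pre (n - 1) i := rfl

@[simp] theorem pre_zero (i : ℕ → ℕ) : pre 0 i = [] := rfl

theorem pre_succ (p : ℕ) (i : ℕ → ℕ) : pre (p + 1) i = pre p i ++ desc (p + 1) (i (p + 1)) := by
  simp [pre, List.range'_concat, add_comm 1 p]

theorem pre_congr {p : ℕ} {i i' : ℕ → ℕ} (h : ∀ q, 1 ≤ q → q ≤ p → i q = i' q) :
    pre p i = pre p i' := by
  induction p with
  | zero => rfl
  | succ p ih =>
    rw [pre_succ, pre_succ, ih fun q h1 h2 => h q h1 (by omega), h _ (by omega) le_rfl]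

/-- The index condition for prefixes `s_{1 i_1} ⋯ s_{p i_p}`. -/
def ValidPre (p : ℕ) (i : ℕ → ℕ) : Prop := ∀ q, 1 ≤ q → q ≤ p → 1 ≤ i q ∧ i q ≤ q + 1

/-- The lower indices of the nonempty factors increase. -/
def Incr (p : ℕ) (i : ℕ → ℕ) : Prop :=
  ∀ q q', 1 ≤ q → q < q' → q' ≤ p → i q ≤ q → i q' ≤ q' → i q < i q'

theorem Incr.mono {p p' : ℕ} {i : ℕ → ℕ} (h : Incr p i) (hp : p' ≤ p) : Incr p' i :=
  fun q q' h1 h2 h3 => h q q' h1 h2 (h3.trans hp)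

theorem ValidPre.mono {p p' : ℕ} {i : ℕ → ℕ} (h : ValidPre p i) (hp : p' ≤ p) : ValidPre p' i :=
  fun q h1 h2 => h q h1 (h2.trans hp)

/-- Right multiplication of a prefix by a letter: either the length drops, or it grows by one, and
then, if the resulting indices increase, the letter has been absorbed by commutations only. -/
theorem pre_step {N : Type*} [Monoid N] {y : ℕ → N} (hy : FarCommute y) {d n : ℕ}
    (hx : BraidGens d n x) (p : ℕ) (hp : p < n) (i : ℕ → ℕ) (hi : ValidPre p i) (a : ℕ)
    (ha : 1 ≤ a) (hap : a ≤ p) :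
    ∃ i', ValidPre p i' ∧ (∀ q, p < q → i' q = i q) ∧ ev x (pre p i') = ev x (pre p i) * x a ∧
      ((pre p i').length + 1 = (pre p i).length ∨ ((pre p i').length = (pre p i).length + 1 ∧
        (Incr p i' → ∃ q, 1 ≤ q ∧ q ≤ p ∧ i' q = a ∧ i = Function.update i' q (a + 1) ∧
          (∀ q', q < q' → q' ≤ p → a + 1 < i' q') ∧
          ev y (pre p i) * y a = ev y (pre p i')))) := by
  induction p generalizing a with
  | zero => omega
  | succ p ih =>
    have hip := hi (p + 1) (by omega) le_rfl
    have hval : ∀ c, 1 ≤ c → c ≤ p + 2 → ValidPre (p + 1) (Function.update i (p + 1) c) := by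
      intro c h1 h2 q hq1 hq2
      by_cases hq : q = p + 1
      · subst hq; simp; omega
      · rw [Function.update_of_ne hq]; exact hi q hq1 hq2
    have hpre : ∀ c, pre (p + 1) (Function.update i (p + 1) c) = pre p i ++ desc (p + 1) c := by
      intro c
      rw [pre_succ, Function.update_self]
      congr 1
      exact pre_congr fun q _ h => Function.update_of_ne (by omega) _ _
    -- The letter is compared with the lower index of the last factor: if equal, it cancels the last
    -- letter; if one below, it extends the factor; if further below, it commutes past the factor;
    -- if above, it passes through as a - 1. The last two cases recurse into the shorter prefix.
    by_cases h1 : a = i (p + 1)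
    · refine ⟨Function.update i (p + 1) (a + 1), hval _ (by omega) (by omega),
        fun q hq => Function.update_of_ne (by omega) _ _, ?_, Or.inl ?_⟩
      · rw [hpre, pre_succ, ← h1, desc_eq_append hap]
        simp [mul_assoc, hx.sq a ha (by omega)]
      · rw [hpre, pre_succ, ← h1]
        simp
        omega
    by_cases h2 : a + 1 = i (p + 1)
    · have e : pre (p + 1) (Function.update i (p + 1) a) = pre (p + 1) i ++ [a] := by
        rw [hpre, desc_eq_append hap, pre_succ, ← h2, List.append_assoc]
      refine ⟨Function.update i (p + 1) a, hval _ (by omega) (by omega),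
        fun q hq => Function.update_of_ne (by omega) _ _, by simp [e], Or.inr ⟨by simp [e], ?_⟩⟩
      intro _
      refine ⟨p + 1, by omega, le_rfl, by simp, ?_, fun q' h3 h4 => by omega, by simp [e]⟩
      rw [h2]; simp
    by_cases h3 : a < i (p + 1)
    · obtain ⟨i', hi1, hi2, hi3, hi4⟩ := ih (by omega) (hi.mono (by omega)) a ha (by omega)
      have hi2' : i' (p + 1) = i (p + 1) := hi2 _ (by omega)
      refine ⟨i', ?_, fun q hq => hi2 q (by omega), ?_, ?_⟩
      · intro q hq1 hq2
        rcases Nat.lt_or_ge p q with h | h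
        · rw [hi2 q h]; exact hi q hq1 hq2
        · exact hi1 q hq1 h
      · have : Commute (x a) (ev x (desc (p + 1) (i (p + 1)))) :=
          hx.comm.ev fun c hc => by rw [mem_desc] at hc; omega
        rw [pre_succ, pre_succ, ev_append, ev_append, hi3, hi2', mul_assoc, mul_assoc, this.eq]
      · rw [pre_succ, pre_succ, hi2']
        simp only [List.length_append]
        refine hi4.imp (fun h => by omega) (fun h => ⟨by omega, fun hinc => ?_⟩)
        obtain ⟨q, hq1, hq2, hq3, hq4, hq5, hq6⟩ := h.2 (hinc.mono (by omega))
        refine ⟨q, hq1, by omega, hq3, hq4, ?_, ?_⟩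
        · intro q' h4 h5
          rcases Nat.lt_or_ge p q' with h | h
          · rw [show q' = p + 1 by omega, hi2']; omega
          · exact hq5 q' h4 h
        · have : Commute (y a) (ev y (desc (p + 1) (i (p + 1)))) :=
            hy.ev fun c hc => by rw [mem_desc] at hc; omega
          rw [ev_append, ev_append, ← hq6, mul_assoc, mul_assoc, this.eq]
    · obtain ⟨b, rfl⟩ : ∃ b, a = b + 1 := ⟨a - 1, by omega⟩
      obtain ⟨i', hi1, hi2, hi3, hi4⟩ := ih (by omega) (hi.mono (by omega)) b (by omega) (by omega)
      have hi2' : i' (p + 1) = i (p + 1) := hi2 _ (by omega)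
      refine ⟨i', ?_, fun q hq => hi2 q (by omega), ?_, ?_⟩
      · intro q hq1 hq2
        rcases Nat.lt_or_ge p q with h | h
        · rw [hi2 q h]; exact hi q hq1 hq2
        · exact hi1 q hq1 h
      · rw [pre_succ, pre_succ, ev_append, ev_append, hi3, hi2', mul_assoc, mul_assoc,
          desc_shift hx hip.1 (by omega) (by omega) hp]
      · rw [pre_succ, pre_succ, hi2']
        simp only [List.length_append]
        refine hi4.imp (fun h => by omega) (fun h => ⟨by omega, fun hinc => ?_⟩)
        obtain ⟨q, hq1, hq2, hq3, hq4, hq5, hq6⟩ := h.2 (hinc.mono (by omega))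
        have hqb : b ≤ q := by
          have := hi q hq1 (by omega)
          rw [hq4, Function.update_self] at this
          omega
        -- A letter lowered on its way through the last factor would end a factor at b, not below
        -- the lower index of the last one, so the indices cannot increase and there is nothing to
        -- prove.
        have := hinc q (p + 1) hq1 (by omega) le_rfl (by omega) (by omega)
        omega

/-! ### Suffixes -/

/-- The word `s^{(k)}_{n j}`, empty for `k = 0`. -/
def piece (n j k : ℕ) : List ℕ := if k = 0 then [] else List.replicate k n ++ desc (n - 1) j

/-- The concatenation of the words `s^{(e_j)}_{n j}` for `b ≤ j < b + m`. -/
def seg (n : ℕ) (e : ℕ → ℕ) (b m : ℕ) : List ℕ := (List.range' b m).flatMap fun j => piece n j (e j)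

@[simp] theorem piece_zero (n j : ℕ) : piece n j 0 = [] := rfl

theorem piece_of_ne {n j k : ℕ} (h : k ≠ 0) :
    piece n j k = List.replicate k n ++ desc (n - 1) j := if_neg h

@[simp] theorem seg_zero (n : ℕ) (e : ℕ → ℕ) (b : ℕ) : seg n e b 0 = [] := rfl

theorem seg_add (n : ℕ) (e : ℕ → ℕ) (b m m' : ℕ) :
    seg n e b (m + m') = seg n e b m ++ seg n e (b + m) m' := by
  have := List.range'_append_1 (s := b) (m := m) (n := m')
  simp only [seg]
  rw [← this, List.flatMap_append]

theorem seg_one (n : ℕ) (e : ℕ → ℕ) (b : ℕ) : seg n e b 1 = piece n b (e b) := by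
  simp [seg]

theorem seg_congr {n : ℕ} {e e' : ℕ → ℕ} {b m : ℕ} (h : ∀ j, b ≤ j → j < b + m → e j = e' j) :
    seg n e b m = seg n e' b m := by
  induction m with
  | zero => rfl
  | succ m ih =>
    rw [seg_add, seg_add, ih fun j h1 h2 => h j h1 (by omega), seg_one, seg_one,
      h (b + m) (by omega) (by omega)]

theorem mem_seg {n : ℕ} {e : ℕ → ℕ} {b m c : ℕ} (hn : b + m ≤ n + 1) (h : c ∈ seg n e b m) :
    ∃ j, b ≤ j ∧ j < b + m ∧ e j ≠ 0 ∧ j ≤ c ∧ c ≤ n := by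
  simp only [seg, List.mem_flatMap, List.mem_range'_1] at h
  obtain ⟨j, hj, hc⟩ := h
  have hne : e j ≠ 0 := by
    intro h0
    simp [h0] at hc
  rw [piece_of_ne hne, List.mem_append, mem_desc, List.mem_replicate] at hc
  exact ⟨j, hj.1, hj.2, hne, by omega, by omega⟩

/-- Each nonempty factor crossed lowers the letter by one. The last clause, that a crossed factor
still has its index at or below the emerging letter, is what later contradicts goodness through
`Good.absorb_lt`. -/
theorem seg_pass {d n : ℕ} (hx : BraidGens d n x) (e : ℕ → ℕ) (b a : ℕ) (hba : b < a)
    (han : a < n) :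
    ∃ a', 1 ≤ a' ∧ a' ≤ a ∧ a ≤ a' + b ∧ ev x (seg n e 1 b) * x a = x a' * ev x (seg n e 1 b) ∧
      ((∀ j, 1 ≤ j → j ≤ b → e j = 0) → a' = a) ∧
      ((∃ j, 1 ≤ j ∧ j ≤ b ∧ e j ≠ 0) → a' < a ∧ ∃ j, 1 ≤ j ∧ j ≤ b ∧ e j ≠ 0 ∧ j ≤ a') := by
  induction b generalizing a with
  | zero => exact ⟨a, by omega, le_rfl, by omega, by simp, fun _ => rfl, fun ⟨j, h⟩ => by omega⟩
  | succ b ih =>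
    by_cases h0 : e (b + 1) = 0
    · obtain ⟨a', h1, h2, h3, h4, h5, h6⟩ := ih a (by omega) han
      refine ⟨a', h1, h2, by omega, ?_, fun h => h5 fun j hj hj' => h j hj (by omega), ?_⟩
      · rw [seg_add, seg_one, add_comm 1 b, h0]
        simpa using h4
      · rintro ⟨j, hj1, hj2, hj3⟩
        have : j ≠ b + 1 := fun h => hj3 (h ▸ h0)
        obtain ⟨h7, j', h8, h9, h10⟩ := h6 ⟨j, hj1, by omega, hj3⟩
        exact ⟨h7, j', h8, by omega, h10⟩
    · obtain ⟨c, rfl⟩ : ∃ c, a = c + 1 := ⟨a - 1, by omega⟩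
      obtain ⟨a', h1, h2, h3, h4, h5, h6⟩ := ih c (by omega) (by omega)
      refine ⟨a', h1, by omega, by omega, ?_, fun h => absurd (h (b + 1) (by omega) le_rfl) h0, ?_⟩
      · rw [seg_add, seg_one, add_comm 1 b, piece_of_ne h0]
        have hc : Commute (x c) (x n ^ e (b + 1)) := (hx.comm c n (by omega)).pow_right _
        simp only [ev_append, ev_replicate, mul_assoc]
        rw [desc_shift hx (by omega) (by omega) (by omega) (by omega), ← mul_assoc (x n ^ _),
          ← hc.eq, mul_assoc, ← mul_assoc _ (x c), h4, mul_assoc]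
      · intro _
        refine ⟨by omega, ?_⟩
        by_cases hz : ∀ j, 1 ≤ j → j ≤ b → e j = 0
        · exact ⟨b + 1, by omega, le_rfl, h0, by rw [h5 hz]; omega⟩
        · push Not at hz
          obtain ⟨j, hj1, hj2, hj3⟩ := hz
          obtain ⟨_, j', h8, h9, h10⟩ := h6 ⟨j, hj1, hj2, hj3⟩
          exact ⟨j', h8, by omega, h10⟩

theorem desc_mul_desc {d n : ℕ} (hx : BraidGens d n x) {p b j : ℕ} (hj : 1 ≤ j) (hp : p < n)
    (hb : b < p) :
    ev x (desc b j) * ev x (desc p j) = ev x (desc p j) * ev x (desc (b + 1) (j + 1)) := by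
  rcases Nat.lt_or_ge b j with h | h
  · simp [desc_of_lt h, desc_of_lt (Nat.succ_lt_succ h)]
  · induction b, h using Nat.le_induction with
    | base =>
      rw [desc_eq_append (i := j) le_rfl, desc_eq_append (i := j + 1) (j := j + 1) le_rfl,
        desc_of_lt (Nat.lt_succ_self _), desc_of_lt (Nat.lt_succ_self _)]
      simp only [List.nil_append, ev_singleton]
      exact (desc_shift hx hj le_rfl hb hp).symm
    | succ b hjb ih =>
      have e : ∀ c k, k ≤ c + 1 → desc (c + 1) k = [c + 1] ++ desc c k := by
        intro c k hk
        rw [desc_split (b := c) hk (by omega), desc_eq_append (i := c + 1) (j := c + 1) le_rfl,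
          desc_of_lt (Nat.lt_succ_self _), List.nil_append]
      rw [e b j (by omega), e (b + 1) (j + 1) (by omega)]
      simp only [ev_append, ev_singleton, mul_assoc]
      rw [ih (by omega), ← mul_assoc, ← mul_assoc, desc_shift hx hj (by omega) (by omega) hp]

/-- The element x m * x n ^ l * x m is the l-th power of x m * x n * x m, which commutes with x n by
the length-four braid relation. -/
theorem conj_pow_commute {d n m : ℕ} (hx : BraidGens d n x) (hm : 1 ≤ m) (hmn : m + 1 = n)
    (l : ℕ) : Commute (x n) (x m * x n ^ l * x m) := by
  subst hmn
  have hlast := hx.last m hm rfl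
  have hu : Commute (x (m + 1)) (x m * x (m + 1) * x m) := by
    change _ * _ = _ * _
    simpa only [mul_assoc] using hlast
  have hpp := hx.sq m hm (by omega)
  have : x m * x (m + 1) ^ l * x m = (x m * x (m + 1) * x m) ^ l := by
    induction l with
    | zero => simp [hpp]
    | succ l ih =>
      rw [pow_succ (x m * x (m + 1) * x m), ← ih, pow_succ]
      calc x m * (x (m + 1) ^ l * x (m + 1)) * x m
          = x m * x (m + 1) ^ l * (1 * x (m + 1)) * x m := by rw [one_mul]; simp only [mul_assoc]
        _ = _ := by rw [← hpp]; simp only [mul_assoc]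
  rw [this]
  exact hu.pow_right l

/-- The letter s_a completes the second factor, and the rest of the first run then passes through
the completed run, so that a conjugate s_{n-1} s_n ^ l s_{n-1} forms to the right of s_n ^ k. The
two commute, which exchanges the exponents and releases one s_{n-1} on the left. -/
theorem piece_swap {d n : ℕ} (hx : BraidGens d n x) {a k l : ℕ} (ha : 1 ≤ a) (han : a < n)
    (hk : k ≠ 0) (hl : l ≠ 0) :
    ev x (piece n a k) * ev x (piece n (a + 1) l) * x a =
      x (n - 1) * (ev x (piece n a l) * ev x (piece n (a + 1) k)) := by
  obtain ⟨m, rfl⟩ : ∃ m, n = m + 1 := ⟨n - 1, by omega⟩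
  have hm : m + 1 - 1 = m := by omega
  simp only [piece_of_ne hk, piece_of_ne hl, hm, ev_append, ev_replicate]
  have hsplit : ev x (desc m a) = x m * ev x (desc (m - 1) a) := by
    rw [desc_split (p := m) (b := m - 1) (by omega) (by omega), show m - 1 + 1 = m by omega,
      desc_eq_append (i := m) le_rfl, desc_of_lt (Nat.lt_succ_self _)]
    simp
  have hD : Commute (x (m + 1)) (ev x (desc (m - 1) a)) :=
    hx.comm.ev fun c hc => by rw [mem_desc] at hc; omega
  have hDD : ev x (desc (m - 1) a) * ev x (desc m a) =
      ev x (desc m a) * ev x (desc m (a + 1)) := by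
    have := desc_mul_desc hx (b := m - 1) (p := m) (j := a) ha (by omega) (by omega)
    rwa [show m - 1 + 1 = m by omega] at this
  have hend : ev x (desc m (a + 1)) * x a = ev x (desc m a) := by
    rw [desc_eq_append (i := m) (j := a) (by omega)]
    simp
  have hul := conj_pow_commute hx (m := m) (by omega) rfl
  calc x (m + 1) ^ k * ev x (desc m a) * (x (m + 1) ^ l * ev x (desc m (a + 1))) * x a
      = x (m + 1) ^ k * (x m * (ev x (desc (m - 1) a) * x (m + 1) ^ l)) * ev x (desc m a) := by
        simp only [mul_assoc, hend]
        nth_rewrite 1 [hsplit]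
        simp only [mul_assoc]
    _ = x (m + 1) ^ k * (x m * x (m + 1) ^ l) * (ev x (desc (m - 1) a) * ev x (desc m a)) := by
        rw [← (hD.pow_left l).eq]; simp only [mul_assoc]
    _ = x (m + 1) ^ k * (x m * x (m + 1) ^ l * x m) * ev x (desc (m - 1) a) *
          ev x (desc m (a + 1)) := by
        rw [hDD, hsplit]; simp only [mul_assoc]
    _ = x m * x (m + 1) ^ l * x m * (x (m + 1) ^ k * ev x (desc (m - 1) a)) *
          ev x (desc m (a + 1)) := by
        rw [((hul l).pow_left k).eq]; simp only [mul_assoc]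
    _ = _ := by rw [(hD.pow_left k).eq, hsplit]; simp only [mul_assoc]

end words

/-! ### Right multiplication of canonical words by generators -/

/-- The canonical word `s_{1 i_1} ⋯ s_{n-1, i_{n-1}} s^{(e_1)}_{n 1} ⋯ s^{(e_n)}_{n n}`, in which
the factors with `e_j = 0` are left out. -/
def canon (n : ℕ) (i e : ℕ → ℕ) : List ℕ := pre (n - 1) i ++ seg n e 1 n

/-- The conditions on the indices and exponents of a canonical word. -/
structure ValidData (d n : ℕ) (i e : ℕ → ℕ) : Prop where
  pre : ValidPre (n - 1) i
  exp : ∀ j, 1 ≤ j → j ≤ n → e j < d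

/-- The canonical words of fully commutative elements: the lower indices of the nonempty factors of
the prefix increase and stay below the lower indices of the suffix, except that a single suffix
factor may be preceded by `s_m s_{m+1} ⋯ s_{n-1}`. -/
structure Good (n : ℕ) (i e : ℕ → ℕ) : Prop where
  incr : Incr (n - 1) i
  below : ∀ j, 1 ≤ j → j ≤ n → e j ≠ 0 → ∀ p, 1 ≤ p → p ≤ n - 1 → i p ≤ p →
    i p < j ∨ ((∀ q, p ≤ q → q ≤ n - 1 → i q = q) ∧ ∀ j', 1 ≤ j' → j' ≤ n → j' ≠ j → e j' = 0)

/-- This removes the last letter of a factor, undoing an absorption; later factors leave enough room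
for the index to rise by one. -/
theorem Incr.update {p q a : ℕ} {i : ℕ → ℕ} (h : Incr p i) (hq : i q = a) (hq1 : 1 ≤ q)
    (hqp : q ≤ p) (haq : a ≤ q) (hlater : ∀ q', q < q' → q' ≤ p → a + 1 < i q') :
    Incr p (Function.update i q (a + 1)) := by
  intro u v hu huv hv h1 h2
  by_cases huq : u = q
  · subst huq
    rw [Function.update_self, Function.update_of_ne (by omega)]
    exact hlater v huv hv
  · rw [Function.update_of_ne huq] at h1 ⊢
    by_cases hvq : v = q
    · subst hvq
      rw [Function.update_self]
      have := h u v hu huv hv h1 (by omega)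
      omega
    · rw [Function.update_of_ne hvq] at h2 ⊢
      exact h u v hu huv hv h1 h2

/-- In a good prefix, the last letter of the prefix is not above the first suffix factor, unless it
is `n - 1`. -/
theorem Good.absorb_lt {n : ℕ} {i e : ℕ → ℕ} (h : Good n i e) {q a j : ℕ} (hq1 : 1 ≤ q)
    (hqn : q ≤ n - 1) (hqa : i q = a) (haq : a ≤ q)
    (hlater : ∀ q', q < q' → q' ≤ n - 1 → a + 1 < i q') (hj : 1 ≤ j) (hjn : j ≤ n)
    (hje : e j ≠ 0) (hja : j ≤ a) :
    a = n - 1 ∧ ∀ j', 1 ≤ j' → j' ≤ n → j' ≠ j → e j' = 0 := by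
  rcases h.below j hj hjn hje q hq1 hqn (by omega) with h1 | ⟨h1, h2⟩
  · omega
  · refine ⟨?_, h2⟩
    by_contra hne
    have h3 := h1 q le_rfl hqn
    have h4 := h1 (q + 1) (by omega) (by omega)
    have h5 := hlater (q + 1) (by omega) (by omega)
    omega

section step

variable {M N : Type*} [Monoid M] [Monoid N] {x : ℕ → M} {y : ℕ → N} {d n : ℕ}

/-- What happens when the letter `a` is appended to the canonical word with data `i`, `e`. -/
def StepGoal (x : ℕ → M) (y : ℕ → N) (d n : ℕ) (i e : ℕ → ℕ) (a : ℕ) : Prop :=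
  ∃ i' e', ValidData d n i' e' ∧ ev x (canon n i' e') = ev x (canon n i e) * x a ∧
    ((canon n i' e').length ≤ (canon n i e).length ∨
      ((canon n i' e').length = (canon n i e).length + 1 ∧
        (Good n i' e' → Good n i e ∧ ev y (canon n i e) * y a = ev y (canon n i' e'))))

/-- The factor with lower index n is a bare power of s_n at the end of the word, so its exponent
grows by one, or the power disappears once it reaches d. -/
theorem step_last (hx : BraidGens d n x) (hd : 0 < d) (hn : 1 ≤ n) {i e : ℕ → ℕ}
    (hv : ValidData d n i e) : StepGoal x y d n i e n := by
  have hc : ∀ f : ℕ → ℕ, (∀ j, 1 ≤ j → j < n → f j = e j) →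
      canon n i f = pre (n - 1) i ++ seg n e 1 (n - 1) ++ List.replicate (f n) n := by
    intro f hf
    have h1 := seg_add n f 1 (n - 1) 1
    rw [show n - 1 + 1 = n by omega, seg_one, show 1 + (n - 1) = n by omega] at h1
    rw [canon, h1, seg_congr (e' := e) fun j h1 h2 => hf j h1 (by omega), List.append_assoc]
    congr 2
    by_cases h : f n = 0
    · simp [h]
    · simp [piece_of_ne h, desc_of_lt (show n - 1 < n by omega)]
  have hval : ∀ c, c < d → ValidData d n i (Function.update e n c) := by
    intro c hcd
    refine ⟨hv.pre, fun j h1 h2 => ?_⟩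
    by_cases hj : j = n
    · subst hj; simpa using hcd
    · rw [Function.update_of_ne hj]; exact hv.exp j h1 h2
  have hne : ∀ c j, 1 ≤ j → j < n → Function.update e n c j = e j :=
    fun c j _ h => Function.update_of_ne (by omega) _ _
  by_cases hlt : e n + 1 < d
  · have e1 : canon n i (Function.update e n (e n + 1)) = canon n i e ++ [n] := by
      rw [hc _ (hne _), hc e fun _ _ _ => rfl, Function.update_self, List.replicate_succ']
      simp only [List.append_assoc]
    refine ⟨i, Function.update e n (e n + 1), hval _ hlt, by simp [e1],
      Or.inr ⟨by simp [e1], fun hg => ⟨⟨hg.incr, ?_⟩, by simp [e1]⟩⟩⟩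
    intro j hj hjn hje p hp hpn hpi
    have hmono : ∀ j, Function.update e n (e n + 1) j = 0 → e j = 0 := by
      intro j hj
      by_cases h : j = n
      · subst h; simp at hj
      · rwa [Function.update_of_ne h] at hj
    exact (hg.below j hj hjn (fun h => hje (hmono j h)) p hp hpn hpi).imp_right fun h =>
      ⟨h.1, fun j' h1 h2 h3 => hmono j' (h.2 j' h1 h2 h3)⟩
  · have hlt' := hv.exp n hn le_rfl
    refine ⟨i, Function.update e n 0, hval _ hd, ?_, Or.inl ?_⟩
    · rw [hc _ (hne _), hc e fun _ _ _ => rfl, Function.update_self]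
      simp only [ev_append, ev_replicate, pow_zero, mul_one]
      rw [mul_assoc, ← pow_succ, show e n + 1 = d by omega, hx.pow, mul_one]
    · rw [hc _ (hne _), hc e fun _ _ _ => rfl, Function.update_self]
      simp

theorem canon_split (i e : ℕ → ℕ) {a : ℕ} (ha : 1 ≤ a) (han : a < n) :
    canon n i e = pre (n - 1) i ++ (seg n e 1 (a - 1) ++ (piece n a (e a) ++
      (piece n (a + 1) (e (a + 1)) ++ seg n e (a + 2) (n - a - 1)))) := by
  have h1 := seg_add n e 1 (a - 1) (1 + (1 + (n - a - 1)))
  rw [show a - 1 + (1 + (1 + (n - a - 1))) = n by omega, show 1 + (a - 1) = a by omega,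
    seg_add, seg_one, seg_add, seg_one, show a + 1 + 1 = a + 2 by omega] at h1
  rw [canon, h1]

theorem commute_tail {z : ℕ → M} (hz : FarCommute z) (e : ℕ → ℕ) {a : ℕ} (h : a < n) :
    Commute (z a) (ev z (seg n e (a + 2) (n - a - 1))) := by
  apply hz.ev
  intro c hc
  obtain ⟨j, h1, h2, _, h3, _⟩ := mem_seg (by omega) hc
  omega

/-- The letter commutes past the later factors, then extends the factor with index a + 1 to one with
index a, or cancels the last letter of a factor with index a. -/
theorem step_shift (hx : BraidGens d n x) (hy : FarCommute y) {i e : ℕ → ℕ}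
    (hv : ValidData d n i e) {a : ℕ} (ha : 1 ≤ a) (han : a < n)
    (h0 : (e a = 0 ∧ e (a + 1) ≠ 0) ∨ (e a ≠ 0 ∧ e (a + 1) = 0)) : StepGoal x y d n i e a := by
  obtain ⟨f, hf⟩ : ∃ f, f = Function.update (Function.update e a (e (a + 1))) (a + 1) (e a) :=
    ⟨_, rfl⟩
  have hfa : f a = e (a + 1) := by
    rw [hf, Function.update_of_ne (by omega), Function.update_self]
  have hfa1 : f (a + 1) = e a := by rw [hf, Function.update_self]
  have hfne : ∀ j, j ≠ a → j ≠ a + 1 → f j = e j := by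
    intro j h1 h2
    rw [hf, Function.update_of_ne h2, Function.update_of_ne h1]
  have hvf : ValidData d n i f := by
    refine ⟨hv.pre, fun j h1 h2 => ?_⟩
    by_cases h3 : j = a
    · rw [h3, hfa]; exact hv.exp _ (by omega) (by omega)
    by_cases h4 : j = a + 1
    · rw [h4, hfa1]; exact hv.exp _ (by omega) (by omega)
    rw [hfne j h3 h4]; exact hv.exp j h1 h2
  have e1 := canon_split i e ha han
  have e2 := canon_split i f ha han
  rw [hfa, hfa1, seg_congr (e' := e) fun j h1 h2 => hfne j (by omega) (by omega),
    seg_congr (b := a + 2) (e' := e) fun j h1 h2 => hfne j (by omega) (by omega)] at e2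
  have htx := commute_tail hx.comm e han
  have hty := commute_tail hy e han
  have hpc : ∀ k, k ≠ 0 → piece n a k = piece n (a + 1) k ++ [a] := by
    intro k hk
    rw [piece_of_ne hk, piece_of_ne hk, desc_eq_append (show a ≤ n - 1 by omega), List.append_assoc]
  refine ⟨i, f, hvf, ?_⟩
  rw [e1, e2]
  rcases h0 with ⟨h0, h1⟩ | ⟨h0, h1⟩
  · rw [h0, hpc _ h1]
    refine ⟨?_, Or.inr ⟨?_, fun hg => ⟨⟨hg.incr, ?_⟩, ?_⟩⟩⟩
    · simp only [ev_append, ev_singleton, piece_zero, ev_nil, one_mul, mul_assoc]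
      rw [htx.eq]
    · simp; omega
    · intro j hj hjn hje p hp hpn hpi
      by_cases hja : j = a
      · exact absurd h0 (hja ▸ hje)
      have hfane : f a ≠ 0 := by rw [hfa]; exact h1
      -- The factor at a + 1 in the old word is the one at a in the new word. Being below a implies
      -- being below a + 1, and the single-factor exception carries over.
      by_cases hja1 : j = a + 1
      · rcases hg.below a (by omega) (by omega) hfane p hp hpn hpi with h | h
        · exact Or.inl (by omega)
        · refine Or.inr ⟨h.1, fun j' h2 h3 h4 => ?_⟩
          by_cases hj'a : j' = a
          · rw [hj'a, h0]
          · rw [← hfne j' hj'a (by omega)]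
            exact h.2 j' h2 h3 hj'a
      · rcases hg.below j hj hjn (by rwa [hfne j hja hja1]) p hp hpn hpi with h | h
        · exact Or.inl h
        · exact absurd (h.2 a (by omega) (by omega) (Ne.symm hja)) hfane
    · simp only [ev_append, ev_singleton, piece_zero, ev_nil, one_mul, mul_assoc]
      rw [hty.eq]
  · rw [h1, hpc _ h0]
    refine ⟨?_, Or.inl ?_⟩
    · simp only [ev_append, ev_singleton, piece_zero, ev_nil, one_mul, mul_assoc]
      rw [← htx.eq, ← mul_assoc (x a) (x a), hx.sq a ha han, one_mul]
    · simp

/-- By `piece_swap` the two exponents change places and an s_{n-1} is released, which crosses the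
earlier suffix factors and enters the prefix. -/
theorem step_swap (hx : BraidGens d n x) (hy : FarCommute y) {i e : ℕ → ℕ}
    (hv : ValidData d n i e) {a : ℕ} (ha : 1 ≤ a) (han : a < n)
    (h0 : e a ≠ 0) (h1 : e (a + 1) ≠ 0) : StepGoal x y d n i e a := by
  obtain ⟨f, hf⟩ : ∃ f, f = Function.update (Function.update e a (e (a + 1))) (a + 1) (e a) :=
    ⟨_, rfl⟩
  have hfa : f a = e (a + 1) := by
    rw [hf, Function.update_of_ne (by omega), Function.update_self]
  have hfa1 : f (a + 1) = e a := by rw [hf, Function.update_self]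
  have hfne : ∀ j, j ≠ a → j ≠ a + 1 → f j = e j := by
    intro j h1 h2
    rw [hf, Function.update_of_ne h2, Function.update_of_ne h1]
  obtain ⟨a', hb1, hb2, _, hb4, hb5, hb6⟩ := seg_pass hx e (a - 1) (n - 1) (by omega) (by omega)
  obtain ⟨i', hi1, _, hi3, hi4⟩ := pre_step hy hx (n - 1) (by omega) i hv.pre a' hb1 hb2
  have hvf : ValidData d n i' f := by
    refine ⟨hi1, fun j h1 h2 => ?_⟩
    by_cases h3 : j = a
    · rw [h3, hfa]; exact hv.exp _ (by omega) (by omega)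
    by_cases h4 : j = a + 1
    · rw [h4, hfa1]; exact hv.exp _ (by omega) (by omega)
    rw [hfne j h3 h4]; exact hv.exp j h1 h2
  have e1 := canon_split i e ha han
  have e2 := canon_split i' f ha han
  rw [hfa, hfa1, seg_congr (e' := e) fun j h1 h2 => hfne j (by omega) (by omega),
    seg_congr (b := a + 2) (e' := e) fun j h1 h2 => hfne j (by omega) (by omega)] at e2
  have htx := commute_tail hx.comm e han
  have hsw := piece_swap hx (k := e a) (l := e (a + 1)) ha han h0 h1
  refine ⟨i', f, hvf, ?_, ?_⟩
  · rw [e1, e2]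
    simp only [ev_append, hi3]
    rw [mul_assoc _ (x a'), ← mul_assoc (x a'), ← hb4]
    simp only [mul_assoc] at hsw ⊢
    rw [← htx.eq, ← mul_assoc (ev x (piece n (a + 1) (e (a + 1)))),
      ← mul_assoc (ev x (piece n a (e a))), hsw]
    simp only [mul_assoc]
  · rw [e1, e2]
    simp only [List.length_append, piece_of_ne h0, piece_of_ne h1, List.length_replicate,
      length_desc]
    refine hi4.imp (fun h => by omega) (fun h => ⟨by omega, fun hg => ?_⟩)
    -- A longer word is never good here. The absorbed letter lies at or above a nonempty suffix
    -- index, which goodness allows only with a single suffix factor; but the factors at a and a + 1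
    -- are both nonempty.
    exfalso
    obtain ⟨q, hq1, hq2, hq3, hq4, hq5, _⟩ := h.2 hg.incr
    have haq : a' ≤ q := by
      have := hv.pre q hq1 hq2
      rw [hq4, Function.update_self] at this
      omega
    have hfa0 : f a ≠ 0 := by rwa [hfa]
    have hfa10 : f (a + 1) ≠ 0 := by rwa [hfa1]
    by_cases hz : ∀ j, 1 ≤ j → j ≤ a - 1 → e j = 0
    · have := hb5 hz
      have := (hg.absorb_lt hq1 hq2 hq3 haq hq5 ha (by omega) hfa0 (by omega)).2 (a + 1)
        (by omega) (by omega) (by omega)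
      exact hfa10 this
    · push Not at hz
      obtain ⟨_, j, hj1, hj2, hj3, hj4⟩ := hb6 hz
      have := (hg.absorb_lt hq1 hq2 hq3 haq hq5 hj1 (by omega)
        (by rwa [hfne j (by omega) (by omega)]) (by omega)).2 a (by omega) (by omega) (by omega)
      exact hfa0 this

/-- No factor has index a or a + 1, so the letter crosses the whole suffix and is dealt with by the
prefix. -/
theorem step_pass (hx : BraidGens d n x) (hy : FarCommute y) {i e : ℕ → ℕ}
    (hv : ValidData d n i e) {a : ℕ} (ha : 1 ≤ a) (han : a < n)
    (h0 : e a = 0) (h1 : e (a + 1) = 0) : StepGoal x y d n i e a := by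
  obtain ⟨a', hb1, hb2, _, hb4, hb5, hb6⟩ := seg_pass hx e (a - 1) a (by omega) (by omega)
  obtain ⟨i', hi1, _, hi3, hi4⟩ := pre_step hy hx (n - 1) (by omega) i hv.pre a' hb1 (by omega)
  have e1 := canon_split i e ha han
  have e2 := canon_split i' e ha han
  have htx := commute_tail hx.comm e han
  refine ⟨i', e, ⟨hi1, hv.exp⟩, ?_, ?_⟩
  · rw [e1, e2, h0, h1]
    simp only [ev_append, hi3, piece_zero, ev_nil, one_mul]
    rw [mul_assoc _ (x a'), ← mul_assoc (x a'), ← hb4]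
    simp only [mul_assoc]
    rw [← htx.eq]
  · rw [canon, canon]
    simp only [List.length_append]
    refine hi4.imp (fun h => by omega) (fun h => ⟨by omega, fun hg => ?_⟩)
    obtain ⟨q, hq1, hq2, hq3, hq4, hq5, hq6⟩ := h.2 hg.incr
    have haq : a' ≤ q := by
      have := hv.pre q hq1 hq2
      rw [hq4, Function.update_self] at this
      omega
    -- A factor before position a would have lowered the letter below n - 1, the only value
    -- `Good.absorb_lt` permits. Hence the letter crosses by commutations only.
    have hz : ∀ j, 1 ≤ j → j ≤ a - 1 → e j = 0 := by
      by_contra hz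
      push Not at hz
      obtain ⟨_, j, hj1, hj2, hj3, hj4⟩ := hb6 hz
      have := (hg.absorb_lt hq1 hq2 hq3 haq hq5 hj1 (by omega) hj3 hj4).1
      omega
    have haa := hb5 hz
    rw [haa] at hq3 hq4 hq5 hq6 haq
    have hz' : ∀ j, 1 ≤ j → e j ≠ 0 → a + 2 ≤ j := by
      intro j hj hje
      by_contra hlt
      rcases (show j ≤ a - 1 ∨ j = a ∨ j = a + 1 by omega) with h | h | h
      · exact hje (hz j hj h)
      · exact hje (h ▸ h0)
      · exact hje (h ▸ h1)
    refine ⟨⟨?_, ?_⟩, ?_⟩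
    · rw [hq4]
      exact hg.incr.update hq3 hq1 hq2 haq hq5
    · intro j hj hjn hje p hp hpn hpi
      have hj2 := hz' j hj hje
      by_cases hpq : p = q
      · left
        rw [hpq, hq4, Function.update_self]
        omega
      · rw [hq4, Function.update_of_ne hpq] at hpi ⊢
        rcases hg.below j hj hjn hje p hp hpn hpi with h | h
        · exact Or.inl h
        · by_cases hpq' : p ≤ q
          · have := h.1 q hpq' hq2
            have := h.1 p le_rfl hpn
            left; omega
          · refine Or.inr ⟨fun q' hq' hq'' => ?_, h.2⟩
            rw [Function.update_of_ne (by omega)]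
            exact h.1 q' hq' hq''
    · have : Commute (y a) (ev y (seg n e 1 n)) := by
        apply hy.ev
        intro c hc
        obtain ⟨j, h1, h2, h3, h4, _⟩ := mem_seg (by omega) hc
        have := hz' j h1 h3
        omega
      rw [ev_append, ev_append, ← hq6, mul_assoc, mul_assoc, this.eq]

/-- Appending a letter to a canonical word: the canonical word of the product is at most as long, or
one letter longer, and in the latter case the letter is absorbed by commutations if the new word is
good. -/
theorem step (hx : BraidGens d n x) (hy : FarCommute y) (hd : 0 < d) {i e : ℕ → ℕ}
    (hv : ValidData d n i e) {a : ℕ} (ha : 1 ≤ a) (han : a ≤ n) : StepGoal x y d n i e a := by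
  rcases eq_or_lt_of_le han with rfl | han
  · exact step_last hx hd ha hv
  by_cases h0 : e a = 0 <;> by_cases h1 : e (a + 1) = 0
  · exact step_pass hx hy hv ha han h0 h1
  · exact step_shift hx hy hv ha han (Or.inl ⟨h0, h1⟩)
  · exact step_shift hx hy hv ha han (Or.inr ⟨h0, h1⟩)
  · exact step_swap hx hy hv ha han h0 h1

end step

/-! ### The group `G(d,1,n)`, the trace monoid, and the monomial representation -/

/-- The generators of `G(d,1,n)`, indexed by natural numbers. -/
def sN (d n a : ℕ) : G1 d n := if h : 1 ≤ a ∧ a ≤ n then s d n ⟨a, h⟩ else 1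

theorem sN_of_mem {d n a : ℕ} (h : 1 ≤ a ∧ a ≤ n) : sN d n a = s d n ⟨a, h⟩ := dif_pos h

theorem braidGens_sN (d n : ℕ) (hn : 1 ≤ n) : BraidGens d n (sN d n) where
  comm a b hab := by
    by_cases ha : 1 ≤ a ∧ a ≤ n
    · by_cases hb : 1 ≤ b ∧ b ≤ n
      · rw [sN_of_mem ha, sN_of_mem hb]
        have := s_rel (Rel1.comm (d := d) (⟨b, hb⟩ : Letter n) ⟨a, ha⟩ hab)
        simp only [map_mul, FreeGroup.lift_apply_of] at this
        exact this.symm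
      · rw [sN, sN, dif_neg hb]; exact Commute.one_right _
    · rw [sN, dif_neg ha]; exact Commute.one_left _
  sq a h1 h2 := by
    rw [sN_of_mem ⟨h1, h2.le⟩]
    simpa [pow_two] using s_rel (Rel1.sq (d := d) (⟨a, h1, h2.le⟩ : Letter n) h2)
  braid a h1 h2 := by
    rw [sN_of_mem ⟨h1, by omega⟩, sN_of_mem ⟨by omega, h2.le⟩]
    simpa using s_rel (Rel1.braid (d := d) (⟨a, h1, by omega⟩ : Letter n)
      ⟨a + 1, by omega, h2.le⟩ rfl (by simp only; omega))
  last a h1 h2 := by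
    rw [sN_of_mem ⟨h1, by omega⟩, sN_of_mem ⟨hn, le_rfl⟩]
    simpa using s_rel (Rel1.braid_last (d := d) (⟨n, hn, le_rfl⟩ : Letter n)
      ⟨a, h1, by omega⟩ rfl h2)
  pow := by
    rw [sN_of_mem ⟨hn, le_rfl⟩]
    simpa using s_rel (Rel1.pow_last (d := d) (⟨n, hn, le_rfl⟩ : Letter n) rfl)

theorem evalWord_eq_ev (d n : ℕ) (w : List (Letter n)) :
    evalWord d n w = ev (sN d n) (w.map Subtype.val) := by
  simp only [evalWord, ev, List.map_map]
  congr 2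
  funext a
  exact (sN_of_mem a.2).symm

/-- All letters of the word lie in `{1, …, n}`. -/
def IsWord (n : ℕ) (w : List ℕ) : Prop := ∀ a ∈ w, 1 ≤ a ∧ a ≤ n

theorem isWord_map (n : ℕ) (w : List (Letter n)) : IsWord n (w.map Subtype.val) := by
  intro a ha
  obtain ⟨b, _, rfl⟩ := List.mem_map.1 ha
  exact b.2

theorem IsWord.exists_map {n : ℕ} {w : List ℕ} (h : IsWord n w) :
    ∃ u : List (Letter n), u.map Subtype.val = w :=
  ⟨w.attachWith _ h, List.attachWith_map_subtype_val _⟩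

/-- Inverses are not needed, because every generator has order dividing 2d. -/
theorem exists_word (d n : ℕ) (hd : 0 < d) (hn : 1 ≤ n) (g : G1 d n) :
    ∃ w, IsWord n w ∧ ev (sN d n) w = g := by
  have hx := braidGens_sN d n hn
  let H : Subgroup (G1 d n) :=
    { carrier := {g | ∃ w, IsWord n w ∧ ev (sN d n) w = g}
      mul_mem' := by
        rintro _ _ ⟨u, hu, rfl⟩ ⟨v, hv, rfl⟩
        refine ⟨u ++ v, ?_, ev_append _ _⟩
        intro a ha
        rcases List.mem_append.1 ha with h | h
        exacts [hu a h, hv a h]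
      one_mem' := ⟨[], by simp [IsWord], rfl⟩
      inv_mem' := by
        rintro _ ⟨w, hw, rfl⟩
        change ∃ v, IsWord n v ∧ ev (sN d n) v = (ev (sN d n) w)⁻¹
        induction w with
        | nil => exact ⟨[], by simp [IsWord], by simp⟩
        | cons a w ih =>
          obtain ⟨v, hv, hvw⟩ := ih fun b hb => hw b (List.mem_cons_of_mem _ hb)
          have ha := hw a List.mem_cons_self
          have hpow : sN d n a ^ (2 * d) = 1 := by
            rcases eq_or_lt_of_le ha.2 with h | h
            · rw [h, mul_comm, pow_mul, hx.pow, one_pow]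
            · rw [pow_mul, pow_two, hx.sq a ha.1 h, one_pow]
          refine ⟨v ++ List.replicate (2 * d - 1) a, ?_, ?_⟩
          · intro b hb
            rcases List.mem_append.1 hb with h | h
            · exact hv b h
            · rw [(List.mem_replicate.1 h).2]; exact ha
          · rw [ev_append, ev_cons, ev_replicate, mul_inv_rev, hvw]
            congr 1
            rw [eq_inv_iff_mul_eq_one, ← pow_succ, show 2 * d - 1 + 1 = 2 * d by omega, hpow] }
  have : g ∈ H := by
    refine PresentedGroup.generated_by _ H (fun a => ?_) g
    refine ⟨[a.1], ?_, ?_⟩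
    · intro b hb
      rw [List.mem_singleton.1 hb]; exact a.2
    · rw [ev_singleton, sN_of_mem a.2]; rfl
  exact this

/-- The congruence on words given by the commutations. -/
def commCon (n : ℕ) : Con (FreeMonoid (Letter n)) where
  r u v := CommEquiv n u.toList v.toList
  iseqv := ⟨fun _ => Relation.EqvGen.refl _, fun h => h.symm _ _, fun h h' => h.trans _ _ _ h'⟩
  mul' := by
    intro u u' v v' h h'
    have h1 : ∀ (w a b : List (Letter n)), CommEquiv n a b → CommEquiv n (a ++ w) (b ++ w) := by
      intro w a b hab
      induction hab with
      | rel a b hab =>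
        obtain ⟨x, y, i, j, hij, rfl, rfl⟩ := hab
        exact Relation.EqvGen.rel _ _ ⟨x, y ++ w, i, j, hij, by simp, by simp⟩
      | refl => exact Relation.EqvGen.refl _
      | symm _ _ _ ih => exact ih.symm _ _
      | trans _ _ _ _ _ ih ih' => exact ih.trans _ _ _ ih'
    have h2 : ∀ (w a b : List (Letter n)), CommEquiv n a b → CommEquiv n (w ++ a) (w ++ b) := by
      intro w a b hab
      induction hab with
      | rel a b hab =>
        obtain ⟨x, y, i, j, hij, rfl, rfl⟩ := hab
        exact Relation.EqvGen.rel _ _ ⟨w ++ x, y, i, j, hij, by simp, by simp⟩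
      | refl => exact Relation.EqvGen.refl _
      | symm _ _ _ ih => exact ih.symm _ _
      | trans _ _ _ _ _ ih ih' => exact ih.trans _ _ _ ih'
    exact (h1 _ _ _ h).trans _ _ _ (h2 _ _ _ h')

/-- The generators of the trace monoid. -/
def trace (n a : ℕ) : (commCon n).Quotient :=
  if h : 1 ≤ a ∧ a ≤ n then ((FreeMonoid.of (⟨a, h⟩ : Letter n) : FreeMonoid (Letter n)) :
    (commCon n).Quotient) else 1

theorem farCommute_trace (n : ℕ) : FarCommute (trace n) := by
  intro a b hab
  by_cases ha : 1 ≤ a ∧ a ≤ n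
  · by_cases hb : 1 ≤ b ∧ b ≤ n
    · rw [trace, dif_pos ha, trace, dif_pos hb]
      change _ * _ = _ * _
      rw [← Con.coe_mul, ← Con.coe_mul, Con.eq]
      exact (Relation.EqvGen.rel _ _ ⟨[], [], ⟨b, hb⟩, ⟨a, ha⟩, hab, rfl, rfl⟩).symm _ _
    · rw [trace, trace, dif_neg hb]; exact Commute.one_right _
  · rw [trace, dif_neg ha]; exact Commute.one_left _

theorem ev_trace (n : ℕ) (w : List (Letter n)) :
    ev (trace n) (w.map Subtype.val) =
      ((FreeMonoid.ofList w : FreeMonoid (Letter n)) : (commCon n).Quotient) := by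
  induction w with
  | nil => rfl
  | cons a w ih =>
    rw [List.map_cons, ev_cons, ih, trace, dif_pos a.2, ← Con.coe_mul]
    rfl

theorem commEquiv_of_ev_trace {n : ℕ} {u v : List (Letter n)}
    (h : ev (trace n) (u.map Subtype.val) = ev (trace n) (v.map Subtype.val)) :
    CommEquiv n u v := by
  rw [ev_trace, ev_trace, Con.eq] at h
  exact h

/-- The action of the generators on `ℕ × ℤ/d` by monomial transformations. -/
def mono (d n a : ℕ) : Equiv.Perm (ℕ × ZMod d) :=
  if a = n then Equiv.prodShear (Equiv.refl ℕ)
    (fun j => if j = n then Equiv.addRight 1 else Equiv.refl _)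
  else (Equiv.swap a (a + 1)).prodCongr (Equiv.refl _)

theorem mono_last (d n : ℕ) (z : ℕ) (c : ZMod d) :
    mono d n n (z, c) = (z, if z = n then c + 1 else c) := by
  simp only [mono, if_pos, Equiv.prodShear_apply, Equiv.refl_apply]
  split_ifs <;> simp

theorem mono_of_ne {d n a : ℕ} (h : a ≠ n) (z : ℕ) (c : ZMod d) :
    mono d n a (z, c) = (if z = a then a + 1 else if z = a + 1 then a else z, c) := by
  simp [mono, if_neg h, Equiv.swap_apply_def]

theorem mono_last_pow (d n k : ℕ) (z : ℕ) (c : ZMod d) :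
    (mono d n n ^ k) (z, c) = (z, if z = n then c + k else c) := by
  induction k generalizing c with
  | zero => simp
  | succ k ih =>
    rw [pow_succ, Equiv.Perm.mul_apply, mono_last, ih]
    split_ifs <;> simp [add_comm, add_left_comm]

theorem mono_rel {d n : ℕ} {u v : FreeGroup (Letter n)} (h : Rel1 d n u v) :
    FreeGroup.lift (fun a : Letter n => mono d n a.1) u =
      FreeGroup.lift (fun a : Letter n => mono d n a.1) v := by
  cases h with
  | pow_last i hi =>
    simp only [map_pow, FreeGroup.lift_apply_of, map_one, hi]
    ext ⟨z, c⟩ : 1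
    rw [mono_last_pow]
    simp
  | sq i hi =>
    simp only [pow_two, map_mul, FreeGroup.lift_apply_of, map_one]
    ext ⟨z, c⟩ : 1
    simp only [Equiv.Perm.mul_apply, mono_of_ne hi.ne, Equiv.Perm.one_apply]
    congr 1
    split_ifs <;> omega
  | comm i j h =>
    simp only [map_mul, FreeGroup.lift_apply_of]
    have hj : j.1 ≠ n := by have := i.2.2; omega
    ext ⟨z, c⟩ : 1
    by_cases hi : i.1 = n
    · simp only [Equiv.Perm.mul_apply, hi, mono_of_ne hj, mono_last]
      congr 1
      split_ifs <;> first | rfl | omega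
    · simp only [Equiv.Perm.mul_apply, mono_of_ne hj, mono_of_ne hi]
      congr 1
      split_ifs <;> omega
  | braid i j hj hi =>
    simp only [map_mul, FreeGroup.lift_apply_of]
    ext ⟨z, c⟩ : 1
    have hi0 : i.1 ≠ n := by omega
    have hi1 : i.1 + 1 ≠ n := by omega
    have hi2 : ¬ i.1 = i.1 + 1 + 1 := by omega
    have hi3 : ¬ i.1 + 1 + 1 = i.1 := by omega
    simp only [Equiv.Perm.mul_apply, hj]
    by_cases h1 : z = i.1
    · simp [h1, mono_of_ne hi0, mono_of_ne hi1, hi2, hi3]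
    by_cases h2 : z = i.1 + 1
    · simp [h2, mono_of_ne hi0, mono_of_ne hi1, hi2, hi3]
    by_cases h3 : z = i.1 + 2
    · simp [h3, mono_of_ne hi0, mono_of_ne hi1, hi2]
    · simp [h1, h2, h3, mono_of_ne hi0, mono_of_ne hi1]
  | braid_last i j hi hj =>
    simp only [map_mul, FreeGroup.lift_apply_of]
    ext ⟨z, c⟩ : 1
    simp only [Equiv.Perm.mul_apply, hi, mono_of_ne (show j.1 ≠ n by omega), mono_last]
    by_cases h1 : z = j.1
    · simp [h1, hj, show j.1 ≠ n by omega, show n ≠ j.1 by omega]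
    · by_cases h2 : z = n
      · simp [h2, hj, show n ≠ j.1 by omega, show j.1 ≠ n by omega]
      · simp [h1, h2, hj]

/-- The monomial representation of `G(d,1,n)`. -/
def monoHom (d n : ℕ) : G1 d n →* Equiv.Perm (ℕ × ZMod d) :=
  PresentedGroup.toGroup (f := fun a : Letter n => mono d n a.1) (by
    rintro _ ⟨u, v, h, rfl⟩
    rw [map_mul, map_inv, mono_rel h, mul_inv_cancel])

theorem monoHom_ev {d n : ℕ} {w : List ℕ} (h : IsWord n w) :
    monoHom d n (ev (sN d n) w) = ev (mono d n) w := by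
  induction w with
  | nil => simp
  | cons a w ih =>
    rw [ev_cons, ev_cons, map_mul, ih fun b hb => h b (List.mem_cons_of_mem _ hb),
      sN_of_mem (h a List.mem_cons_self)]
    congr 1

/-! ### Uniqueness of canonical words -/

theorem mono_desc {d n p j : ℕ} (hj : 1 ≤ j) (hp : p < n) (z : ℕ) (c : ZMod d) :
    ev (mono d n) (desc p j) (z, c) =
      (if z = j ∧ j ≤ p then p + 1 else if j < z ∧ z ≤ p + 1 then z - 1 else z, c) := by
  induction p with
  | zero =>
    rw [desc_of_lt (by omega), ev_nil, Equiv.Perm.one_apply]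
    congr 1
    split_ifs <;> omega
  | succ p ih =>
    rcases Nat.lt_or_ge (p + 1) j with h | h
    · rw [desc_of_lt h, ev_nil, Equiv.Perm.one_apply]
      congr 1
      split_ifs <;> omega
    · rw [desc_split (p := p + 1) (b := p) h (by omega), desc_eq_append (i := p + 1) le_rfl,
        desc_of_lt (Nat.lt_succ_self _), List.nil_append, ev_append, ev_singleton,
        Equiv.Perm.mul_apply, ih (by omega), mono_of_ne (by omega)]
      congr 1
      split_ifs <;> omega

theorem mono_pre_snd {d n p : ℕ} {i : ℕ → ℕ} (hi : ValidPre p i) (hp : p < n) (u : ℕ × ZMod d) :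
    (ev (mono d n) (pre p i) u).2 = u.2 := by
  induction p generalizing u with
  | zero => rfl
  | succ p ih =>
    rw [pre_succ, ev_append, Equiv.Perm.mul_apply, ih (hi.mono (by omega)) (by omega),
      mono_desc (hi _ (by omega) le_rfl).1 hp]

theorem mono_pre_fix {d n p : ℕ} {i : ℕ → ℕ} (hi : ValidPre p i) (hp : p < n) {z : ℕ}
    (hz : p + 1 < z) (c : ZMod d) : ev (mono d n) (pre p i) (z, c) = (z, c) := by
  induction p with
  | zero => rfl
  | succ p ih =>
    have := hi (p + 1) (by omega) le_rfl
    rw [pre_succ, ev_append, Equiv.Perm.mul_apply, mono_desc this.1 hp, if_neg (by omega),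
      if_neg (by omega), ih (hi.mono (by omega)) (by omega) (by omega)]

/-- The last lower index is the point sent to the top position, since the earlier factors fix that
position. Cancelling the last factor leaves a shorter prefix. -/
theorem pre_injective {d n p : ℕ} {i i' : ℕ → ℕ} (hi : ValidPre p i) (hi' : ValidPre p i')
    (hp : p < n) (h : ev (mono d n) (pre p i) = ev (mono d n) (pre p i')) :
    ∀ q, 1 ≤ q → q ≤ p → i q = i' q := by
  induction p with
  | zero => intro q _ _; omega
  | succ p ih =>
    have h1 := hi (p + 1) (by omega) le_rfl
    have h2 := hi' (p + 1) (by omega) le_rfl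
    have hlast : i (p + 1) = i' (p + 1) := by
      by_contra hne
      have h3 := congrArg (fun f => f (i (p + 1), (0 : ZMod d))) h
      have h4 : ev (mono d n) (desc (p + 1) (i (p + 1))) (i (p + 1), (0 : ZMod d)) =
          (p + 2, 0) := by
        rw [mono_desc h1.1 hp]
        congr 1
        split_ifs <;> omega
      simp only [pre_succ, ev_append, Equiv.Perm.mul_apply] at h3
      rw [h4, mono_desc h2.1 hp, mono_pre_fix (hi.mono (by omega)) (by omega) (by omega),
        ← mono_pre_fix (hi'.mono (show p ≤ p + 1 by omega)) (show p < n by omega)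
          (show p + 1 < p + 2 by omega)] at h3
      have h5 := congrArg Prod.fst ((ev (mono d n) (pre p i')).injective h3)
      simp only at h5
      split_ifs at h5 <;> omega
    intro q hq1 hq2
    rcases eq_or_lt_of_le hq2 with rfl | hq2
    · exact hlast
    · refine ih (hi.mono (by omega)) (hi'.mono (by omega)) (by omega) ?_ q hq1 (by omega)
      rw [pre_succ, pre_succ, ev_append, ev_append, hlast] at h
      exact mul_right_cancel h

theorem mono_piece {d n j k : ℕ} (hj : 1 ≤ j) (hjn : j ≤ n) (hk : k ≠ 0) (z : ℕ) (c : ZMod d) :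
    ev (mono d n) (piece n j k) (z, c) =
      if z = j then (n, c + k) else if j < z ∧ z ≤ n then (z - 1, c)
      else (z, c) := by
  rw [piece_of_ne hk, ev_append, ev_replicate, Equiv.Perm.mul_apply,
    mono_desc hj (by omega), mono_last_pow]
  by_cases h1 : z = j
  · subst h1
    rw [if_pos rfl]
    by_cases h2 : z ≤ n - 1
    · rw [if_pos ⟨rfl, h2⟩, show n - 1 + 1 = n by omega, if_pos rfl]
    · rw [if_neg (by omega), if_neg (by omega), show z = n by omega, if_pos rfl]
  · rw [if_neg h1, if_neg (by omega)]
    by_cases h2 : j < z ∧ z ≤ n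
    · rw [if_pos (by omega), if_pos h2, if_neg (by omega)]
    · rw [if_neg (by omega), if_neg h2, if_neg (by omega)]

theorem mono_seg_snd {d n b : ℕ} (e : ℕ → ℕ) {z : ℕ} (hz : b < z) (hzn : z ≤ n) (c : ZMod d) :
    (ev (mono d n) (seg n e 1 b) (z, c)).2 = c := by
  induction b generalizing z with
  | zero => rfl
  | succ b ih =>
    rw [seg_add, seg_one, ev_append, Equiv.Perm.mul_apply, add_comm 1 b]
    by_cases h : e (b + 1) = 0
    · rw [h, piece_zero, ev_nil, Equiv.Perm.one_apply]
      exact ih (by omega) hzn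
    · rw [mono_piece (by omega) (by omega) h, if_neg (by omega), if_pos ⟨hz, hzn⟩]
      exact ih (by omega) (by omega)

theorem mono_seg_fix {d n b m : ℕ} (e : ℕ → ℕ) {z : ℕ} (hz : z < b) (hb : b + m ≤ n + 1)
    (c : ZMod d) : ev (mono d n) (seg n e b m) (z, c) = (z, c) := by
  induction m with
  | zero => rfl
  | succ m ih =>
    rw [seg_add, seg_one, ev_append, Equiv.Perm.mul_apply]
    by_cases h : e (b + m) = 0
    · rw [h, piece_zero, ev_nil, Equiv.Perm.one_apply, ih (by omega)]
    · rw [mono_piece (by omega) (by omega) h, if_neg (by omega), if_neg (by omega),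
        ih (by omega)]

/-- Factors to the right of the j-th fix j; the j-th, if present, sends j to n and adds its
exponent; the factors to its left only lower the position, and the prefix does not touch the ℤ/d
coordinate. -/
theorem mono_canon_snd {d n : ℕ} {i e : ℕ → ℕ} (hv : ValidData d n i e) {j : ℕ} (hj : 1 ≤ j)
    (hjn : j ≤ n) : (ev (mono d n) (canon n i e) (j, 0)).2 = (e j : ZMod d) := by
  have h1 := seg_add n e 1 (j - 1) (1 + (n - j))
  rw [seg_add n e (1 + (j - 1)), seg_one, show j - 1 + (1 + (n - j)) = n by omega,
    show 1 + (j - 1) = j by omega] at h1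
  rw [canon, h1]
  simp only [ev_append, Equiv.Perm.mul_apply]
  rw [mono_pre_snd hv.pre (by omega),
    mono_seg_fix (b := j + 1) e (Nat.lt_succ_self j) (by omega)]
  by_cases h : e j = 0
  · rw [h, piece_zero, ev_nil, Equiv.Perm.one_apply, mono_seg_snd e (by omega) hjn]
    simp
  · rw [mono_piece hj hjn h, if_pos rfl, mono_seg_snd e (by omega) le_rfl]
    simp

theorem isWord_canon {d n : ℕ} {i e : ℕ → ℕ} (hv : ValidData d n i e) : IsWord n (canon n i e) := by
  intro a ha
  rw [canon, List.mem_append] at ha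
  rcases ha with ha | ha
  · simp only [pre, List.mem_flatMap, List.mem_range'_1, mem_desc] at ha
    obtain ⟨q, hq, h1, h2⟩ := ha
    have := hv.pre q hq.1 (by omega)
    omega
  · obtain ⟨j, h1, _, _, h2, h3⟩ := mem_seg (by omega) ha
    omega

/-- The canonical word of an element is unique. -/
theorem canon_injective {d n : ℕ} (hn : 1 ≤ n) {i e i' e' : ℕ → ℕ} (hv : ValidData d n i e)
    (hv' : ValidData d n i' e')
    (h : ev (sN d n) (canon n i e) = ev (sN d n) (canon n i' e')) :
    (∀ q, 1 ≤ q → q ≤ n - 1 → i q = i' q) ∧ ∀ j, 1 ≤ j → j ≤ n → e j = e' j := by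
  have h1 : ev (mono d n) (canon n i e) = ev (mono d n) (canon n i' e') := by
    rw [← monoHom_ev (isWord_canon hv), h, monoHom_ev (isWord_canon hv')]
  have he : ∀ j, 1 ≤ j → j ≤ n → e j = e' j := by
    intro j hj hjn
    have h2 := mono_canon_snd hv hj hjn
    rw [h1, mono_canon_snd hv' hj hjn, ZMod.natCast_eq_natCast_iff] at h2
    exact (Nat.ModEq.eq_of_lt_of_lt h2 (hv'.exp j hj hjn) (hv.exp j hj hjn)).symm
  refine ⟨?_, he⟩
  rw [canon, canon, seg_congr (e' := e') fun j h1 h2 => he j h1 (by omega), ev_append,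
    ev_append] at h1
  exact pre_injective hv.pre hv'.pre (by omega) (mul_right_cancel h1)

theorem canon_congr {n : ℕ} {i e i' e' : ℕ → ℕ} (hi : ∀ q, 1 ≤ q → q ≤ n - 1 → i q = i' q)
    (he : ∀ j, 1 ≤ j → j ≤ n → e j = e' j) : canon n i e = canon n i' e' := by
  rw [canon, canon, pre_congr hi, seg_congr fun j h1 h2 => he j h1 (by omega)]

theorem Good.congr {n : ℕ} {i e i' e' : ℕ → ℕ} (hi : ∀ q, 1 ≤ q → q ≤ n - 1 → i q = i' q)
    (he : ∀ j, 1 ≤ j → j ≤ n → e j = e' j) (h : Good n i e) : Good n i' e' := by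
  constructor
  · intro q q' h1 h2 h3 h4 h5
    rw [← hi q h1 (by omega)] at h4 ⊢
    rw [← hi q' (by omega) h3] at h5 ⊢
    exact h.incr q q' h1 h2 h3 h4 h5
  · intro j hj hjn hje p hp hpn hpi
    rw [← hi p hp hpn] at hpi ⊢
    rw [← he j hj hjn] at hje
    exact (h.below j hj hjn hje p hp hpn hpi).imp_right fun h => ⟨fun q h1 h2 => by
      rw [← hi q (by omega) h2]; exact h.1 q h1 h2, fun j' h1 h2 h3 => by
      rw [← he j' h1 h2]; exact h.2 j' h1 h2 h3⟩

/-! ### Canonical words are reduced -/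

/-- Every word has the same value as a canonical word that is not longer; if it is equally long and
good, the two words differ by commutations. -/
theorem exists_canon {d n : ℕ} (hd : 0 < d) (hn : 1 ≤ n) (w : List ℕ) (hw : IsWord n w) :
    ∃ i e, ValidData d n i e ∧ ev (sN d n) (canon n i e) = ev (sN d n) w ∧
      (canon n i e).length ≤ w.length ∧
      (w.length = (canon n i e).length → Good n i e →
        ev (trace n) w = ev (trace n) (canon n i e)) := by
  induction w using List.reverseRecOn with
  | nil =>
    -- Lower index q + 1 is the convention for an empty q-th factor.
    have h0 : canon n (fun q => q + 1) (fun _ => 0) = [] := by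
      have h1 : ∀ p, pre p (fun q => q + 1) = [] := by
        intro p
        induction p with
        | zero => rfl
        | succ p ih => rw [pre_succ, ih, desc_of_lt (by omega)]; rfl
      rw [canon, h1]
      simp [seg]
    refine ⟨fun q => q + 1, fun _ => 0, ⟨fun q _ _ => ⟨by omega, le_rfl⟩, fun _ _ _ => hd⟩, ?_⟩
    rw [h0]
    simp
  | append_singleton w a ih =>
    obtain ⟨i, e, hv, h1, h2, h3⟩ := ih fun b hb => hw b (List.mem_append_left _ hb)
    have ha := hw a (List.mem_append_right _ (List.mem_singleton_self a))
    obtain ⟨i', e', hv', h4, h5⟩ :=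
      step (braidGens_sN d n hn) (farCommute_trace n) hd hv ha.1 ha.2
    refine ⟨i', e', hv', ?_, ?_, ?_⟩
    · rw [h4, h1, ev_append, ev_singleton]
    · rw [List.length_append, List.length_singleton]
      omega
    · intro hlen hg
      rw [List.length_append, List.length_singleton] at hlen
      rcases h5 with h5 | ⟨h5, h6⟩
      · omega
      · obtain ⟨h7, h8⟩ := h6 hg
        rw [ev_append, ev_singleton, h3 (by omega) h7, h8]

/-- Any competing word reduces to a canonical word that is no longer, and by uniqueness this is the
given one. -/
theorem length_canon_le {d n : ℕ} (hd : 0 < d) (hn : 1 ≤ n) {i e : ℕ → ℕ}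
    (hv : ValidData d n i e) {w : List ℕ} (hw : IsWord n w)
    (h : ev (sN d n) w = ev (sN d n) (canon n i e)) : (canon n i e).length ≤ w.length := by
  obtain ⟨i', e', hv', h1, h2, _⟩ := exists_canon hd hn w hw
  obtain ⟨hi, he⟩ := canon_injective hn hv hv' (by rw [h1, h])
  rwa [canon_congr hi he]

theorem mem_reducedWords_iff {d n : ℕ} (hd : 0 < d) (hn : 1 ≤ n) {i e : ℕ → ℕ}
    (hv : ValidData d n i e) {w : List (Letter n)} :
    w ∈ reducedWords d n (ev (sN d n) (canon n i e)) ↔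
      ev (sN d n) (w.map Subtype.val) = ev (sN d n) (canon n i e) ∧
        w.length = (canon n i e).length := by
  obtain ⟨u, hu⟩ := (isWord_canon hv).exists_map
  constructor
  · rintro ⟨h1, h2⟩
    rw [evalWord_eq_ev] at h1
    refine ⟨h1, le_antisymm ?_ ?_⟩
    · have := h2 u (by rw [evalWord_eq_ev, hu])
      rwa [← hu, List.length_map]
    · have := length_canon_le hd hn hv (isWord_map n w) h1
      rwa [List.length_map] at this
  · rintro ⟨h1, h2⟩
    refine ⟨by rw [evalWord_eq_ev, h1], fun v hv' => ?_⟩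
    rw [evalWord_eq_ev] at hv'
    have := length_canon_le hd hn hv (isWord_map n v) hv'
    rwa [List.length_map, ← h2] at this

/-- Every reduced word has the length of the canonical word, hence, by `exists_canon`, its value in
the trace monoid. -/
theorem Good.isFullyCommutative {d n : ℕ} (hd : 0 < d) (hn : 1 ≤ n) {i e : ℕ → ℕ}
    (hv : ValidData d n i e) (hg : Good n i e) :
    IsFullyCommutative d n (ev (sN d n) (canon n i e)) := by
  have key : ∀ u ∈ reducedWords d n (ev (sN d n) (canon n i e)),
      ev (trace n) (u.map Subtype.val) = ev (trace n) (canon n i e) := by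
    intro u hu
    obtain ⟨h1, h2⟩ := (mem_reducedWords_iff hd hn hv).1 hu
    obtain ⟨i', e', hv', h3, _, h5⟩ := exists_canon hd hn _ (isWord_map n u)
    obtain ⟨hi, he⟩ := canon_injective hn hv hv' (by rw [h3, h1])
    rw [canon_congr hi he]
    exact h5 (by rw [List.length_map, h2, canon_congr hi he]) (hg.congr hi he)
  intro u hu v hv'
  exact commEquiv_of_ev_trace (by rw [key u hu, key v hv'])

/-! ### Fully commutative elements have good canonical words -/

/-- A commuting pair has indices differing by at least two, so it never contains both neighbours c
and c + 1. This is the invariant separating commutation classes. -/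
theorem CommEquiv.filter_eq {n : ℕ} {u v : List (Letter n)} (h : CommEquiv n u v) (c : ℕ) :
    (u.map Subtype.val).filter (fun a => a = c ∨ a = c + 1) =
      (v.map Subtype.val).filter (fun a => a = c ∨ a = c + 1) := by
  induction h with
  | rel u v h =>
    obtain ⟨x, y, i, j, hij, rfl, rfl⟩ := h
    simp only [List.map_append, List.filter_append, List.map_cons, List.map_nil]
    congr 2
    by_cases h1 : i.1 = c ∨ i.1 = c + 1
    · have h2 : ¬ (j.1 = c ∨ j.1 = c + 1) := by omega
      simp [List.filter_cons, h2]
    · simp [List.filter_cons, h1]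
  | refl => rfl
  | symm _ _ _ ih => exact ih.symm
  | trans _ _ _ _ _ ih ih' => exact ih.trans ih'

theorem not_isFullyCommutative {d n : ℕ} (hd : 0 < d) (hn : 1 ≤ n) {i e : ℕ → ℕ}
    (hv : ValidData d n i e) {w : List ℕ} (hw : IsWord n w)
    (hev : ev (sN d n) w = ev (sN d n) (canon n i e)) (hlen : w.length = (canon n i e).length)
    (c : ℕ) (hne : w.filter (fun a => a = c ∨ a = c + 1) ≠
      (canon n i e).filter (fun a => a = c ∨ a = c + 1)) :
    ¬ IsFullyCommutative d n (ev (sN d n) (canon n i e)) := by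
  intro hfc
  obtain ⟨u, hu⟩ := hw.exists_map
  obtain ⟨v, hv'⟩ := (isWord_canon hv).exists_map
  have h := hfc u ((mem_reducedWords_iff hd hn hv).2 ⟨by rw [hu, hev], by rw [← hlen, ← hu]; simp⟩)
    v ((mem_reducedWords_iff hd hn hv).2 ⟨by rw [hv'], by rw [← hv']; simp⟩)
  have := h.filter_eq c
  rw [hu, hv'] at this
  exact hne this

/-- A letter that can be moved through a descending factor raises its index. -/
theorem not_isFullyCommutative_of_shift {d n : ℕ} (hd : 0 < d) (hn : 1 ≤ n) {i e : ℕ → ℕ}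
    (hv : ValidData d n i e) {X Y Z : List ℕ} {a q j : ℕ} (hj : 1 ≤ j) (hja : j ≤ a) (haq : a < q)
    (hq : q < n) (hZ : ∀ b ∈ Z, a + 1 < b)
    (hw : canon n i e = X ++ ([a] ++ (Z ++ (desc q j ++ Y)))) :
    ¬ IsFullyCommutative d n (ev (sN d n) (canon n i e)) := by
  have hx := braidGens_sN d n hn
  have hcw := isWord_canon hv
  rw [hw] at hcw
  refine not_isFullyCommutative hd hn hv (w := X ++ (Z ++ (desc q j ++ ([a + 1] ++ Y)))) ?_ ?_ ?_ a
    ?_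
  · intro b hb
    by_cases hba : b = a + 1
    · omega
    · refine hcw b ?_
      simp only [List.mem_append, List.mem_singleton] at hb ⊢
      tauto
  · have hcomm : Commute (sN d n a) (ev (sN d n) Z) := hx.comm.ev fun b hb => Or.inl (hZ b hb)
    have hs := desc_shift hx hj hja haq hq
    rw [hw]
    simp only [ev_append, ev_singleton]
    rw [← mul_assoc (ev _ (desc q j)), hs, ← mul_assoc (sN d n a) (ev _ Z), hcomm.eq]
    simp only [mul_assoc]
  · rw [hw]
    simp only [List.length_append, List.length_singleton]
    omega
  -- The rewriting has replaced one letter a by a + 1, so the number of letters a differs.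
  · intro heq
    have h1 := congrArg (List.count a) heq
    rw [List.count_filter (by simp), List.count_filter (by simp), hw] at h1
    simp only [List.count_append, List.count_singleton] at h1
    simp at h1

/-- The word `s_{b, i_b} ⋯ s_{b + m - 1, i_{b + m - 1}}`. -/
def preSeg (i : ℕ → ℕ) (b m : ℕ) : List ℕ := (List.range' b m).flatMap fun q => desc q (i q)

theorem pre_split (i : ℕ → ℕ) {p q : ℕ} (hq : 1 ≤ q) (hqp : q ≤ p) :
    pre p i = pre (q - 1) i ++ (desc q (i q) ++ preSeg i (q + 1) (p - q)) := by
  have h1 := List.range'_append_1 (s := 1) (m := q - 1) (n := 1 + (p - q))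
  have h2 := List.range'_append_1 (s := q) (m := 1) (n := p - q)
  rw [show 1 + (q - 1) = q by omega, show q - 1 + (1 + (p - q)) = p by omega] at h1
  rw [pre, ← h1, ← h2, List.flatMap_append, List.flatMap_append, pre, preSeg]
  simp

theorem mem_preSeg {i : ℕ → ℕ} {b m c : ℕ} :
    c ∈ preSeg i b m ↔ ∃ q, b ≤ q ∧ q < b + m ∧ i q ≤ c ∧ c ≤ q := by
  simp [preSeg, List.mem_range'_1, and_assoc]

theorem seg_eq_nil {n : ℕ} {e : ℕ → ℕ} {b m : ℕ} (h : ∀ j, b ≤ j → j < b + m → e j = 0) :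
    seg n e b m = [] := by
  simp only [seg, List.flatMap_eq_nil_iff, List.mem_range'_1]
  intro j hj
  rw [h j hj.1 hj.2]; rfl

/-- The suffix, from its first factor on. -/
theorem seg_first {n : ℕ} {e : ℕ → ℕ} {b m j : ℕ} (hb : b ≤ j) (hj : j < b + m) (hje : e j ≠ 0)
    (hmin : ∀ j', b ≤ j' → j' < j → e j' = 0) :
    seg n e b m = List.replicate (e j) n ++ (desc (n - 1) j ++ seg n e (j + 1) (b + m - j - 1)) := by
  have h1 := seg_add n e b (j - b) (1 + (b + m - j - 1))
  rw [show j - b + (1 + (b + m - j - 1)) = m by omega, show b + (j - b) = j by omega,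
    seg_add n e j, seg_one, seg_eq_nil (b := b) (m := j - b) fun j' h1 h2 => hmin j' h1 (by omega),
    piece_of_ne hje] at h1
  rw [h1]
  simp

/-- In a closest pair of nonempty factors violating the order, all factors between are empty. The
last letter of the first then meets the second directly and can be moved through it. -/
theorem incr_of_isFullyCommutative {d n : ℕ} (hd : 0 < d) (hn : 1 ≤ n) {i e : ℕ → ℕ}
    (hv : ValidData d n i e)
    (hfc : IsFullyCommutative d n (ev (sN d n) (canon n i e))) : Incr (n - 1) i := by
  intro p p' hp hpp' hp' h1 h2
  by_contra hle
  obtain ⟨k, hk⟩ : ∃ k, p' - p = k := ⟨_, rfl⟩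
  induction k using Nat.strong_induction_on generalizing p p' with
  | _ k ih =>
    by_cases hmid : ∃ q, p < q ∧ q < p' ∧ i q ≤ q
    · obtain ⟨q, h3, h4, h5⟩ := hmid
      by_cases h6 : i q ≤ i p
      · exact ih (q - p) (by omega) p q hp h3 (by omega) h1 h5 (by omega) rfl
      · exact ih (p' - q) (by omega) q p' (by omega) h4 hp' h5 h2 (by omega) rfl
    · push Not at hmid
      refine not_isFullyCommutative_of_shift hd hn hv (X := pre (p - 1) i ++ desc p (i p + 1))
        (Z := preSeg i (p + 1) (p' - 1 - p))
        (Y := preSeg i (p' + 1) (n - 1 - p') ++ seg n e 1 n) (a := i p) (q := p') (j := i p')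
        (hv.pre p' (by omega) hp').1 (by omega) (by omega) (by omega) ?_ ?_ hfc
      · intro b hb
        obtain ⟨q, h3, h4, h5, h6⟩ := mem_preSeg.1 hb
        have := hmid q (by omega) (by omega)
        omega
      · rw [canon, pre_split i (q := p') (by omega) hp', pre_split i hp (show p ≤ p' - 1 by omega),
          desc_eq_append h1]
        simp only [List.append_assoc]

/-- Take the last violating prefix factor. Every later nonempty factor is a single letter, so the
last letter of the violating factor commutes up to the first suffix run and moves through it. -/
theorem below_of_isFullyCommutative {d n : ℕ} (hd : 0 < d) (hn : 1 ≤ n) {i e : ℕ → ℕ}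
    (hv : ValidData d n i e) (hfc : IsFullyCommutative d n (ev (sN d n) (canon n i e))) {j : ℕ}
    (hj : 1 ≤ j) (hjn : j ≤ n) (hje : e j ≠ 0) (hmin : ∀ j', 1 ≤ j' → j' < j → e j' = 0) {p : ℕ}
    (hp : 1 ≤ p) (hpn : p ≤ n - 1) (hpi : i p ≤ p) (hle : j ≤ i p) :
    ∀ q, p ≤ q → q ≤ n - 1 → i q = q := by
  have hinc := incr_of_isFullyCommutative hd hn hv hfc
  by_contra hnt
  obtain ⟨k, hk⟩ : ∃ k, n - p = k := ⟨_, rfl⟩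
  induction k using Nat.strong_induction_on generalizing p with
  | _ k ih =>
    by_cases hex : ∃ q, p < q ∧ q ≤ n - 1 ∧ i q ≤ q ∧ ¬ ∀ q', q ≤ q' → q' ≤ n - 1 → i q' = q'
    · obtain ⟨q, h1, h2, h3, h4⟩ := hex
      have := hinc p q hp h1 h2 hpi h3
      exact ih (n - q) (by omega) (by omega) h2 h3 (by omega) h4 rfl
    · push Not at hex
      have hlow : ∀ q, p < q → q ≤ n - 1 → i q ≤ q → i q = q := fun q h1 h2 h3 =>
        hex q h1 h2 h3 q le_rfl h2
      -- Only a letter p followed by the factor s_{p+1}, or p = n - 1 itself, could stop the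
      -- commutation, and both would make the tail an unbroken s_p ⋯ s_{n-1}.
      have hkey : i p < p ∨ (p < n - 1 ∧ p + 1 < i (p + 1)) := by
        by_contra hcon
        refine hnt fun q h1 h2 => ?_
        rcases eq_or_lt_of_le h1 with rfl | h1
        · omega
        · exact hex (p + 1) (by omega) (by omega) (by omega) q h1 h2
      refine not_isFullyCommutative_of_shift hd hn hv (X := pre (p - 1) i ++ desc p (i p + 1))
        (Z := preSeg i (p + 1) (n - 1 - p) ++ List.replicate (e j) n)
        (Y := seg n e (j + 1) (1 + n - j - 1)) (a := i p) (q := n - 1) (j := j)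
        hj hle (by omega) (by omega) ?_ ?_ hfc
      · intro b hb
        rcases List.mem_append.1 hb with hb | hb
        · obtain ⟨q, h3, h4, h5, h6⟩ := mem_preSeg.1 hb
          have h7 := hlow q (by omega) (by omega) (by omega)
          have : q ≠ p + 1 ∨ i p < p := by
            rcases hkey with h | h
            · exact Or.inr h
            · left; rintro rfl; omega
          omega
        · rw [(List.mem_replicate.1 hb).2]
          omega
      · rw [canon, pre_split i hp hpn, seg_first hj (by omega) hje hmin, desc_eq_append hpi]
        simp only [List.append_assoc]

/-- If the prefix ends in the factor s_{n-1}, the word contains s_{n-1} s_n ^ k s_{n-1}, which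
commutes with s_n. The power of s_n opening a second suffix factor could therefore be moved in front
of it. -/
theorem single_of_isFullyCommutative {d n : ℕ} (hd : 0 < d) (hn : 1 ≤ n) {i e : ℕ → ℕ}
    (hv : ValidData d n i e) (hfc : IsFullyCommutative d n (ev (sN d n) (canon n i e))) {j : ℕ}
    (hj : 1 ≤ j) (hjn : j ≤ n - 1) (hje : e j ≠ 0) (hmin : ∀ j', 1 ≤ j' → j' < j → e j' = 0)
    (hlast : i (n - 1) = n - 1) : ∀ j', 1 ≤ j' → j' ≤ n → j' ≠ j → e j' = 0 := by
  by_contra hcon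
  push Not at hcon
  obtain ⟨j₀, h1, h2, h3, h4⟩ := hcon
  have hex : ∃ j', j < j' ∧ j' ≤ n ∧ e j' ≠ 0 := by
    refine ⟨j₀, ?_, h2, h4⟩
    by_contra h
    exact h4 (hmin j₀ h1 (by omega))
  classical
  obtain ⟨j', ⟨hj', hj'n, hj'e⟩, hj'min⟩ : ∃ j', (j < j' ∧ j' ≤ n ∧ e j' ≠ 0) ∧
      ∀ m, j < m → m < j' → e m = 0 := by
    refine ⟨Nat.find hex, Nat.find_spec hex, fun m hm hlt => ?_⟩
    by_contra hne
    have := Nat.find_spec hex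
    exact Nat.find_min hex hlt ⟨hm, by omega, hne⟩
  obtain ⟨m, rfl⟩ : ∃ m, n = m + 2 := ⟨n - 2, by omega⟩
  have hx := braidGens_sN d (m + 2) hn
  have hw : canon (m + 2) i e = pre m i ++ ([m + 1] ++ (List.replicate (e j) (m + 2) ++
      (desc (m + 1) j ++ (List.replicate (e j') (m + 2) ++ (desc (m + 1) j' ++
        seg (m + 2) e (j' + 1) (m + 2 - j')))))) := by
    have hp := pre_split i (p := m + 1) (q := m + 1) (by omega) le_rfl
    rw [canon, seg_first hj (by omega) hje hmin, seg_first (j := j') (by omega) (by omega) hj'e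
      (fun j'' h h' => hj'min j'' (by omega) h'), show m + 2 - 1 = m + 1 by omega, hp,
      show i (m + 1) = m + 1 from hlast, desc_eq_append (i := m + 1) le_rfl,
      desc_of_lt (Nat.lt_succ_self _)]
    simp [preSeg, show 1 + (m + 2) - j - 1 = m + 2 - j by omega,
      show j + 1 + (m + 2 - j) - j' - 1 = m + 2 - j' by omega]
  have hcw := isWord_canon hv
  refine not_isFullyCommutative hd hn hv (w := pre m i ++ (List.replicate (e j') (m + 2) ++
    ([m + 1] ++ (List.replicate (e j) (m + 2) ++ (desc (m + 1) j ++ (desc (m + 1) j' ++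
        seg (m + 2) e (j' + 1) (m + 2 - j'))))))) ?_ ?_ ?_ (m + 1) ?_ hfc
  · intro b hb
    refine hcw b ?_
    rw [hw]
    simp only [List.mem_append] at hb ⊢
    tauto
  · rw [hw]
    simp only [ev_append, ev_replicate, ev_singleton]
    have hD : Commute (sN d (m + 2) (m + 2)) (ev (sN d (m + 2)) (desc m j)) :=
      hx.comm.ev fun c hc => by rw [mem_desc] at hc; omega
    have hsplit : ev (sN d (m + 2)) (desc (m + 1) j) =
        sN d (m + 2) (m + 1) * ev (sN d (m + 2)) (desc m j) := by
      rw [desc_split (p := m + 1) (b := m) (by omega) (by omega),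
        desc_eq_append (i := m + 1) le_rfl, desc_of_lt (Nat.lt_succ_self _)]
      simp
    have hu := conj_pow_commute hx (m := m + 1) (by omega) rfl (e j)
    rw [hsplit]
    generalize ev (sN d (m + 2)) (desc m j) = D at *
    generalize sN d (m + 2) (m + 1) = p at *
    generalize sN d (m + 2) (m + 2) = t at *
    have h5 := hu.pow_left (e j')
    have h6 := hD.pow_left (e j')
    congr 1
    simp only [← mul_assoc]
    congr 2
    calc t ^ e j' * p * t ^ e j * p * D = t ^ e j' * (p * t ^ e j * p) * D := by
          simp only [mul_assoc]
      _ = p * t ^ e j * p * (t ^ e j' * D) := by rw [h5.eq]; simp only [mul_assoc]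
      _ = _ := by rw [h6.eq]; simp only [mul_assoc]
  · rw [hw]
    simp only [List.length_append]
    omega
  -- After the common beginning, one word continues with s_n and the other with s_{n-1}, as the
  -- projection to these two letters shows.
  · rw [hw]
    intro heq
    simp only [List.filter_append, List.filter_replicate] at heq
    have := List.append_cancel_left heq
    obtain ⟨k, hk⟩ := Nat.exists_eq_succ_of_ne_zero hj'e
    simp [hk, List.replicate_succ] at this

/-- An element is fully commutative if and only if its canonical word is good. -/
theorem isFullyCommutative_iff_good {d n : ℕ} (hd : 0 < d) (hn : 1 ≤ n) {i e : ℕ → ℕ}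
    (hv : ValidData d n i e) :
    IsFullyCommutative d n (ev (sN d n) (canon n i e)) ↔ Good n i e := by
  refine ⟨fun hfc => ⟨incr_of_isFullyCommutative hd hn hv hfc, ?_⟩,
    fun hg => hg.isFullyCommutative hd hn hv⟩
  intro j hj hjn hje p hp hpn hpi
  by_contra hcon
  push Not at hcon
  obtain ⟨hjp, hcon⟩ := hcon
  have hex : ∃ j, 1 ≤ j ∧ e j ≠ 0 := ⟨j, hj, hje⟩
  classical
  obtain ⟨k, hk, hke, hkmin, hkj⟩ : ∃ k, 1 ≤ k ∧ e k ≠ 0 ∧ (∀ m, 1 ≤ m → m < k → e m = 0) ∧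
      k ≤ j := by
    refine ⟨Nat.find hex, (Nat.find_spec hex).1, (Nat.find_spec hex).2, fun m hm hlt => ?_,
      Nat.find_min' hex ⟨hj, hje⟩⟩
    by_contra hne
    exact Nat.find_min hex hlt ⟨hm, hne⟩
  have htail := below_of_isFullyCommutative hd hn hv hfc hk (by omega) hke hkmin hp hpn hpi
    (by omega)
  have hsing := single_of_isFullyCommutative hd hn hv hfc hk (by omega) hke hkmin
    (htail (n - 1) hpn le_rfl)
  obtain rfl : j = k := by
    by_contra hne
    exact hje (hsing j hj hjn hne)
  obtain ⟨j', h1, h2, h3, h4⟩ := hcon htail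
  exact h4 (hsing j' h1 h2 h3)

/-! ### The image of `τ` -/

/-- The image contains all s_a with a < n and is normalized by s_n, so all letters s_n can be
collected on the right. The resulting power lies in the image because s_n ^ r does. -/
theorem mem_range_tau_of_dvd {d r n : ℕ} (hd : 0 < d) (hr : r ∣ d) (hn : 3 ≤ n) {w : List ℕ}
    (hw : IsWord n w) (h : r ∣ w.count n) : ev (sN d n) w ∈ (tau d r n hd hr hn).range := by
  have hr0 : 0 < r := Nat.pos_of_dvd_of_pos hr hd
  have hsn : sN d n n = s d n (lastL n hn) := sN_of_mem ⟨by omega, le_rfl⟩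
  have hlow : ∀ a, 1 ≤ a → a < n → sN d n a ∈ (tau d r n hd hr hn).range := by
    intro a h1 h2
    refine ⟨gen d r n (some ⟨a, h1, h2.le⟩), ?_⟩
    rw [tau_gen, sN_of_mem ⟨h1, h2.le⟩]
    simp only [tauGen, if_neg h2.ne]
  have hpow : sN d n n ^ r ∈ (tau d r n hd hr hn).range :=
    ⟨gen d r n none, by rw [tau_gen, hsn]; rfl⟩
  have hrot : ∀ g, sN d n n * tau d r n hd hr hn (rot hn g) =
      tau d r n hd hr hn g * sN d n n := by
    have hinv : (sN d n n)⁻¹ = sN d n n ^ (d - 1) := by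
      rw [eq_comm, eq_inv_iff_mul_eq_one, ← pow_succ, Nat.sub_add_cancel hd, hsn, s_pow_last]
    have hx := braidGens_sN d n (by omega)
    have key : (tau d r n hd hr hn).comp (rot hn) =
        (MulAut.conj (sN d n n)⁻¹).toMonoidHom.comp (tau d r n hd hr hn) := by
      refine PresentedGroup.ext fun o => ?_
      change tau d r n hd hr hn (rot hn (gen d r n o)) =
        (sN d n n)⁻¹ * tau d r n hd hr hn (gen d r n o) * (sN d n n)⁻¹⁻¹
      rw [inv_inv]
      have hp : tau d r n hd hr hn (gen d r n (some (predL n hn))) = sN d n (n - 1) := by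
        rw [tau_gen, sN_of_mem ⟨by omega, by omega⟩]
        simp only [tauGen, if_neg (show (predL n hn).1 ≠ n by simp only [predL]; omega)]
        rfl
      have hq : tau d r n hd hr hn (gen d r n (some (lastL n hn))) =
          (sN d n n)⁻¹ * sN d n (n - 1) * sN d n n := by
        rw [tau_gen, hinv, hsn, sN_of_mem ⟨by omega, by omega⟩]
        simp only [tauGen, if_pos (show (lastL n hn).1 = n from rfl)]
        rfl
      cases o with
      | none =>
        rw [rot_zero, tau_gen, hsn]
        simp only [tauGen]
        group
      | some i =>
        rcases lt_trichotomy (i.1 + 1) n with hi | hi | hi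
        · rw [rot_low hn i hi, tau_gen]
          simp only [tauGen, if_neg (show i.1 ≠ n by omega)]
          rw [← sN_of_mem i.2, mul_assoc, (hx.comm i.1 n hi).eq, inv_mul_cancel_left]
        · obtain rfl : i = predL n hn := Subtype.ext (by simp [predL]; omega)
          rw [rot_pred, hp, hq]
        · obtain rfl : i = lastL n hn := Subtype.ext (by have := i.2.2; simp [lastL]; omega)
          rw [rot_last, map_mul, map_mul, hp, hq]
          have hB := hx.last (n - 1) (by omega) (by omega)
          have hpp := hx.sq (n - 1) (by omega) (by omega)
          generalize sN d n (n - 1) = p at *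
          generalize sN d n n = t at *
          have hu : (p * t * p) * t⁻¹ = t⁻¹ * (p * t * p) := (commute_conj hB).inv_left.symm
          calc t⁻¹ * p * t * p * (t⁻¹ * p * t) = t⁻¹ * ((p * t * p) * t⁻¹) * p * t := by
                simp only [mul_assoc]
            _ = t⁻¹ * (t⁻¹ * p * t * (p * p)) * t := by rw [hu]; simp only [mul_assoc]
            _ = t⁻¹ * (t⁻¹ * p * t) * t := by rw [hpp, mul_one]
    intro g
    have := DFunLike.congr_fun key g
    simp only [MonoidHom.comp_apply] at this
    rw [this]
    simp [mul_assoc]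
  -- Surjectivity of `rot` is needed here: the intertwining relation moves s_n only past elements of
  -- the form τ (rot g).
  have hconj : ∀ h ∈ (tau d r n hd hr hn).range,
      ∃ h' ∈ (tau d r n hd hr hn).range, sN d n n * h = h' * sN d n n := by
    rintro _ ⟨g, rfl⟩
    obtain ⟨g', rfl⟩ := (rot_bijective (d := d) hr0 hn).2 g
    exact ⟨_, ⟨g', rfl⟩, hrot g'⟩
  have key : ∃ h ∈ (tau d r n hd hr hn).range, ev (sN d n) w = h * sN d n n ^ w.count n := by
    clear h
    induction w with
    | nil => exact ⟨1, one_mem _, by simp⟩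
    | cons a w ih =>
      obtain ⟨h, hh, hev⟩ := ih fun b hb => hw b (List.mem_cons_of_mem _ hb)
      have ha := hw a List.mem_cons_self
      rw [ev_cons, hev]
      rcases eq_or_lt_of_le ha.2 with rfl | han
      · obtain ⟨h', hh', he⟩ := hconj h hh
        exact ⟨h', hh', by rw [List.count_cons_self, ← mul_assoc, he, pow_succ', mul_assoc]⟩
      · exact ⟨sN d n a * h, mul_mem (hlow a ha.1 han) hh, by
          rw [List.count_cons_of_ne han.ne, mul_assoc]⟩
  obtain ⟨h', hh', he⟩ := key
  obtain ⟨m, hm⟩ := h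
  rw [he, hm, pow_mul]
  exact mul_mem hh' (pow_mem hpow m)

/-- The homomorphism counting the letters `s_n` modulo `r`. -/
theorem exists_countHom (d r n : ℕ) (hr : r ∣ d) :
    ∃ f : G1 d n →* Multiplicative (ZMod r), ∀ i : Letter n,
      f (s d n i) = Multiplicative.ofAdd (if i.1 = n then 1 else 0) := by
  refine ⟨PresentedGroup.toGroup
    (f := fun i : Letter n => Multiplicative.ofAdd (if i.1 = n then (1 : ZMod r) else 0)) ?_,
    fun i => PresentedGroup.toGroup.of _⟩
  rintro _ ⟨u, v, h, rfl⟩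
  rw [map_mul, map_inv, mul_inv_eq_one]
  cases h with
  | pow_last i hi =>
    simp only [map_pow, FreeGroup.lift_apply_of, map_one, hi, if_pos]
    rw [← ofAdd_nsmul, nsmul_one, (ZMod.natCast_eq_zero_iff d r).2 hr]
    rfl
  | sq i hi => simp [hi.ne]
  | comm i j h => simp only [map_mul, FreeGroup.lift_apply_of]; exact mul_comm _ _
  | braid i j hj hi =>
    simp [show i.1 ≠ n by omega, show j.1 ≠ n by omega]
  | braid_last i j hi hj =>
    simp only [map_mul, FreeGroup.lift_apply_of, hi, if_neg (show j.1 ≠ n by omega)]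
    simp

/-- Counting letters s_n modulo r is a homomorphism that vanishes on the images of all generators:
these involve r, d or no letters s_n. -/
theorem mem_range_tau_iff {d r n : ℕ} (hd : 0 < d) (hr : r ∣ d) (hn : 3 ≤ n) {w : List ℕ}
    (hw : IsWord n w) : ev (sN d n) w ∈ (tau d r n hd hr hn).range ↔ r ∣ w.count n := by
  refine ⟨?_, mem_range_tau_of_dvd hd hr hn hw⟩
  rintro ⟨g, hg⟩
  obtain ⟨f, hf⟩ := exists_countHom d r n hr
  have h1 : f.comp (tau d r n hd hr hn) = 1 := by
    refine PresentedGroup.ext fun o => ?_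
    change f (tau d r n hd hr hn (gen d r n o)) = 1
    rw [tau_gen]
    cases o with
    | none =>
      simp only [tauGen, map_pow, hf]
      rw [if_pos (show (lastL n hn).1 = n from rfl), ← ofAdd_nsmul, nsmul_one, ZMod.natCast_self]
      rfl
    | some i =>
      simp only [tauGen]
      split_ifs with hi
      · simp only [map_mul, map_pow, hf]
        rw [if_pos (show (lastL n hn).1 = n from rfl),
          if_neg (show (predL n hn).1 ≠ n by simp only [predL]; omega), ofAdd_zero, mul_one, ← pow_succ,
          Nat.sub_add_cancel hd, ← ofAdd_nsmul, nsmul_one, (ZMod.natCast_eq_zero_iff d r).2 hr]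
        rfl
      · rw [hf, if_neg hi]
        rfl
  have h2 : ∀ v : List ℕ, IsWord n v →
      f (ev (sN d n) v) = Multiplicative.ofAdd ((v.count n : ℕ) : ZMod r) := by
    intro v hv
    induction v with
    | nil => simp
    | cons a v ih =>
      have ha := hv a List.mem_cons_self
      rw [ev_cons, map_mul, ih fun b hb => hv b (List.mem_cons_of_mem _ hb), sN_of_mem ha, hf]
      by_cases h : a = n
      · simp [h, mul_comm]
      · simp [h]
  have h3 := DFunLike.congr_fun h1 g
  rw [MonoidHom.comp_apply, hg, h2 w hw] at h3
  exact (ZMod.natCast_eq_zero_iff _ _).1 h3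

/-! ### Suffix labels -/

/-- The exponents of a suffix label. -/
def toExp : List (ℕ × ℕ) → ℕ → ℕ
  | [] => fun _ => 0
  | x :: σ => Function.update (toExp σ) x.1 x.2

/-- Suffix labels with lower indices in `{b, …, n}`. -/
def IsSuffixFrom (d n b : ℕ) (σ : List (ℕ × ℕ)) : Prop :=
  (σ.map Prod.fst).Pairwise (· < ·) ∧ ∀ x ∈ σ, b ≤ x.1 ∧ x.1 ≤ n ∧ 1 ≤ x.2 ∧ x.2 < d

theorem isSuffixFrom_one {d n : ℕ} {σ : List (ℕ × ℕ)} :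
    IsSuffixFrom d n 1 σ ↔ IsSuffixData d n σ := Iff.rfl

theorem isSuffixFrom_nil (d n b : ℕ) : IsSuffixFrom d n b [] := by simp [IsSuffixFrom]

theorem isSuffixFrom_cons {d n b : ℕ} {x : ℕ × ℕ} {σ : List (ℕ × ℕ)} :
    IsSuffixFrom d n b (x :: σ) ↔
      (b ≤ x.1 ∧ x.1 ≤ n ∧ 1 ≤ x.2 ∧ x.2 < d) ∧ IsSuffixFrom d n (x.1 + 1) σ := by
  simp only [IsSuffixFrom, List.map_cons, List.pairwise_cons, List.mem_cons, forall_eq_or_imp,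
    List.mem_map, forall_exists_index, and_imp, forall_apply_eq_imp_iff₂]
  constructor
  · rintro ⟨⟨h1, h2⟩, h3, h4⟩
    exact ⟨h3, h2, fun y hy => ⟨h1 y hy, (h4 y hy).2⟩⟩
  · rintro ⟨h3, h2, h4⟩
    exact ⟨⟨fun y hy => (h4 y hy).1, h2⟩, h3, fun y hy => ⟨by have := (h4 y hy).1; omega,
      (h4 y hy).2⟩⟩

theorem IsSuffixFrom.mono {d n b b' : ℕ} {σ : List (ℕ × ℕ)} (h : IsSuffixFrom d n b σ)
    (hb : b' ≤ b) : IsSuffixFrom d n b' σ :=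
  ⟨h.1, fun x hx => ⟨hb.trans (h.2 x hx).1, (h.2 x hx).2⟩⟩

theorem toExp_eq_zero {d n b j : ℕ} {σ : List (ℕ × ℕ)} (h : IsSuffixFrom d n b σ) (hj : j < b) :
    toExp σ j = 0 := by
  induction σ generalizing b with
  | nil => rfl
  | cons x σ ih =>
    obtain ⟨h1, h2⟩ := isSuffixFrom_cons.1 h
    rw [toExp, Function.update_of_ne (by omega), ih h2 (by omega)]

theorem toExp_lt {d n b j : ℕ} (hd : 0 < d) {σ : List (ℕ × ℕ)} (h : IsSuffixFrom d n b σ) :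
    toExp σ j < d := by
  induction σ generalizing b with
  | nil => exact hd
  | cons x σ ih =>
    obtain ⟨h1, h2⟩ := isSuffixFrom_cons.1 h
    by_cases hj : j = x.1
    · rw [toExp, hj, Function.update_self]; exact h1.2.2.2
    · rw [toExp, Function.update_of_ne hj]; exact ih h2

theorem suffixWord_eq_seg {d n b : ℕ} {σ : List (ℕ × ℕ)} (h : IsSuffixFrom d n b σ)
    (hb : b ≤ n + 1) : suffixWord n σ = seg n (toExp σ) b (n + 1 - b) := by
  induction σ generalizing b with
  | nil => rw [seg_eq_nil (e := toExp []) fun j _ _ => rfl]; rfl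
  | cons x σ ih =>
    obtain ⟨h1, h2⟩ := isSuffixFrom_cons.1 h
    have hx : toExp (x :: σ) x.1 = x.2 := by rw [toExp, Function.update_self]
    rw [seg_first (j := x.1) h1.1 (by omega) (by omega), hx,
      seg_congr (b := x.1 + 1) (e' := toExp σ)]
    · have := ih h2 (by omega)
      rw [show n + 1 - (x.1 + 1) = b + (n + 1 - b) - x.1 - 1 by omega] at this
      rw [← this]
      simp [suffixWord]
    · intro j hj _
      rw [toExp, Function.update_of_ne (by omega)]
    · intro j hj hjx
      rw [toExp, Function.update_of_ne (by omega), toExp_eq_zero h2 (by omega)]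

theorem toExp_injective {d n b : ℕ} {σ σ' : List (ℕ × ℕ)} (h : IsSuffixFrom d n b σ)
    (h' : IsSuffixFrom d n b σ') (he : ∀ j, b ≤ j → j ≤ n → toExp σ j = toExp σ' j) : σ = σ' := by
  induction σ generalizing b σ' with
  | nil =>
    cases σ' with
    | nil => rfl
    | cons x σ' =>
      obtain ⟨h1, h2⟩ := isSuffixFrom_cons.1 h'
      have := he x.1 h1.1 h1.2.1
      simp only [toExp, Function.update_self] at this
      omega
  | cons x σ ih =>
    obtain ⟨h1, h2⟩ := isSuffixFrom_cons.1 h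
    cases σ' with
    | nil =>
      have := he x.1 h1.1 h1.2.1
      simp only [toExp, Function.update_self] at this
      omega
    | cons x' σ' =>
      obtain ⟨h3, h4⟩ := isSuffixFrom_cons.1 h'
      have hxx : x.1 = x'.1 := by
        rcases lt_trichotomy x.1 x'.1 with hlt | heq | hlt
        · have := he x.1 h1.1 h1.2.1
          rw [toExp, toExp, Function.update_self, Function.update_of_ne hlt.ne,
            toExp_eq_zero h4 (by omega)] at this
          omega
        · exact heq
        · have := he x'.1 h3.1 h3.2.1
          rw [toExp, toExp, Function.update_self, Function.update_of_ne hlt.ne,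
            toExp_eq_zero h2 (by omega)] at this
          omega
      have hxx2 : x.2 = x'.2 := by
        have := he x.1 h1.1 h1.2.1
        rwa [toExp, toExp, Function.update_self, hxx, Function.update_self] at this
      rw [← hxx] at h4
      rw [Prod.ext hxx hxx2, ih h2 h4]
      intro j hj hjn
      have := he j (by omega) hjn
      rwa [toExp, toExp, Function.update_of_ne (by omega), Function.update_of_ne (by omega)] at this

theorem exists_toExp {d n : ℕ} (e : ℕ → ℕ) (m b : ℕ) (hm : b + m = n + 1)
    (he : ∀ j, b ≤ j → j ≤ n → e j < d) :
    ∃ σ, IsSuffixFrom d n b σ ∧ ∀ j, b ≤ j → j ≤ n → toExp σ j = e j := by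
  induction m generalizing b with
  | zero => exact ⟨[], isSuffixFrom_nil _ _ _, fun j h1 h2 => by omega⟩
  | succ m ih =>
    obtain ⟨σ, h1, h2⟩ := ih (b + 1) (by omega) fun j h h' => he j (by omega) h'
    by_cases h0 : e b = 0
    · refine ⟨σ, h1.mono (by omega), fun j hj hjn => ?_⟩
      rcases eq_or_lt_of_le hj with rfl | hj
      · rw [h0, toExp_eq_zero h1 (by omega)]
      · exact h2 j hj hjn
    · refine ⟨(b, e b) :: σ, isSuffixFrom_cons.2 ⟨⟨le_rfl, by omega, by simp only; omega,
        he b le_rfl (by omega)⟩, h1⟩, fun j hj hjn => ?_⟩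
      rcases eq_or_lt_of_le hj with rfl | hj
      · rw [toExp, Function.update_self]
      · rw [toExp, Function.update_of_ne (by simp only; omega), h2 j hj hjn]

/-- The sum of the exponents of a suffix label. -/
def expSum (σ : List (ℕ × ℕ)) : ℕ := (σ.map Prod.snd).sum

theorem count_suffixWord {n : ℕ} (hn : 1 ≤ n) (σ : List (ℕ × ℕ)) :
    (suffixWord n σ).count n = expSum σ := by
  induction σ with
  | nil => rfl
  | cons x σ ih =>
    have h : (desc (n - 1) x.1).count n = 0 := by
      rw [List.count_eq_zero, mem_desc]; omega
    simp only [suffixWord, List.flatMap_cons, List.count_append] at ih ⊢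
    rw [ih, h]
    simp [expSum]

/-! ### Counting suffix labels -/

theorem card_filter_range_residue {d r : ℕ} (hd : 0 < d) (hr : r ∣ d) (c : ZMod r) :
    r * ((Finset.range d).filter fun k : ℕ => (k : ZMod r) = c).card = d := by
  have hr0 : 0 < r := Nat.pos_of_dvd_of_pos hr hd
  have : NeZero r := ⟨hr0.ne'⟩
  have h1 := Nat.count_modEq_card d hr0 c.val
  rw [Nat.count_eq_card_filter_range, Nat.mod_eq_zero_of_dvd hr] at h1
  simp only [Nat.not_lt_zero, if_false, add_zero] at h1
  have h2 : ((Finset.range d).filter fun k : ℕ => (k : ZMod r) = c) =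
      (Finset.range d).filter fun k : ℕ => k ≡ c.val [MOD r] := by
    refine Finset.filter_congr fun k _ => ?_
    rw [← ZMod.natCast_eq_natCast_iff, ZMod.natCast_zmod_val]
  rw [h2, h1, Nat.mul_div_cancel' hr]

/-- The suffix labels with lower indices in `{b, …, b + m - 1}`. -/
def sufs (d : ℕ) : ℕ → ℕ → Finset (List (ℕ × ℕ))
  | _, 0 => {[]}
  | b, m + 1 => sufs d (b + 1) m ∪
      (Finset.Ico 1 d ×ˢ sufs d (b + 1) m).image fun p => (b, p.1) :: p.2

theorem mem_sufs {d n : ℕ} {σ : List (ℕ × ℕ)} (m b : ℕ) (hm : b + m = n + 1) :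
    σ ∈ sufs d b m ↔ IsSuffixFrom d n b σ := by
  induction m generalizing b σ with
  | zero =>
    simp only [sufs, Finset.mem_singleton]
    constructor
    · rintro rfl; exact isSuffixFrom_nil _ _ _
    · intro h
      cases σ with
      | nil => rfl
      | cons x σ => obtain ⟨h1, h2⟩ := isSuffixFrom_cons.1 h; omega
  | succ m ih =>
    simp only [sufs, Finset.mem_union, Finset.mem_image, Finset.mem_product, Finset.mem_Ico,
      ih (b + 1) (by omega), Prod.exists]
    constructor
    · rintro (h | ⟨k, τ, ⟨h1, h2⟩, rfl⟩)
      · exact h.mono (by omega)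
      · exact isSuffixFrom_cons.2 ⟨⟨le_rfl, by omega, h1.1, h1.2⟩, h2⟩
    · intro h
      cases σ with
      | nil => exact Or.inl (isSuffixFrom_nil _ _ _)
      | cons x σ =>
        obtain ⟨h1, h2⟩ := isSuffixFrom_cons.1 h
        rcases eq_or_lt_of_le h1.1 with h3 | h3
        · right
          refine ⟨x.2, σ, ⟨h1.2.2, h3 ▸ h2⟩, ?_⟩
          rw [h3]
        · left
          exact isSuffixFrom_cons.2 ⟨⟨h3, h1.2⟩, h2⟩

/-- The suffix labels with first lower index `b`. -/
def sufsAt (d b m : ℕ) : Finset (List (ℕ × ℕ)) :=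
  (Finset.Ico 1 d ×ˢ sufs d (b + 1) m).image fun p => (b, p.1) :: p.2

theorem disjoint_sufs_sufsAt (d b m : ℕ) : Disjoint (sufs d (b + 1) m) (sufsAt d b m) := by
  rw [Finset.disjoint_left]
  intro σ h1 h2
  simp only [sufsAt, Finset.mem_image, Prod.exists] at h2
  obtain ⟨k, τ, _, rfl⟩ := h2
  have := (isSuffixFrom_cons.1 ((mem_sufs (n := b + m) m (b + 1) (by omega)).1 h1)).1.1
  simp at this

/-- The number of suffix labels with a given residue of the exponent sum. -/
def resCount (d r b m : ℕ) (c : ZMod r) : ℕ :=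
  ((sufs d b m).filter fun σ => (expSum σ : ZMod r) = c).card

theorem card_sufsAt_filter (d r b m : ℕ) (c : ZMod r) :
    ((sufsAt d b m).filter fun σ => (expSum σ : ZMod r) = c).card =
      ∑ k ∈ Finset.Ico 1 d, resCount d r (b + 1) m (c - (k : ZMod r)) := by
  have hinj : Function.Injective fun p : ℕ × List (ℕ × ℕ) => (b, p.1) :: p.2 := by
    rintro ⟨k, τ⟩ ⟨k', τ'⟩ h
    simpa using h
  rw [sufsAt, Finset.filter_image, Finset.card_image_of_injective _ hinj,
    Finset.card_filter, Finset.sum_product]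
  refine Finset.sum_congr rfl fun k _ => ?_
  rw [resCount, Finset.card_filter]
  refine Finset.sum_congr rfl fun τ _ => ?_
  have : expSum ((b, k) :: τ) = k + expSum τ := by simp [expSum]
  rw [this, Nat.cast_add]
  simp only [eq_sub_iff_add_eq']

theorem resCount_zero (d r b : ℕ) (c : ZMod r) :
    resCount d r b 0 c = if c = 0 then 1 else 0 := by
  simp only [resCount, sufs, Finset.filter_singleton]
  by_cases h : c = 0
  · simp [h, expSum]
  · simp [h, expSum, Ne.symm h]

theorem resCount_succ (d r b m : ℕ) (c : ZMod r) :
    resCount d r b (m + 1) c = resCount d r (b + 1) m c +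
      ((sufsAt d b m).filter fun σ => (expSum σ : ZMod r) = c).card := by
  rw [resCount, sufs, ← sufsAt, Finset.filter_union, Finset.card_union_of_disjoint
    (Finset.disjoint_filter_filter (disjoint_sufs_sufsAt d b m)), resCount]

/-- An absent factor counts as exponent 0, so the first exponent runs over 0, …, d - 1, which meets
each residue class equally often as r divides d. One such exponent already equidistributes the sum.
-/
theorem mul_resCount {d r : ℕ} (hd : 0 < d) (hr : r ∣ d) (m b : ℕ) (c : ZMod r) :
    r * resCount d r b (m + 1) c = d ^ (m + 1) := by
  have hrange : ∀ f : ℕ → ℕ, f 0 + ∑ k ∈ Finset.Ico 1 d, f k = ∑ k ∈ Finset.range d, f k := by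
    intro f
    rw [Finset.range_eq_Ico, Finset.sum_eq_sum_Ico_succ_bot hd]
  have hstep : ∀ m b, ∀ c : ZMod r, resCount d r b (m + 1) c =
      ∑ k ∈ Finset.range d, resCount d r (b + 1) m (c - (k : ZMod r)) := by
    intro m b c
    rw [resCount_succ, card_sufsAt_filter, ← hrange fun k => resCount d r (b + 1) m (c - k)]
    simp
  induction m generalizing b c with
  | zero =>
    rw [hstep]
    simp only [resCount_zero, sub_eq_zero, zero_add, pow_one]
    rw [← Finset.card_filter]
    conv_rhs => rw [← card_filter_range_residue hd hr c]
    simp only [eq_comm]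
  | succ m ih =>
    rw [hstep, Finset.mul_sum, Finset.sum_congr rfl fun (k : ℕ) _ => ih (b + 1) (c - (k : ZMod r)),
      Finset.sum_const, Finset.card_range, smul_eq_mul, ← pow_succ']

/-! ### Counting prefixes -/

/-- Prefix data of length `m`, normalized outside `{1, …, m}`. -/
def NormPre (m : ℕ) (i : ℕ → ℕ) : Prop := ValidPre m i ∧ ∀ q, q = 0 ∨ m < q → i q = q + 1

open Classical in
/-- The increasing prefixes of length `m` with lower indices at most `k`. -/
noncomputable def preF : ℕ → ℕ → Finset (ℕ → ℕ)
  | 0, _ => {fun q => q + 1}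
  | m + 1, k => preF m k ∪ (Finset.Icc 1 (min k (m + 1))).biUnion fun c =>
      (preF m (c - 1)).image fun i => Function.update i (m + 1) c

/-- Membership in `preF m k`. -/
def IsPreF (m k : ℕ) (i : ℕ → ℕ) : Prop :=
  NormPre m i ∧ Incr m i ∧ ∀ p, 1 ≤ p → p ≤ m → i p ≤ p → i p ≤ k

theorem normPre_zero {i : ℕ → ℕ} : NormPre 0 i ↔ i = fun q => q + 1 := by
  constructor
  · rintro ⟨_, h⟩
    funext q
    exact h q (by omega)
  · rintro rfl
    exact ⟨fun q h1 h2 => by omega, fun q _ => rfl⟩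

theorem NormPre.succ {m : ℕ} {i : ℕ → ℕ} (h : NormPre m i) : NormPre (m + 1) i := by
  refine ⟨fun q h1 h2 => ?_, fun q hq => h.2 q (by omega)⟩
  rcases Nat.lt_or_ge m q with h3 | h3
  · rw [h.2 q (Or.inr h3)]; omega
  · exact h.1 q h1 h3

theorem NormPre.update {m c : ℕ} {i : ℕ → ℕ} (h : NormPre m i) (h1 : 1 ≤ c) (h2 : c ≤ m + 2) :
    NormPre (m + 1) (Function.update i (m + 1) c) := by
  refine ⟨fun q hq1 hq2 => ?_, fun q hq => ?_⟩
  · by_cases hq : q = m + 1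
    · subst hq; rw [Function.update_self]; omega
    · rw [Function.update_of_ne hq]; exact h.1 q hq1 (by omega)
  · rw [Function.update_of_ne (by omega)]; exact h.2 q (by omega)

theorem NormPre.restrict {m : ℕ} {i : ℕ → ℕ} (h : NormPre (m + 1) i) :
    NormPre m (Function.update i (m + 1) (m + 2)) := by
  refine ⟨fun q hq1 hq2 => ?_, fun q hq => ?_⟩
  · rw [Function.update_of_ne (by omega)]; exact h.1 q hq1 (by omega)
  · by_cases hq' : q = m + 1
    · subst hq'; rw [Function.update_self]
    · rw [Function.update_of_ne hq']; exact h.2 q (by omega)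

theorem mem_preF {m k : ℕ} {i : ℕ → ℕ} : i ∈ preF m k ↔ IsPreF m k i := by
  induction m generalizing k i with
  | zero =>
    simp only [preF, Finset.mem_singleton, IsPreF, normPre_zero]
    refine ⟨fun h => ⟨h, fun q q' h1 h2 h3 => by omega, fun p h1 h2 => by omega⟩, fun h => h.1⟩
  | succ m ih =>
    simp only [preF, Finset.mem_union, Finset.mem_biUnion, Finset.mem_image, Finset.mem_Icc, ih]
    constructor
    · rintro (⟨h1, h2, h3⟩ | ⟨c, ⟨hc1, hc2⟩, i, ⟨h1, h2, h3⟩, rfl⟩)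
      · have hlast : i (m + 1) = m + 2 := h1.2 _ (Or.inr (by omega))
        refine ⟨h1.succ, fun q q' hq hqq hq' hiq hiq' => ?_, fun p hp hpm hip => ?_⟩
        · have : q' ≠ m + 1 := by rintro rfl; omega
          exact h2 q q' hq hqq (by omega) hiq hiq'
        · have : p ≠ m + 1 := by rintro rfl; omega
          exact h3 p hp (by omega) hip
      · refine ⟨h1.update hc1 (by omega), fun q q' hq hqq hq' hiq hiq' => ?_,
          fun p hp hpm hip => ?_⟩
        · rw [Function.update_of_ne (by omega)] at hiq ⊢
          by_cases hqm : q' = m + 1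
          · rw [hqm, Function.update_self]
            have := h3 q hq (by omega) hiq
            omega
          · rw [Function.update_of_ne hqm] at hiq' ⊢
            exact h2 q q' hq hqq (by omega) hiq hiq'
        · by_cases hpm' : p = m + 1
          · rw [hpm', Function.update_self]; omega
          · rw [Function.update_of_ne hpm'] at hip ⊢
            have := h3 p hp (by omega) hip
            omega
    · rintro ⟨h1, h2, h3⟩
      have hv := h1.1 (m + 1) (by omega) le_rfl
      by_cases hlast : i (m + 1) = m + 2
      · left
        have : Function.update i (m + 1) (m + 2) = i := by rw [← hlast, Function.update_eq_self]
        exact ⟨this ▸ h1.restrict, h2.mono (by omega), fun p hp hpm => h3 p hp (by omega)⟩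
      · right
        have := h3 (m + 1) (by omega) le_rfl (by omega)
        refine ⟨i (m + 1), by omega, Function.update i (m + 1) (m + 2), ⟨h1.restrict, ?_, ?_⟩, ?_⟩
        · intro q q' hq hqq hq' hiq hiq'
          rw [Function.update_of_ne (by omega)] at hiq hiq' ⊢
          rw [Function.update_of_ne (by omega)]
          exact h2 q q' hq hqq (by omega) hiq hiq'
        · intro p hp hpm hip
          rw [Function.update_of_ne (by omega)] at hip ⊢
          have := h2 p (m + 1) hp (by omega) le_rfl hip (by omega)
          omega
        · rw [Function.update_idem, Function.update_eq_self]

theorem update_injOn_normPre (m c : ℕ) {s : Finset (ℕ → ℕ)} (hs : ∀ i ∈ s, NormPre m i) :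
    Set.InjOn (fun i : ℕ → ℕ => Function.update i (m + 1) c) s := by
  intro i hi i' hi' h
  funext q
  by_cases hq : q = m + 1
  · rw [(hs i hi).2 q (by omega), (hs i' hi').2 q (by omega)]
  · have := congrFun h q
    simpa [Function.update_of_ne hq] using this

theorem card_preF_succ (m k : ℕ) : (preF (m + 1) k).card =
    (preF m k).card + ∑ c ∈ Finset.Icc 1 (min k (m + 1)), (preF m (c - 1)).card := by
  classical
  rw [preF, Finset.card_union_of_disjoint, Finset.card_biUnion]
  · congr 1
    refine Finset.sum_congr rfl fun c _ => ?_
    exact Finset.card_image_of_injOn (update_injOn_normPre m c fun i hi => (mem_preF.1 hi).1)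
  · intro c _ c' _ hcc
    change Disjoint _ _
    rw [Finset.disjoint_left]
    intro i hi hi'
    obtain ⟨u, _, rfl⟩ := Finset.mem_image.1 hi
    obtain ⟨v, _, h⟩ := Finset.mem_image.1 hi'
    have := congrFun h (m + 1)
    simp only [Function.update_self] at this
    exact hcc this.symm
  · rw [Finset.disjoint_left]
    intro i hi hi'
    obtain ⟨c, hc, hi'⟩ := Finset.mem_biUnion.1 hi'
    obtain ⟨u, _, rfl⟩ := Finset.mem_image.1 hi'
    have := (mem_preF.1 hi).1.2 (m + 1) (by omega)
    rw [Function.update_self] at this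
    rw [Finset.mem_Icc] at hc
    omega

/-- Raising the bound by one adds precisely the prefixes whose last factor has lower index k + 1.
Their earlier factors have indices at most k. -/
theorem card_preF_succ_succ {m k : ℕ} (hk : k ≤ m) :
    (preF (m + 1) (k + 1)).card = (preF (m + 1) k).card + (preF m (k + 1)).card := by
  rw [card_preF_succ, card_preF_succ, min_eq_left (by omega), min_eq_left (by omega),
    Finset.sum_Icc_succ_top (by omega)]
  simp only [Nat.add_sub_cancel]
  omega

theorem preF_of_le {m k : ℕ} (h : m ≤ k) : preF m k = preF m m := by
  ext i
  rw [mem_preF, mem_preF]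
  exact ⟨fun h => ⟨h.1, h.2.1, fun p h1 h2 h3 => by omega⟩,
    fun h => ⟨h.1, h.2.1, fun p h1 h2 h3 => by omega⟩⟩

theorem card_preF_zero (m : ℕ) : (preF m 0).card = 1 := by
  induction m with
  | zero => rfl
  | succ m ih => rw [card_preF_succ, ih]; simp

/-! ### Recurrence and boundary values of the Catalan triangle -/

theorem catalanTriangle_zero (n : ℕ) : catalanTriangle n 0 = 1 := by
  rw [catalanTriangle, Nat.factorial_succ]
  have : (n.factorial : ℚ) ≠ 0 := by positivity
  push_cast
  field_simp
  simp [mul_comm]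

theorem catalanTriangle_succ_succ (n k : ℕ) :
    catalanTriangle (n + 1) (k + 1) = catalanTriangle (n + 1) k + catalanTriangle n (k + 1) := by
  simp only [catalanTriangle]
  rw [show n + 1 + (k + 1) = (n + k + 1) + 1 by ring, show n + 1 + k = n + k + 1 by ring,
    show n + (k + 1) = n + k + 1 by ring, Nat.factorial_succ (n + k + 1), Nat.factorial_succ (n + 1),
    Nat.factorial_succ k]
  have h1 : ((n + 1).factorial : ℚ) ≠ 0 := by positivity
  have h2 : (k.factorial : ℚ) ≠ 0 := by positivity
  push_cast
  field_simp
  ring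

theorem catalanTriangle_diag (n : ℕ) :
    catalanTriangle (n + 1) (n + 1) = catalanTriangle (n + 1) n := by
  simp only [catalanTriangle]
  rw [show n + 1 + (n + 1) = (n + n + 1) + 1 by ring, show n + 1 + n = n + n + 1 by ring,
    Nat.factorial_succ (n + n + 1), Nat.factorial_succ (n + 1), Nat.factorial_succ n]
  have h2 : (n.factorial : ℚ) ≠ 0 := by positivity
  push_cast
  field_simp
  ring

theorem catalanTriangle_self (n : ℕ) : catalanTriangle n n = catalan n := by
  rw [catalan_eq_centralBinom_div, Nat.cast_div (Nat.succ_dvd_centralBinom n) (by positivity),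
    Nat.centralBinom_eq_two_mul_choose, Nat.cast_choose ℚ (by omega), catalanTriangle,
    Nat.factorial_succ, show n + n = 2 * n by ring, show 2 * n - n = n by omega]
  have h2 : (n.factorial : ℚ) ≠ 0 := by positivity
  push_cast
  field_simp
  ring

/-- Both sides satisfy the same recurrence, equal 1 at k = 0, and do not change in the last step
from k = m to k = m + 1. -/
theorem card_preF (m k : ℕ) (hk : k ≤ m + 1) : ((preF m k).card : ℚ) = catalanTriangle (m + 1) k := by
  induction m generalizing k with
  | zero =>
    rw [show (preF 0 k).card = 1 from rfl]
    have h0 := catalanTriangle_zero 1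
    have h1 := catalanTriangle_diag 0
    rcases (show k = 0 ∨ k = 1 by omega) with rfl | rfl
    · simp [h0]
    · simp only [zero_add] at h1 ⊢
      rw [h1, h0]; simp
  | succ m ih =>
    induction k with
    | zero => rw [card_preF_zero, catalanTriangle_zero]; simp
    | succ k ihk =>
      rcases Nat.lt_or_ge m k with h | h
      · obtain rfl : k = m + 1 := by omega
        rw [preF_of_le (by omega), ihk (by omega), catalanTriangle_diag]
      · rw [card_preF_succ_succ h, Nat.cast_add, ihk (by omega), ih (k + 1) (by omega),
          catalanTriangle_succ_succ (m + 1) k]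

open Classical in
/-- The prefixes that may precede a single suffix factor with lower index `j`. -/
noncomputable def sngF : ℕ → ℕ → Finset (ℕ → ℕ)
  | 0, j => preF 0 j
  | m + 1, j => if j ≤ m + 1 then
      preF (m + 1) (j - 1) ∪ (sngF m j).image fun i => Function.update i (m + 1) (m + 1)
    else preF (m + 1) j

/-- Membership in `sngF m j`. -/
def IsSngF (m j : ℕ) (i : ℕ → ℕ) : Prop :=
  NormPre m i ∧ Incr m i ∧ ∀ p, 1 ≤ p → p ≤ m → i p ≤ p →
    i p < j ∨ ∀ q, p ≤ q → q ≤ m → i q = q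

theorem isSngF_of_lt {m j : ℕ} (h : m < j) (i : ℕ → ℕ) : IsSngF m j i ↔ IsPreF m j i :=
  ⟨fun h => ⟨h.1, h.2.1, fun p h1 h2 h3 => by omega⟩,
    fun h => ⟨h.1, h.2.1, fun p h1 h2 h3 => by omega⟩⟩

theorem mem_sngF {m j : ℕ} (hj : 1 ≤ j) {i : ℕ → ℕ} : i ∈ sngF m j ↔ IsSngF m j i := by
  induction m generalizing i with
  | zero => rw [sngF, mem_preF, isSngF_of_lt (by omega)]
  | succ m ih =>
    rw [sngF]
    split_ifs with hjm
    · simp only [Finset.mem_union, Finset.mem_image, ih, mem_preF]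
      constructor
      · rintro (⟨h1, h2, h3⟩ | ⟨i, ⟨h1, h2, h3⟩, rfl⟩)
        · exact ⟨h1, h2, fun p hp hpm hip => Or.inl (by have := h3 p hp hpm hip; omega)⟩
        · refine ⟨h1.update (by omega) (by omega), fun q q' hq hqq hq' hiq hiq' => ?_,
            fun p hp hpm hip => ?_⟩
          · rw [Function.update_of_ne (by omega)] at hiq ⊢
            by_cases hqm : q' = m + 1
            · rw [hqm, Function.update_self]; omega
            · rw [Function.update_of_ne hqm] at hiq' ⊢
              exact h2 q q' hq hqq (by omega) hiq hiq'
          · by_cases hpm' : p = m + 1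
            · right
              intro q hq1 hq2
              rw [show q = m + 1 by omega, Function.update_self]
            · rw [Function.update_of_ne hpm'] at hip ⊢
              refine (h3 p hp (by omega) hip).imp_right fun h q hq1 hq2 => ?_
              by_cases hqm : q = m + 1
              · rw [hqm, Function.update_self]
              · rw [Function.update_of_ne hqm]; exact h q hq1 (by omega)
      · rintro ⟨h1, h2, h3⟩
        by_cases hlast : i (m + 1) = m + 1
        · right
          refine ⟨Function.update i (m + 1) (m + 2), ⟨h1.restrict, ?_, ?_⟩, ?_⟩
          · intro q q' hq hqq hq' hiq hiq'
            rw [Function.update_of_ne (by omega)] at hiq hiq' ⊢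
            rw [Function.update_of_ne (by omega)]
            exact h2 q q' hq hqq (by omega) hiq hiq'
          · intro p hp hpm hip
            rw [Function.update_of_ne (by omega)] at hip ⊢
            refine (h3 p hp (by omega) hip).imp_right fun h q hq1 hq2 => ?_
            rw [Function.update_of_ne (by omega)]
            exact h q hq1 (by omega)
          · rw [Function.update_idem]
            nth_rewrite 2 [← hlast]
            rw [Function.update_eq_self]
        · left
          refine ⟨h1, h2, fun p hp hpm hip => ?_⟩
          rcases h3 p hp hpm hip with h | h
          · omega
          · exact absurd (h (m + 1) hpm le_rfl) hlast
    · rw [mem_preF, isSngF_of_lt (by omega)]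

/-- The exceptional prefixes make up for the stricter bound: either all indices are below j, or the
last factor is a single letter and the rest is of the same kind. This is the recurrence
`card_preF_succ_succ` again. -/
theorem card_sngF {m j : ℕ} (hj : 1 ≤ j) (hjm : j ≤ m + 1) : (sngF m j).card = (preF m j).card := by
  classical
  induction m with
  | zero => rfl
  | succ m ih =>
    rw [sngF]
    split_ifs with h
    · rw [Finset.card_union_of_disjoint, Finset.card_image_of_injOn
        (update_injOn_normPre m (m + 1) fun i hi => ((mem_sngF hj).1 hi).1), ih h]
      · obtain ⟨k, rfl⟩ : ∃ k, j = k + 1 := ⟨j - 1, by omega⟩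
        rw [card_preF_succ_succ (by omega)]
        rfl
      · rw [Finset.disjoint_left]
        intro i hi hi'
        obtain ⟨u, _, rfl⟩ := Finset.mem_image.1 hi'
        have := (mem_preF.1 hi).2.2 (m + 1) (by omega) le_rfl
        rw [Function.update_self] at this
        have := this le_rfl
        omega
    · rfl

/-! ### Fully commutative elements and suffix labels -/

/-- The prefixes of the fully commutative canonical words with a given suffix. -/
noncomputable def goodF (n : ℕ) : List (ℕ × ℕ) → Finset (ℕ → ℕ)
  | [] => preF (n - 1) n
  | [x] => sngF (n - 1) x.1
  | x :: _ :: _ => preF (n - 1) (x.1 - 1)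

/-- The index of the packet containing the collection with a given label. -/
def packetIndex (n : ℕ) : List (ℕ × ℕ) → ℕ
  | [] => n
  | [x] => min x.1 (n - 1)
  | x :: _ :: _ => x.1 - 1

/-- Only the first suffix index matters, and two suffix factors rule out the exception in
`Good.below`. -/
theorem mem_goodF {d n : ℕ} {σ : List (ℕ × ℕ)} (hσ : IsSuffixData d n σ) {i : ℕ → ℕ} :
    i ∈ goodF n σ ↔ NormPre (n - 1) i ∧ Good n i (toExp σ) := by
  rw [← isSuffixFrom_one] at hσ
  match σ, hσ with
  | [], _ =>
    rw [goodF, mem_preF]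
    exact ⟨fun h => ⟨h.1, h.2.1, fun j _ _ hj => absurd rfl hj⟩,
      fun h => ⟨h.1, h.2.incr, fun p _ hp hpi => by omega⟩⟩
  | [x], h =>
    obtain ⟨h1, _⟩ := isSuffixFrom_cons.1 h
    have hne : ∀ j, j ≠ x.1 → toExp [x] j = 0 := fun j hj => by
      rw [toExp, Function.update_of_ne hj]; rfl
    have hx : toExp [x] x.1 ≠ 0 := by rw [toExp, Function.update_self]; omega
    rw [goodF, mem_sngF h1.1]
    constructor
    · rintro ⟨h2, h3, h4⟩
      refine ⟨h2, h3, fun j hj hjn hje p hp hpn hpi => ?_⟩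
      obtain rfl : j = x.1 := by
        by_contra hjx
        exact hje (hne j hjx)
      exact (h4 p hp hpn hpi).imp_right fun h => ⟨h, fun j' _ _ hj' => hne j' hj'⟩
    · rintro ⟨h2, h3⟩
      exact ⟨h2, h3.incr, fun p hp hpn hpi =>
        (h3.below x.1 h1.1 h1.2.1 hx p hp hpn hpi).imp_right fun h => h.1⟩
  | x :: y :: σ, h =>
    obtain ⟨h1, h2⟩ := isSuffixFrom_cons.1 h
    obtain ⟨h3, _⟩ := isSuffixFrom_cons.1 h2
    have hx : toExp (x :: y :: σ) x.1 ≠ 0 := by rw [toExp, Function.update_self]; omega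
    have hy : toExp (x :: y :: σ) y.1 ≠ 0 := by
      rw [toExp, Function.update_of_ne (by omega), toExp, Function.update_self]; omega
    have hlow : ∀ j, j < x.1 → toExp (x :: y :: σ) j = 0 := fun j hj =>
      toExp_eq_zero (isSuffixFrom_cons.2 ⟨⟨le_rfl, h1.2⟩, h2⟩) hj
    rw [goodF, mem_preF]
    constructor
    · rintro ⟨h4, h5, h6⟩
      refine ⟨h4, h5, fun j hj hjn hje p hp hpn hpi => Or.inl ?_⟩
      have := h6 p hp hpn hpi
      have : ¬ j < x.1 := fun h => hje (hlow j h)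
      omega
    · rintro ⟨h4, h5⟩
      refine ⟨h4, h5.incr, fun p hp hpn hpi => ?_⟩
      rcases h5.below x.1 h1.1 h1.2.1 hx p hp hpn hpi with h6 | h6
      · omega
      · exact absurd (h6.2 y.1 (by omega) (by omega) (by omega)) hy

/-- The minimum in `packetIndex` is harmless because the last two entries of a row of the Catalan
triangle agree; hence single factors of index n and n - 1 share a packet. -/
theorem card_goodF {d n : ℕ} (hn : 1 ≤ n) {σ : List (ℕ × ℕ)} (hσ : IsSuffixData d n σ) :
    ((goodF n σ).card : ℚ) = catalanTriangle n (packetIndex n σ) := by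
  obtain ⟨m, rfl⟩ : ∃ m, n = m + 1 := ⟨n - 1, by omega⟩
  rw [← isSuffixFrom_one] at hσ
  match σ, hσ with
  | [], _ => exact card_preF m (m + 1) le_rfl
  | [x], h =>
    obtain ⟨h1, _⟩ := isSuffixFrom_cons.1 h
    simp only [goodF, packetIndex, Nat.add_sub_cancel]
    rw [card_sngF h1.1 (by omega), card_preF m x.1 (by omega)]
    rcases Nat.lt_or_ge m x.1 with h2 | h2
    · rw [show x.1 = m + 1 by omega, min_eq_right (by omega), catalanTriangle_diag]
    · rw [min_eq_left h2]
  | x :: y :: σ, h =>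
    obtain ⟨h1, _⟩ := isSuffixFrom_cons.1 h
    exact card_preF m (x.1 - 1) (by omega)

theorem canon_toExp {d n : ℕ} {σ : List (ℕ × ℕ)} (hσ : IsSuffixData d n σ) (i : ℕ → ℕ) :
    canon n i (toExp σ) = prefixWord n i ++ suffixWord n σ := by
  rw [suffixWord_eq_seg (isSuffixFrom_one.2 hσ) (by omega), canon, prefixWord_eq_pre]
  rfl

theorem validData_toExp {d n : ℕ} (hd : 0 < d) {σ : List (ℕ × ℕ)} (hσ : IsSuffixData d n σ)
    {i : ℕ → ℕ} (hi : ValidPre (n - 1) i) : ValidData d n i (toExp σ) :=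
  ⟨hi, fun _ _ _ => toExp_lt hd (isSuffixFrom_one.2 hσ)⟩

theorem validPre_iff {n : ℕ} {i : ℕ → ℕ} : ValidPre (n - 1) i ↔ IsPrefixData n i :=
  ⟨fun h p h1 h2 => h p h1 (by omega), fun h p h1 h2 => h p h1 (by omega)⟩

theorem count_canon {d n : ℕ} (hn : 1 ≤ n) {σ : List (ℕ × ℕ)} (hσ : IsSuffixData d n σ)
    (i : ℕ → ℕ) : (canon n i (toExp σ)).count n = expSum σ := by
  rw [canon_toExp hσ, List.count_append, count_suffixWord hn]
  have : (prefixWord n i).count n = 0 := by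
    rw [List.count_eq_zero, prefixWord_eq_pre, pre, ← preSeg, mem_preSeg]
    rintro ⟨q, h1, h2, h3, h4⟩
    omega
  omega

/-- The suffix labels whose exponent sum is divisible by `r`. -/
def labels (d r n : ℕ) : Finset (List (ℕ × ℕ)) :=
  (sufs d 1 n).filter fun σ => (expSum σ : ZMod r) = 0

theorem mem_labels {d r n : ℕ} {σ : List (ℕ × ℕ)} :
    σ ∈ labels d r n ↔ IsSuffixData d n σ ∧ r ∣ expSum σ := by
  rw [labels, Finset.mem_filter, mem_sufs (n := n) n 1 (by omega), isSuffixFrom_one,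
    ZMod.natCast_eq_zero_iff]

theorem canon_data_injective {d n : ℕ} (hd : 0 < d) (hn : 3 ≤ n) {σ σ' : List (ℕ × ℕ)}
    {i i' : ℕ → ℕ} (hσ : IsSuffixData d n σ) (hσ' : IsSuffixData d n σ')
    (hi : ValidPre (n - 1) i) (hi' : ValidPre (n - 1) i')
    (h : ev (sN d n) (canon n i (toExp σ)) = ev (sN d n) (canon n i' (toExp σ'))) :
    (∀ q, 1 ≤ q → q ≤ n - 1 → i q = i' q) ∧ σ = σ' := by
  obtain ⟨h1, h2⟩ := canon_injective (by omega) (validData_toExp hd hσ hi)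
    (validData_toExp hd hσ' hi') h
  exact ⟨h1, toExp_injective (isSuffixFrom_one.2 hσ) (isSuffixFrom_one.2 hσ') h2⟩

theorem exists_canon_data {d n : ℕ} (hd : 0 < d) (hn : 3 ≤ n) (g : G1 d n) :
    ∃ σ i, IsSuffixData d n σ ∧ NormPre (n - 1) i ∧
      ev (sN d n) (canon n i (toExp σ)) = g := by
  obtain ⟨w, hw, rfl⟩ := exists_word d n hd (by omega) g
  obtain ⟨i, e, hv, h1, _⟩ := exists_canon hd (by omega) w hw
  obtain ⟨σ, h2, h3⟩ := exists_toExp (n := n) e n 1 (by omega) hv.exp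
  -- Indices outside the range carry no information; fixing them makes the index function itself
  -- unique.
  have hi : ∀ q, 1 ≤ q → q ≤ n - 1 →
      (fun q => if 1 ≤ q ∧ q ≤ n - 1 then i q else q + 1) q = i q :=
    fun q hq1 hq2 => if_pos ⟨hq1, hq2⟩
  refine ⟨σ, fun q => if 1 ≤ q ∧ q ≤ n - 1 then i q else q + 1, h2, ⟨fun q hq1 hq2 => ?_,
    fun q hq => if_neg (by omega)⟩, ?_⟩
  · rw [hi q hq1 hq2]
    exact hv.pre q hq1 hq2
  · rw [← h1, canon_congr hi h3]

theorem canon_mem_range_iff {d r n : ℕ} (hd : 0 < d) (hr : r ∣ d) (hn : 3 ≤ n) {σ : List (ℕ × ℕ)}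
    {i : ℕ → ℕ} (hσ : IsSuffixData d n σ) (hi : ValidPre (n - 1) i) :
    ev (sN d n) (canon n i (toExp σ)) ∈ (tau d r n hd hr hn).range ↔ r ∣ expSum σ := by
  rw [mem_range_tau_iff hd hr hn (isWord_canon (validData_toExp hd hσ hi)),
    count_canon (by omega) hσ]

/-- The number of fully commutative elements, as a sum over the suffix labels. -/
theorem card_isFullyCommutative {d r n : ℕ} (hd : 0 < d) (hr : r ∣ d) (hn : 3 ≤ n) :
    Nat.card {w : G d r n // IsFullyCommutative d n (tau d r n hd hr hn w)} =
      ∑ σ ∈ labels d r n, (goodF n σ).card := by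
  rw [← Finset.card_sigma]
  let F : (Σ _ : List (ℕ × ℕ), ℕ → ℕ) → G1 d n :=
    fun p => ev (sN d n) (canon n p.2 (toExp p.1))
  have himg : tau d r n hd hr hn '' {w | IsFullyCommutative d n (tau d r n hd hr hn w)} =
      F '' ((labels d r n).sigma (goodF n) : Finset (Σ _ : List (ℕ × ℕ), ℕ → ℕ)) := by
    ext g
    constructor
    · rintro ⟨w, hw, rfl⟩
      obtain ⟨σ, i, hσ, hi, he⟩ := exists_canon_data hd hn (tau d r n hd hr hn w)
      refine ⟨⟨σ, i⟩, ?_, he⟩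
      have hw' : IsFullyCommutative d n (tau d r n hd hr hn w) := hw
      rw [← he, isFullyCommutative_iff_good hd (by omega) (validData_toExp hd hσ hi.1)] at hw'
      rw [Finset.mem_coe, Finset.mem_sigma, mem_labels, mem_goodF hσ]
      exact ⟨⟨hσ, (canon_mem_range_iff hd hr hn hσ hi.1).1 (he ▸ ⟨w, rfl⟩)⟩, hi, hw'⟩
    · rintro ⟨⟨σ, i⟩, hp, rfl⟩
      rw [Finset.mem_coe, Finset.mem_sigma, mem_labels] at hp
      obtain ⟨⟨hσ, hdvd⟩, hi⟩ := hp
      obtain ⟨hi, hg⟩ := (mem_goodF hσ).1 hi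
      obtain ⟨w, hw⟩ := (canon_mem_range_iff hd hr hn hσ hi.1).2 hdvd
      refine ⟨w, ?_, hw⟩
      change IsFullyCommutative d n (tau d r n hd hr hn w)
      rw [hw, isFullyCommutative_iff_good hd (by omega) (validData_toExp hd hσ hi.1)]
      exact hg
  have hinj : Set.InjOn F
      ((labels d r n).sigma (goodF n) : Finset (Σ _ : List (ℕ × ℕ), ℕ → ℕ)) := by
    rintro ⟨σ, i⟩ hp ⟨σ', i'⟩ hp' h
    rw [Finset.mem_coe, Finset.mem_sigma, mem_labels] at hp hp'
    have hi := ((mem_goodF hp.1.1).1 hp.2).1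
    have hi' := ((mem_goodF hp'.1.1).1 hp'.2).1
    obtain ⟨h1, h2⟩ := canon_data_injective hd hn hp.1.1 hp'.1.1 hi.1 hi'.1 h
    simp only at h1 h2
    subst h2
    congr 1
    funext q
    by_cases hq : 1 ≤ q ∧ q ≤ n - 1
    · exact h1 q hq.1 hq.2
    · exact (hi.2 q (by omega)).trans (hi'.2 q (by omega)).symm
  rw [← Set.ncard_coe_finset, ← hinj.ncard_image, ← himg,
    Set.ncard_image_of_injective _ (tau_injective hd hr hn)]
  rfl

/-! ### Packets -/

theorem mem_packetLabels_iff {d n k : ℕ} {σ : List (ℕ × ℕ)} (hn : 3 ≤ n) (hk : k ≤ n) :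
    σ ∈ packetLabels d n k ↔ IsSuffixData d n σ ∧ packetIndex n σ = k := by
  simp only [packetLabels, Set.mem_ofPred_eq, and_congr_right_iff]
  intro hσ
  rw [← isSuffixFrom_one] at hσ
  match σ, hσ with
  | [], _ => simp [packetIndex, eq_comm]
  | [x], h =>
    obtain ⟨h1, _⟩ := isSuffixFrom_cons.1 h
    obtain ⟨j, t⟩ := x
    simp only at h1
    simp only [packetIndex]
    constructor
    · rintro (⟨_, h, _⟩ | ⟨_, h2, t', h⟩ | ⟨h2, t', h | h⟩ | ⟨_, h⟩)
      · exact absurd h (by simp)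
      all_goals simp at h; try omega
    · intro h
      rcases Nat.lt_or_ge j (n - 1) with h2 | h2
      · exact Or.inr (Or.inl ⟨by omega, by omega, t, by rw [show j = k by omega]⟩)
      · refine Or.inr (Or.inr (Or.inl ⟨by omega, t, ?_⟩))
        rcases Nat.lt_or_ge (n - 1) j with h3 | h3
        · exact Or.inl (by rw [show j = n by omega])
        · exact Or.inr (by rw [show j = n - 1 by omega])
  | x :: y :: σ, h =>
    obtain ⟨h1, h2⟩ := isSuffixFrom_cons.1 h
    obtain ⟨h3, _⟩ := isSuffixFrom_cons.1 h2
    obtain ⟨j, t⟩ := x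
    simp only at h1 h3
    simp [packetIndex]
    omega

/-- The empty prefix is good before any suffix. Nonemptiness lets a collection determine its label
and makes membership in the image of τ a real condition on the label. -/
theorem collection_nonempty {d n : ℕ} (hd : 0 < d) (hn : 3 ≤ n) {σ : List (ℕ × ℕ)}
    (hσ : IsSuffixData d n σ) : (collection d n σ).Nonempty := by
  have hi : ValidPre (n - 1) fun q => q + 1 := fun q _ _ => ⟨Nat.le_add_left 1 q, le_rfl⟩
  have hv := validData_toExp hd hσ hi
  obtain ⟨w, hw⟩ := (isWord_canon hv).exists_map
  refine ⟨w, ⟨_, validPre_iff.1 hi, by rw [hw, canon_toExp hσ]⟩, ?_⟩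
  rw [evalWord_eq_ev, hw, isFullyCommutative_iff_good hd (by omega) hv]
  exact ⟨fun q _ _ _ _ h => (Nat.not_succ_le_self q h).elim,
    fun _ _ _ _ p _ _ h => (Nat.not_succ_le_self p h).elim⟩

theorem evalWord_of_mem_collection {d n : ℕ} {σ : List (ℕ × ℕ)} (hσ : IsSuffixData d n σ)
    {w : List (Letter n)} (hw : w ∈ collection d n σ) :
    ∃ i, ValidPre (n - 1) i ∧ evalWord d n w = ev (sN d n) (canon n i (toExp σ)) := by
  obtain ⟨⟨i, hi, hw⟩, _⟩ := hw
  exact ⟨i, validPre_iff.2 hi, by rw [evalWord_eq_ev, hw, canon_toExp hσ]⟩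

/-- All words of a collection contain the same number of letters s_n, so a collection lies in the
image of τ entirely or not at all. Distinct labels give distinct collections by uniqueness of
canonical words. -/
theorem ncard_packet {d r n : ℕ} (hd : 0 < d) (hr : r ∣ d) (hn : 3 ≤ n) {k : ℕ} (hk : k ≤ n) :
    (packet d r n hd hr hn k).ncard =
      ((labels d r n).filter fun σ => packetIndex n σ = k).card := by
  have himg : packet d r n hd hr hn k = collection d n ''
      ((labels d r n).filter fun σ => packetIndex n σ = k : Finset (List (ℕ × ℕ))) := by
    ext c
    simp only [packet, packet1, Set.mem_ofPred_eq, Set.mem_image, Finset.coe_filter, mem_labels,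
      mem_packetLabels_iff hn hk]
    constructor
    · rintro ⟨⟨σ, ⟨hσ, hσk⟩, rfl⟩, hc⟩
      obtain ⟨w, hw⟩ := collection_nonempty hd hn hσ
      obtain ⟨i, hi, he⟩ := evalWord_of_mem_collection hσ hw
      have := hc w hw
      rw [he, canon_mem_range_iff hd hr hn hσ hi] at this
      exact ⟨σ, ⟨⟨hσ, this⟩, hσk⟩, rfl⟩
    · rintro ⟨σ, ⟨⟨hσ, hdvd⟩, hσk⟩, rfl⟩
      refine ⟨⟨σ, ⟨hσ, hσk⟩, rfl⟩, fun w hw => ?_⟩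
      obtain ⟨i, hi, he⟩ := evalWord_of_mem_collection hσ hw
      rw [he, canon_mem_range_iff hd hr hn hσ hi]
      exact hdvd
  rw [himg, Set.InjOn.ncard_image, Set.ncard_coe_finset]
  intro σ hσ σ' hσ' h
  simp only [Finset.coe_filter, Set.mem_ofPred_eq, mem_labels] at hσ hσ'
  obtain ⟨w, hw⟩ := collection_nonempty hd hn hσ.1.1
  obtain ⟨i, hi, he⟩ := evalWord_of_mem_collection hσ.1.1 hw
  rw [h] at hw
  obtain ⟨i', hi', he'⟩ := evalWord_of_mem_collection hσ'.1.1 hw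
  exact (canon_data_injective hd hn hσ.1.1 hσ'.1.1 hi hi' (he ▸ he')).2

theorem packetIndex_le {d n : ℕ} {σ : List (ℕ × ℕ)} (hσ : IsSuffixData d n σ) :
    packetIndex n σ ≤ n := by
  rw [← isSuffixFrom_one] at hσ
  match σ, hσ with
  | [], _ => exact le_rfl
  | [x], _ => simp [packetIndex]
  | x :: y :: σ, h =>
    obtain ⟨h1, _⟩ := isSuffixFrom_cons.1 h
    simp only [packetIndex]
    omega

/-- The sum over labels is grouped by packet, on which the number of good prefixes is constant. -/
theorem card_eq_sum_packet {d r n : ℕ} (hd : 0 < d) (hr : r ∣ d) (hn : 3 ≤ n) :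
    (Nat.card {w : G d r n // IsFullyCommutative d n (tau d r n hd hr hn w)} : ℚ) =
      ∑ k ∈ Finset.range (n + 1), catalanTriangle n k *
        ((packet d r n hd hr hn k).ncard : ℚ) := by
  rw [card_isFullyCommutative, Nat.cast_sum,
    Finset.sum_congr rfl fun σ hσ => card_goodF (by omega) (mem_labels.1 hσ).1,
    ← Finset.sum_fiberwise_of_maps_to (t := Finset.range (n + 1)) (g := packetIndex n)
      fun σ hσ => Finset.mem_range.2 (Nat.lt_succ_of_le (packetIndex_le (mem_labels.1 hσ).1))]
  refine Finset.sum_congr rfl fun k hk => ?_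
  rw [ncard_packet hd hr hn (Nat.lt_succ_iff.1 (Finset.mem_range.1 hk)),
    Finset.sum_congr rfl fun σ hσ => by rw [(Finset.mem_filter.1 hσ).2], Finset.sum_const,
    nsmul_eq_mul, mul_comm]

/-! ### Packet sizes -/

theorem mem_sufsAt {d n b m : ℕ} (hb : b + m = n) {σ : List (ℕ × ℕ)} :
    σ ∈ sufsAt d b m ↔ ∃ t τ, σ = (b, t) :: τ ∧ IsSuffixFrom d n b σ := by
  simp only [sufsAt, Finset.mem_image, Finset.mem_product, Finset.mem_Ico, Prod.exists,
    mem_sufs (n := n) m (b + 1) (by omega)]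
  constructor
  · rintro ⟨t, τ, ⟨h1, h2⟩, rfl⟩
    exact ⟨t, τ, rfl, isSuffixFrom_cons.2 ⟨⟨le_rfl, by simp only; omega, h1⟩, h2⟩⟩
  · rintro ⟨t, τ, rfl, h⟩
    obtain ⟨h1, h2⟩ := isSuffixFrom_cons.1 h
    exact ⟨t, τ, ⟨h1.2.2, h2⟩, rfl⟩

/-- The labels with first lower index `b`. -/
def labelsAt (d r n b : ℕ) : Finset (List (ℕ × ℕ)) :=
  (sufsAt d b (n - b)).filter fun σ => (expSum σ : ZMod r) = 0

/-- The labels with a single lower index `b`. -/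
def labelsSingle (d r b : ℕ) : Finset (List (ℕ × ℕ)) := labelsAt d r b b

theorem mem_labelsAt {d r n : ℕ} {b : ℕ} (hb : b ≤ n) {σ : List (ℕ × ℕ)} :
    σ ∈ labelsAt d r n b ↔ (∃ t τ, σ = (b, t) :: τ) ∧ IsSuffixFrom d n b σ ∧ r ∣ expSum σ := by
  rw [labelsAt, Finset.mem_filter, mem_sufsAt (n := n) (by omega), ZMod.natCast_eq_zero_iff]
  simp only [← exists_and_right, and_assoc]

theorem mem_labelsSingle {d r n : ℕ} {b : ℕ} (hb : b ≤ n) {σ : List (ℕ × ℕ)} :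
    σ ∈ labelsSingle d r b ↔ (∃ t, σ = [(b, t)]) ∧ IsSuffixFrom d n b σ ∧ r ∣ expSum σ := by
  rw [labelsSingle, mem_labelsAt le_rfl]
  constructor
  · rintro ⟨⟨t, τ, rfl⟩, h, h'⟩
    obtain ⟨h1, h2⟩ := isSuffixFrom_cons.1 h
    cases τ with
    | nil => exact ⟨⟨t, rfl⟩, isSuffixFrom_cons.2 ⟨⟨h1.1, hb, h1.2.2⟩, isSuffixFrom_nil _ _ _⟩, h'⟩
    | cons y τ => obtain ⟨h3, _⟩ := isSuffixFrom_cons.1 h2; simp only at h3; omega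
  · rintro ⟨⟨t, rfl⟩, h, h'⟩
    obtain ⟨h1, h2⟩ := isSuffixFrom_cons.1 h
    exact ⟨⟨t, [], rfl⟩, isSuffixFrom_cons.2 ⟨⟨h1.1, le_rfl, h1.2.2⟩, isSuffixFrom_nil _ _ _⟩, h'⟩

theorem mul_card_labelsAt {d r n : ℕ} (hd : 0 < d) (hr : r ∣ d) {b : ℕ} (hb : b < n) :
    (r : ℚ) * (labelsAt d r n b).card = d ^ (n - b + 1) - d ^ (n - b) := by
  have h1 := resCount_succ d r b (n - b) 0
  have h2 := mul_resCount hd hr (n - b) b 0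
  have h3 := mul_resCount hd hr (n - b - 1) (b + 1) 0
  rw [show n - b - 1 + 1 = n - b by omega] at h3
  rw [h1] at h2
  rw [labelsAt, eq_sub_iff_add_eq, add_comm]
  exact_mod_cast (by rw [← h2, mul_add, h3])

theorem mul_card_labelsSingle {d r : ℕ} (hd : 0 < d) (hr : r ∣ d) (b : ℕ) :
    (r : ℚ) * (labelsSingle d r b).card = d - r := by
  have h1 := resCount_succ d r b 0 0
  have h2 := mul_resCount hd hr 0 b 0
  rw [h1, resCount_zero, if_pos rfl] at h2
  rw [labelsSingle, labelsAt, Nat.sub_self, eq_sub_iff_add_eq, add_comm]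
  exact_mod_cast (by rw [mul_add, mul_one, pow_one] at h2; exact h2)

/-- The sizes of the packets. -/
theorem mul_card_packet {d r n : ℕ} (hd : 0 < d) (hr : r ∣ d) (hn : 3 ≤ n) {k : ℕ} (hk : k ≤ n) :
    (r : ℚ) * ((labels d r n).filter fun σ => packetIndex n σ = k).card =
      if k = n then (r : ℚ) else if k + 1 = n then 2 * ((d : ℚ) - r)
      else (d : ℚ) * (d - 1) * d ^ (n - 2 - k) - if k = 0 then (d : ℚ) - r else 0 := by
  have hmem : ∀ σ, σ ∈ (labels d r n).filter (fun σ => packetIndex n σ = k) ↔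
      IsSuffixFrom d n 1 σ ∧ r ∣ expSum σ ∧ packetIndex n σ = k := by
    intro σ
    rw [Finset.mem_filter, mem_labels, and_assoc, isSuffixFrom_one]
  have hsub : ∀ b, b ≤ n → labelsSingle d r b ⊆ labelsAt d r n b := by
    intro b hb σ hσ
    rw [mem_labelsSingle hb] at hσ
    obtain ⟨⟨t, rfl⟩, h⟩ := hσ
    exact (mem_labelsAt hb).2 ⟨⟨t, [], rfl⟩, h⟩
  have hlong : ∀ b, 1 ≤ b → b < n →
      (r : ℚ) * (labelsAt d r n b \ labelsSingle d r b).card =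
        d ^ (n - b + 1) - d ^ (n - b) - (d - r) := by
    intro b hb hbn
    rw [Finset.cast_card_sdiff (hsub b hbn.le), mul_sub, mul_card_labelsAt hd hr hbn,
      mul_card_labelsSingle hd hr]
  have hmemlong : ∀ b, 1 ≤ b → b ≤ n → ∀ σ, σ ∈ labelsAt d r n b \ labelsSingle d r b ↔
      (∃ t y τ, σ = (b, t) :: y :: τ) ∧ IsSuffixFrom d n 1 σ ∧ r ∣ expSum σ := by
    intro b hb hbn σ
    rw [Finset.mem_sdiff, mem_labelsAt hbn, mem_labelsSingle hbn]
    constructor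
    · rintro ⟨⟨⟨t, τ, rfl⟩, h1, h2⟩, h3⟩
      cases τ with
      | nil => exact absurd ⟨⟨t, rfl⟩, h1, h2⟩ h3
      | cons y τ => exact ⟨⟨t, y, τ, rfl⟩, h1.mono hb, h2⟩
    · rintro ⟨⟨t, y, τ, rfl⟩, h1, h2⟩
      obtain ⟨h3, h4⟩ := isSuffixFrom_cons.1 h1
      exact ⟨⟨⟨t, _, rfl⟩, isSuffixFrom_cons.2 ⟨⟨le_rfl, h3.2⟩, h4⟩, h2⟩, by simp⟩
  have hmemsingle : ∀ b, 1 ≤ b → b ≤ n → ∀ σ, σ ∈ labelsSingle d r b ↔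
      (∃ t, σ = [(b, t)]) ∧ IsSuffixFrom d n 1 σ ∧ r ∣ expSum σ := by
    intro b hb hbn σ
    rw [mem_labelsSingle hbn]
    constructor
    · rintro ⟨h1, h2, h3⟩
      exact ⟨h1, h2.mono hb, h3⟩
    · rintro ⟨⟨t, rfl⟩, h2, h3⟩
      obtain ⟨h4, h5⟩ := isSuffixFrom_cons.1 h2
      exact ⟨⟨t, rfl⟩, isSuffixFrom_cons.2 ⟨⟨le_rfl, h4.2⟩, h5⟩, h3⟩
  have hcases : ∀ σ : List (ℕ × ℕ), σ = [] ∨ (∃ b t, σ = [(b, t)]) ∨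
      ∃ b t y τ, σ = (b, t) :: y :: τ := by
    intro σ
    match σ with
    | [] => simp
    | [(b, t)] => simp
    | (b, t) :: y :: τ => simp
  have hsuf : ∀ {b t τ}, IsSuffixFrom d n 1 ((b, t) :: τ) → 1 ≤ b ∧ b ≤ n :=
    fun h => ⟨(isSuffixFrom_cons.1 h).1.1, (isSuffixFrom_cons.1 h).1.2.1⟩
  have hsuf2 : ∀ {b t y τ}, IsSuffixFrom d n 1 ((b, t) :: y :: τ) → b + 1 ≤ n := by
    intro b t y τ h
    have h1 := (isSuffixFrom_cons.1 (isSuffixFrom_cons.1 h).2).1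
    simp only at h1
    omega
  split_ifs with h1 h2 h3
  · have : (labels d r n).filter (fun σ => packetIndex n σ = k) = {[]} := by
      ext σ
      rw [hmem, Finset.mem_singleton]
      constructor
      · rintro ⟨h3, h4, h5⟩
        rcases hcases σ with rfl | ⟨b, t, rfl⟩ | ⟨b, t, y, τ, rfl⟩
        · rfl
        · simp only [packetIndex] at h5; omega
        · have := hsuf h3
          simp only [packetIndex] at h5; omega
      · rintro rfl
        exact ⟨isSuffixFrom_nil _ _ _, by simp [expSum], h1.symm⟩
    rw [this, Finset.card_singleton]
    simp
  · have : (labels d r n).filter (fun σ => packetIndex n σ = k) =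
        labelsSingle d r n ∪ labelsSingle d r (n - 1) := by
      ext σ
      rw [hmem, Finset.mem_union, hmemsingle n (by omega) le_rfl,
        hmemsingle (n - 1) (by omega) (by omega)]
      rcases hcases σ with rfl | ⟨b, t, rfl⟩ | ⟨b, t, y, τ, rfl⟩
      · simp [packetIndex]; omega
      · rw [← or_and_right, and_comm (b := IsSuffixFrom _ _ _ _ ∧ _), and_assoc]
        refine and_congr_right fun h4 => and_congr_right fun _ => ?_
        have := hsuf h4
        simp [packetIndex]
        omega
      · simp only [packetIndex]
        constructor
        · rintro ⟨h4, _, h5⟩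
          have := hsuf2 h4
          omega
        · simp
    rw [this, Finset.card_union_of_disjoint, Nat.cast_add, mul_add, mul_card_labelsSingle hd hr,
      mul_card_labelsSingle hd hr]
    · ring
    · rw [Finset.disjoint_left]
      intro σ h4 h5
      obtain ⟨⟨t, rfl⟩, _⟩ := (hmemsingle n (by omega) le_rfl _).1 h4
      obtain ⟨⟨t', h6⟩, _⟩ := (hmemsingle (n - 1) (by omega) (by omega) _).1 h5
      simp at h6
      omega
  -- For k = 0 there are no single factors of index k; the lost d - r is the correction term.
  · have : (labels d r n).filter (fun σ => packetIndex n σ = k) =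
        labelsAt d r n 1 \ labelsSingle d r 1 := by
      ext σ
      rw [hmem, hmemlong 1 le_rfl (by omega), h3]
      rcases hcases σ with rfl | ⟨b, t, rfl⟩ | ⟨b, t, y, τ, rfl⟩
      · simp [packetIndex]; omega
      · constructor
        · rintro ⟨h4, _, h5⟩
          have := hsuf h4
          simp only [packetIndex] at h5
          omega
        · simp
      · rw [and_comm (b := IsSuffixFrom _ _ _ _ ∧ _), and_assoc]
        refine and_congr_right fun h4 => and_congr_right fun _ => ?_
        have := hsuf h4
        simp [packetIndex]
        omega
    rw [this, hlong 1 le_rfl (by omega), h3]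
    obtain ⟨m, rfl⟩ : ∃ m, n = m + 2 := ⟨n - 2, by omega⟩
    rw [show m + 2 - 1 = m + 1 by omega, show m + 2 - 2 - 0 = m by omega]
    ring
  -- The single factors of index k replace in number the removed single factors of index k + 1.
  · have : (labels d r n).filter (fun σ => packetIndex n σ = k) =
        (labelsAt d r n (k + 1) \ labelsSingle d r (k + 1)) ∪ labelsSingle d r k := by
      ext σ
      rw [hmem, Finset.mem_union, hmemlong (k + 1) (by omega) (by omega),
        hmemsingle k (by omega) (by omega)]
      rcases hcases σ with rfl | ⟨b, t, rfl⟩ | ⟨b, t, y, τ, rfl⟩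
      · simp [packetIndex]; omega
      · rw [← or_and_right, and_comm (b := IsSuffixFrom _ _ _ _ ∧ _), and_assoc]
        refine and_congr_right fun h4 => and_congr_right fun _ => ?_
        have := hsuf h4
        simp [packetIndex]
        omega
      · rw [← or_and_right, and_comm (b := IsSuffixFrom _ _ _ _ ∧ _), and_assoc]
        refine and_congr_right fun h4 => and_congr_right fun _ => ?_
        have := hsuf h4
        simp [packetIndex]
        omega
    rw [this, Finset.card_union_of_disjoint, Nat.cast_add, mul_add, mul_card_labelsSingle hd hr,
      hlong (k + 1) (by omega) (by omega)]
    · obtain ⟨m, rfl⟩ : ∃ m, n = m + k + 2 := ⟨n - 2 - k, by omega⟩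
      rw [show m + k + 2 - (k + 1) = m + 1 by omega, show m + k + 2 - 2 - k = m by omega]
      ring
    · rw [Finset.disjoint_left]
      intro σ h4 h5
      obtain ⟨⟨t, y, τ, rfl⟩, _⟩ := (hmemlong (k + 1) (by omega) (by omega) _).1 h4
      obtain ⟨⟨t', h6⟩, _⟩ := (hmemsingle k (by omega) (by omega) _).1 h5
      simp at h6

/-- The packets with k ≤ n - 2 give the polynomial, except for the correction at k = 0, weighted by
1. The last two have the common weight C_n and sizes 2(d/r - 1) and 1. -/
theorem sum_packet {d r n : ℕ} (hd : 0 < d) (hr : r ∣ d) (hn : 3 ≤ n) :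
    ∑ k ∈ Finset.range (n + 1), catalanTriangle n k * ((packet d r n hd hr hn k).ncard : ℚ) =
      (d : ℚ) * ((d : ℚ) - 1) / (r : ℚ) * (catalanTrianglePoly n (n - 2)).eval (d : ℚ) +
        (2 * (d : ℚ) / (r : ℚ) - 1) * (catalan n : ℚ) - ((d : ℚ) / (r : ℚ) - 1) := by
  have hr0 : (r : ℚ) ≠ 0 := by exact_mod_cast (Nat.pos_of_dvd_of_pos hr hd).ne'
  have hN : ∀ k, k ≤ n → ((packet d r n hd hr hn k).ncard : ℚ) =
      (if k = n then (r : ℚ) else if k + 1 = n then 2 * ((d : ℚ) - r)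
      else (d : ℚ) * (d - 1) * d ^ (n - 2 - k) - if k = 0 then (d : ℚ) - r else 0) / r := by
    intro k hk
    rw [eq_div_iff hr0, mul_comm, ncard_packet hd hr hn hk, mul_card_packet hd hr hn hk]
  obtain ⟨m, rfl⟩ : ∃ m, n = m + 2 := ⟨n - 2, by omega⟩
  have hsum : ∑ k ∈ Finset.range (m + 1), catalanTriangle (m + 2) k *
      ((packet d r (m + 2) hd hr hn k).ncard : ℚ) =
      (d : ℚ) * ((d : ℚ) - 1) / (r : ℚ) * (catalanTrianglePoly (m + 2) m).eval (d : ℚ) -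
        ((d : ℚ) / r - 1) := by
    have h1 : ∀ k ∈ Finset.range (m + 1), catalanTriangle (m + 2) k *
        ((packet d r (m + 2) hd hr hn k).ncard : ℚ) =
        (d : ℚ) * ((d : ℚ) - 1) / (r : ℚ) * (catalanTriangle (m + 2) k * (d : ℚ) ^ (m - k)) -
          if k = 0 then ((d : ℚ) / r - 1) else 0 := by
      intro k hk
      rw [Finset.mem_range] at hk
      rw [hN k (by omega), if_neg (by omega), if_neg (by omega), show m + 2 - 2 - k = m - k by omega]
      split_ifs with h0
      · rw [h0, catalanTriangle_zero]
        field_simp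
      · rw [sub_zero, sub_zero]
        ring
    rw [Finset.sum_congr rfl h1, Finset.sum_sub_distrib, ← Finset.mul_sum, Finset.sum_ite_eq',
      if_pos (by simp), catalanTrianglePoly, Polynomial.eval_finsetSum]
    simp
  rw [Finset.sum_range_succ, Finset.sum_range_succ, hsum, hN (m + 1) (by omega), hN (m + 2) le_rfl,
    if_neg (by omega), if_pos rfl, if_pos rfl, ← catalanTriangle_diag, catalanTriangle_self,
    show m + 2 - 2 = m by omega]
  field_simp
  ring

end ComplexReflection

theorem corollary5p4 (d r n : ℕ) (hd : 0 < d) (hr : r ∣ d) (hn : 3 ≤ n) :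
    (Nat.card {w : ComplexReflection.G d r n //
        ComplexReflection.IsFullyCommutative d n (ComplexReflection.tau d r n hd hr hn w)} : ℚ) =
      ∑ k ∈ Finset.range (n + 1), ComplexReflection.catalanTriangle n k *
        ((ComplexReflection.packet d r n hd hr hn k).ncard : ℚ) ∧
    ∑ k ∈ Finset.range (n + 1), ComplexReflection.catalanTriangle n k *
        ((ComplexReflection.packet d r n hd hr hn k).ncard : ℚ) =
      (d : ℚ) * ((d : ℚ) - 1) / (r : ℚ) *
          (ComplexReflection.catalanTrianglePoly n (n - 2)).eval (d : ℚ) +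
        (2 * (d : ℚ) / (r : ℚ) - 1) * (catalan n : ℚ) - ((d : ℚ) / (r : ℚ) - 1) :=
  ⟨ComplexReflection.card_eq_sum_packet hd hr hn, ComplexReflection.sum_packet hd hr hn⟩
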